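/- Let $S^1=\mathbb{R}/\mathbb{Z}$. Let $C^\infty(S^1)$ be the Fréchet space of real smooth functions on $S^1$, with the topology given by the norms $\|u\|_{C^n}=\sum_{k\le n}\sup|u^{(k)}|$, $n\ge 0$. Let $\mathrm{Diff}^\infty(S^1)$ be the group of smooth orientation-preserving diffeomorphisms of $S^1$, a Fréchet manifold through the two charts $\varphi\mapsto w$, where $\mathrm{id}+w$ is the lift of $\varphi$ to $\mathbb{R}$ with $-\tfrac12<w(0)<\tfrac12$, respectively $0<w(0)<1$. A map between open subsets of Fréchet spaces is called smooth if its iterated directional derivatives of all orders exist and are jointly continuous in the point and the directions; smoothness of maps into $\mathrm{Diff}^\infty(S^1)$ is tested in the charts. Let $b\in\mathbb{R}$, let $A=I-\frac{d^2}{dx^2}$ (an invertible linear operator on $C^\infty(S^1)$), let $$P(u)=A^{-1}\left[3u_xu_{xx}+b\,(Au)\,u_x\right],$$ and for $\varphi\in\mathrm{Diff}^\infty(S^1)$ let $P_\varphi(v)=P(v\circ\varphi^{-1})\circ\varphi$. Consider the geodesic system of the $b$-equation $$\varphi_t=v,\qquad v_t=-P_\varphi(v). \tag{1}$$ Theorem.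 There exist an open interval $J$ centered at $0$ and a $\delta>0$ such that for each $u_0\in C^\infty(S^1)$ with $\|u_0\|_{C^3}<\delta$ there exists a unique solution $(\varphi,v)\in C^\infty\big(J,\mathrm{Diff}^\infty(S^1)\times C^\infty(S^1)\big)$ of (1) such that $\varphi(0)=\mathrm{id}$ and $v(0)=u_0$. Moreover, the map $(t,u_0)\mapsto(\varphi(t),v(t))$ is smooth from $J\times\{u_0\in C^\infty(S^1):\|u_0\|_{C^3}<\delta\}$ to $\mathrm{Diff}^\infty(S^1)\times C^\infty(S^1)$. -/

import Mathlib

open Set Filter Topology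
open scoped ContDiff

/-! ### Smooth maps between topological vector spaces, in the sense of directional derivatives -/

section Frechet

variable {X Y : Type*} [AddCommGroup X] [Module ℝ X] [TopologicalSpace X]
  [AddCommGroup Y] [Module ℝ Y] [TopologicalSpace Y]

/-- `y` is the directional (Gâteaux) derivative of `f` at `x` in the direction `h`:
`y = lim_{ε → 0} (f (x + ε h) - f x) / ε`. -/
def HasDirDeriv (f : X → Y) (x h : X) (y : Y) : Prop :=
  Tendsto (fun ε : ℝ => ε⁻¹ • (f (x + ε • h) - f x)) (𝓝[≠] 0) (𝓝 y)

/-- Smoothness, in the Fréchet (Michal-Bastiani, Hamilton) sense, of a map `f` on an open set `U`: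
all the iterated directional derivatives
`D n x (h₁, …, hₙ) = Dⁿf(x){h₁, …, hₙ}` exist at the points `x` of `U`, and each of them is jointly
continuous in `(x, h₁, …, hₙ)` on `U × Xⁿ`. -/
def FrechetSmoothOn (f : X → Y) (U : Set X) : Prop :=
  ∃ D : (n : ℕ) → X → (Fin n → X) → Y,
    (∀ x ∈ U, ∀ h : Fin 0 → X, D 0 x h = f x) ∧
    (∀ n, ∀ x ∈ U, ∀ h : Fin n → X, ∀ k : X,
      HasDirDeriv (fun y => D n y h) x k (D (n + 1) x (Fin.snoc h k))) ∧
    (∀ n, ContinuousOn (fun p : X × (Fin n → X) => D n p.1 p.2) (U ×ˢ univ))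

end Frechet

/-! ### The Fréchet space of smooth functions on the circle `ℝ / ℤ` -/

/-- The algebra of the functions on the circle `ℝ / ℤ` whose pull-back to `ℝ` is smooth. -/
def smoothSubalgebra : Subalgebra ℝ (UnitAddCircle → ℝ) where
  carrier := {u | ContDiff ℝ ∞ (fun x : ℝ => u (x : UnitAddCircle))}
  mul_mem' := fun {u v} (hu : ContDiff ℝ ∞ fun x : ℝ => u (x : UnitAddCircle))
    (hv : ContDiff ℝ ∞ fun x : ℝ => v (x : UnitAddCircle)) => hu.mul hv
  add_mem' := fun {u v} (hu : ContDiff ℝ ∞ fun x : ℝ => u (x : UnitAddCircle))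
    (hv : ContDiff ℝ ∞ fun x : ℝ => v (x : UnitAddCircle)) => hu.add hv
  algebraMap_mem' := fun c => (contDiff_const : ContDiff ℝ ∞ fun _ : ℝ => c)

/-- The space `C^∞(S¹)` of real smooth functions on the circle `S¹ = ℝ / ℤ`. It is a type of its
own, so that it does not inherit the topology of pointwise convergence. -/
def SmoothCircle : Type := smoothSubalgebra

namespace SmoothCircle

instance : CommRing SmoothCircle := inferInstanceAs (CommRing smoothSubalgebra)

instance : Algebra ℝ SmoothCircle := inferInstanceAs (Algebra ℝ smoothSubalgebra)

instance : CoeFun SmoothCircle (fun _ => UnitAddCircle → ℝ) := ⟨fun u => u.1⟩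

/-- The pull-back of a smooth function on the circle is smooth. -/
theorem contDiff (u : SmoothCircle) : ContDiff ℝ ∞ (fun x : ℝ => u (x : UnitAddCircle)) := u.2

theorem ext_real {u v : SmoothCircle}
    (h : ∀ x : ℝ, u (x : UnitAddCircle) = v (x : UnitAddCircle)) : u = v := by
  apply Subtype.ext
  funext y
  induction y using QuotientAddGroup.induction_on with
  | H x => exact h x

/-- A smooth `1`-periodic function, seen as a smooth function on the circle. -/
def ofPeriodic (f : ℝ → ℝ) (hf : ContDiff ℝ ∞ f) (hp : Function.Periodic f 1) : SmoothCircle :=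
  ⟨hp.lift, hf⟩

theorem ofPeriodic_coe (f : ℝ → ℝ) (hf : ContDiff ℝ ∞ f) (hp : Function.Periodic f 1) (x : ℝ) :
    ofPeriodic f hf hp (x : UnitAddCircle) = f x := rfl

theorem periodic (u : SmoothCircle) :
    Function.Periodic (fun x : ℝ => u (x : UnitAddCircle)) 1 := by
  intro x
  have h : ((x + 1 : ℝ) : UnitAddCircle) = (x : UnitAddCircle) := AddCircle.coe_add_period 1 x
  simp only [h]

theorem deriv_periodic (u : SmoothCircle) :
    Function.Periodic (deriv fun x : ℝ => u (x : UnitAddCircle)) 1 := by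
  intro x
  rw [← deriv_comp_add_const]
  congr 1
  funext y
  exact u.periodic y

/-- The derivative `u ↦ u_x` on `C^∞(S¹)`. -/
noncomputable def deriv : SmoothCircle →ₗ[ℝ] SmoothCircle where
  toFun u := ofPeriodic (_root_.deriv fun x : ℝ => u (x : UnitAddCircle))
    (contDiff_infty_iff_deriv.1 u.contDiff).2 u.deriv_periodic
  map_add' u v := ext_real fun x =>
    deriv_fun_add (u.contDiff.differentiable (by simp) x) (v.contDiff.differentiable (by simp) x)
  map_smul' c u := ext_real fun x =>
    deriv_const_mul (d := fun x : ℝ => u (x : UnitAddCircle)) c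
      (u.contDiff.differentiable (by simp) x)

theorem hasDerivAt (u : SmoothCircle) (x : ℝ) :
    HasDerivAt (fun x : ℝ => u (x : UnitAddCircle)) (deriv u (x : UnitAddCircle)) x :=
  (u.contDiff.differentiable (by simp) x).hasDerivAt

/-- The continuous function underlying a smooth function on the circle. -/
def toContinuousMap (u : SmoothCircle) : C(UnitAddCircle, ℝ) :=
  ⟨u, continuous_coinduced_dom.2 u.contDiff.continuous⟩

/-- The `Cⁿ`-norm `∑_{k ≤ n} sup_x |u^{(k)}(x)|`. -/
noncomputable def cNorm (n : ℕ) (u : SmoothCircle) : ℝ :=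
  ∑ k ∈ Finset.range (n + 1), ‖toContinuousMap (deriv^[k] u)‖

/-- The Fréchet topology of `C^∞(S¹)`: uniform convergence of the derivatives of every order, that
is, convergence in all the `Cⁿ`-norms. -/
noncomputable instance : TopologicalSpace SmoothCircle :=
  TopologicalSpace.induced
    (fun u => fun k : ℕ => toContinuousMap (deriv^[k] u)) Pi.topologicalSpace

/-! ### The operator `A = I - d²/dx²` and its inverse -/

/-- The linear differential operator `A = I - d²/dx²` on `C^∞(S¹)`. -/
noncomputable def opA : SmoothCircle →ₗ[ℝ] SmoothCircle :=
  LinearMap.id - deriv.comp deriv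

/-- For `c ≠ 0` the equation `g' = c g` has no nonzero solution on the circle. -/
theorem eq_zero_of_deriv_eq {c : ℝ} (hc : c ≠ 0) {g : SmoothCircle} (h : deriv g = c • g) :
    g = 0 := by
  have hg : ∀ x : ℝ, deriv g (x : UnitAddCircle) = c * g (x : UnitAddCircle) := fun x => by
    rw [h]; rfl
  have hd : ∀ x : ℝ, HasDerivAt
      (fun x : ℝ => Real.exp (-(c * x)) * g (x : UnitAddCircle)) 0 x := by
    intro x
    have h1 : HasDerivAt (fun x : ℝ => Real.exp (-(c * x))) (Real.exp (-(c * x)) * (-(c * 1))) x :=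
      (((hasDerivAt_id x).const_mul c).neg).exp
    have h2 := h1.mul (g.hasDerivAt x)
    rw [hg x] at h2
    exact h2.congr_deriv (by ring)
  have hconst : ∀ x y : ℝ, Real.exp (-(c * x)) * g (x : UnitAddCircle)
      = Real.exp (-(c * y)) * g (y : UnitAddCircle) :=
    is_const_of_deriv_eq_zero (fun x => (hd x).differentiableAt) (fun x => (hd x).deriv)
  apply ext_real
  intro x
  have h1 := hconst (x + 1) x
  have h2 : g ((x + 1 : ℝ) : UnitAddCircle) = g (x : UnitAddCircle) := g.periodic x
  rw [h2] at h1
  by_contra hne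
  have h3 := mul_right_cancel₀ hne h1
  have h4 := Real.exp_injective h3
  apply hc
  linarith

/-- For `c ≠ 0` the equation `g' - c g = f` is solvable on the circle. -/
theorem exists_deriv_sub {c : ℝ} (hc : c ≠ 0) (f : SmoothCircle) :
    ∃ g : SmoothCircle, deriv g - c • g = f := by
  set F : ℝ → ℝ := fun s => Real.exp (-(c * s)) * f (s : UnitAddCircle) with hF
  have hFs : ContDiff ℝ ∞ F := by
    exact (contDiff_const.mul contDiff_id).neg.exp.mul f.contDiff
  set I : ℝ → ℝ := fun x => ∫ s in (0 : ℝ)..x, F s with hI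
  have hId : ∀ x, HasDerivAt I (F x) x := fun x =>
    intervalIntegral.integral_hasDerivAt_right (hFs.continuous.intervalIntegrable _ _)
      (hFs.continuous.stronglyMeasurableAtFilter _ _) hFs.continuous.continuousAt
  have hIs : ContDiff ℝ ∞ I := by
    rw [contDiff_infty_iff_deriv]
    refine ⟨fun x => (hId x).differentiableAt, ?_⟩
    rw [show _root_.deriv I = F from funext fun x => (hId x).deriv]
    exact hFs
  have hI1 : ∀ x, I (x + 1) = I 1 + Real.exp (-c) * I x := by
    intro x
    have e1 : I (x + 1) = I 1 + ∫ s in (1 : ℝ)..(x + 1), F s :=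
      (intervalIntegral.integral_add_adjacent_intervals
        (hFs.continuous.intervalIntegrable _ _) (hFs.continuous.intervalIntegrable _ _)).symm
    have e2 : ∫ s in (1 : ℝ)..(x + 1), F s = ∫ s in (0 : ℝ)..x, F (s + 1) := by
      rw [intervalIntegral.integral_comp_add_right, zero_add]
    have e3 : ∀ s, F (s + 1) = Real.exp (-c) * F s := by
      intro s
      have : f ((s + 1 : ℝ) : UnitAddCircle) = f (s : UnitAddCircle) := f.periodic s
      simp only [hF, this]
      rw [← mul_assoc, ← Real.exp_add]
      ring_nf
    rw [e1, e2]
    simp only [e3, intervalIntegral.integral_const_mul, hI]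
  have hne : 1 - Real.exp c ≠ 0 := by
    intro h
    apply hc
    have : Real.exp c = 1 := by linarith
    exact (Real.exp_eq_one_iff c).1 this
  set K : ℝ := Real.exp c * I 1 / (1 - Real.exp c) with hK
  have hK' : Real.exp c * (K + I 1) = K := by
    rw [hK]; field_simp; ring
  have hs : ContDiff ℝ ∞ (fun x : ℝ => Real.exp (c * x) * (K + I x)) := by fun_prop
  have hp : Function.Periodic (fun x : ℝ => Real.exp (c * x) * (K + I x)) 1 := by
    intro x
    have e : Real.exp (c * (x + 1)) = Real.exp (c * x) * Real.exp c := by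
      rw [← Real.exp_add]; ring_nf
    have e' : Real.exp c * Real.exp (-c) = 1 := by rw [← Real.exp_add]; simp
    simp only [hI1, e]
    calc Real.exp (c * x) * Real.exp c * (K + (I 1 + Real.exp (-c) * I x))
        = Real.exp (c * x) * (Real.exp c * (K + I 1) + (Real.exp c * Real.exp (-c)) * I x) := by
          ring
      _ = _ := by rw [hK', e']; ring
  refine ⟨ofPeriodic _ hs hp, ext_real fun x => ?_⟩
  have hd : HasDerivAt (fun x : ℝ => Real.exp (c * x) * (K + I x))
      (Real.exp (c * x) * (c * 1) * (K + I x) + Real.exp (c * x) * (F x)) x :=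
    (((hasDerivAt_id x).const_mul c).exp).mul ((hId x).const_add K)
  have hd' : deriv (ofPeriodic _ hs hp) (x : UnitAddCircle)
      = Real.exp (c * x) * (c * 1) * (K + I x) + Real.exp (c * x) * (F x) := hd.deriv
  change deriv (ofPeriodic _ hs hp) (x : UnitAddCircle) - c * (Real.exp (c * x) * (K + I x))
    = f (x : UnitAddCircle)
  have e' : Real.exp (c * x) * Real.exp (-(c * x)) = 1 := by rw [← Real.exp_add]; simp
  rw [hd']
  calc _ = (Real.exp (c * x) * Real.exp (-(c * x))) * f (x : UnitAddCircle) := by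
        simp only [hF]; ring
    _ = _ := by rw [e', one_mul]

/-- The operator `A` is invertible on `C^∞(S¹)`. -/
theorem opA_bijective : Function.Bijective opA := by
  have hA : ∀ u, opA u = u - deriv (deriv u) := fun u => rfl
  constructor
  · rw [← LinearMap.ker_eq_bot, LinearMap.ker_eq_bot']
    intro u hu
    rw [hA, sub_eq_zero] at hu
    have h1 : deriv u + u = 0 := by
      apply eq_zero_of_deriv_eq one_ne_zero
      rw [map_add, ← hu, one_smul, add_comm]
    apply eq_zero_of_deriv_eq (c := -1) (by norm_num)
    rw [neg_one_smul]
    exact eq_neg_of_add_eq_zero_left h1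
  · intro f
    obtain ⟨g, hg⟩ := exists_deriv_sub (one_ne_zero (α := ℝ)) (-f)
    obtain ⟨u, hu⟩ := exists_deriv_sub (c := -1) (by norm_num) g
    refine ⟨u, ?_⟩
    rw [hA, ← neg_inj, ← hg, ← hu]
    simp only [map_sub, map_neg, one_smul, neg_one_smul]
    abel

/-- The operator `A = I - d²/dx²` as a linear automorphism of `C^∞(S¹)`. -/
noncomputable def opAEquiv : SmoothCircle ≃ₗ[ℝ] SmoothCircle :=
  LinearEquiv.ofBijective opA opA_bijective

/-- The operator `P(u) = A⁻¹ [3 u_x u_xx + b (A u) u_x]`. -/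
noncomputable def opP (b : ℝ) (u : SmoothCircle) : SmoothCircle :=
  opAEquiv.symm ((3 : ℝ) • (deriv u * deriv (deriv u)) + b • (opA u * deriv u))

end SmoothCircle

/-! ### The Fréchet manifold of orientation preserving diffeomorphisms of the circle -/

/-- The group `Diff^∞(S¹)` of smooth, orientation preserving diffeomorphisms of the circle
`S¹ = ℝ / ℤ`: bijections which have a smooth lift to `ℝ` with positive derivative, and whose inverse
has a smooth lift to `ℝ`. -/
structure DiffCircle extends UnitAddCircle ≃ UnitAddCircle where
  exists_lift : ∃ f : ℝ → ℝ, ContDiff ℝ ∞ f ∧ (∀ x, 0 < deriv f x) ∧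
    ∀ x : ℝ, toFun (x : UnitAddCircle) = (f x : UnitAddCircle)
  exists_lift_inv : ∃ g : ℝ → ℝ, ContDiff ℝ ∞ g ∧
    ∀ x : ℝ, invFun (x : UnitAddCircle) = (g x : UnitAddCircle)

namespace DiffCircle

/-- The identity diffeomorphism. -/
def id : DiffCircle where
  toEquiv := Equiv.refl _
  exists_lift := ⟨fun x => x, contDiff_id, fun x => by simp, fun _ => rfl⟩
  exists_lift_inv := ⟨fun x => x, contDiff_id, fun _ => rfl⟩

/-- Right composition `v ↦ v ∘ φ`. -/
def comp (v : SmoothCircle) (φ : DiffCircle) : SmoothCircle :=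
  ⟨fun y => v (φ.toEquiv y), by
    obtain ⟨f, hf, -, h⟩ := φ.exists_lift
    have : (fun x : ℝ => v (φ.toEquiv (x : UnitAddCircle))) =
        (fun x : ℝ => v (x : UnitAddCircle)) ∘ f := by
      funext x; exact congrArg v (h x)
    change ContDiff ℝ ∞ _
    rw [this]
    exact v.contDiff.comp hf⟩

/-- Right composition with the inverse, `v ↦ v ∘ φ⁻¹`. -/
def compInv (v : SmoothCircle) (φ : DiffCircle) : SmoothCircle :=
  ⟨fun y => v (φ.toEquiv.symm y), by
    obtain ⟨g, hg, h⟩ := φ.exists_lift_inv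
    have : (fun x : ℝ => v (φ.toEquiv.symm (x : UnitAddCircle)))
        = (fun x : ℝ => v (x : UnitAddCircle)) ∘ g := by
      funext x; exact congrArg v (h x)
    change ContDiff ℝ ∞ _
    rw [this]
    exact v.contDiff.comp hg⟩

/-- The conjugated operator `P_φ = R_φ ∘ P ∘ R_{φ⁻¹}`, where `R_φ v = v ∘ φ`. -/
noncomputable def opPConj (b : ℝ) (φ : DiffCircle) (v : SmoothCircle) : SmoothCircle :=
  comp (SmoothCircle.opP b (compInv v φ)) φ

/-- `w` is the coordinate of `φ` in the chart of index `j` of the two-chart atlas of `Diff^∞(S¹)`: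
`id + w` is a lift of `φ` with `-1/2 < w 0 < 1/2` (if `j = 0`), resp. `0 < w 0 < 1` (if `j = 1`).
The coordinate `w` is unique if it exists. -/
def IsCoord (j : Fin 2) (φ : DiffCircle) (w : SmoothCircle) : Prop :=
  (∀ x : ℝ, φ.toEquiv (x : UnitAddCircle) = ((x + w (x : UnitAddCircle) : ℝ) : UnitAddCircle)) ∧
    w 0 ∈ (if j = 0 then Ioo (-1 / 2) (1 / 2) else Ioo 0 1 : Set ℝ)

/-- A map `g` from an open subset `U` of a topological vector space to the Fréchet manifold
`Diff^∞(S¹)` is smooth: around each point of `U`, it takes its values in the domain of a chart, and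
its coordinate in that chart is smooth. -/
def SmoothOn {X : Type*} [AddCommGroup X] [Module ℝ X] [TopologicalSpace X]
    (g : X → DiffCircle) (U : Set X) : Prop :=
  ∀ x ∈ U, ∃ j : Fin 2, ∃ N : Set X, IsOpen N ∧ x ∈ N ∧ ∃ w : X → SmoothCircle,
    (∀ y ∈ N ∩ U, IsCoord j (g y) (w y)) ∧ FrechetSmoothOn w (N ∩ U)

/-- The curve `φ` in `Diff^∞(S¹)` has velocity `v` at time `t`: its coordinate in a chart around
`φ t` has the time derivative `v` (the changes of charts are translations by constants, so the
choice of the chart does not matter). -/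
def HasVelocity (φ : ℝ → DiffCircle) (t : ℝ) (v : SmoothCircle) : Prop :=
  ∃ j : Fin 2, ∃ w : ℝ → SmoothCircle,
    (∀ᶠ s in 𝓝 t, IsCoord j (φ s) (w s)) ∧ HasDirDeriv w t 1 v

/-- `(φ, v)` is a smooth curve `J → Diff^∞(S¹) × C^∞(S¹)` which solves the geodesic system
`φ_t = v`, `v_t = - P_φ(v)` with `φ(0) = id` and `v(0) = u₀`. -/
structure IsGeodesic (b : ℝ) (J : Set ℝ) (u₀ : SmoothCircle)
    (φ : ℝ → DiffCircle) (v : ℝ → SmoothCircle) : Prop where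
  smooth_fst : SmoothOn φ J
  smooth_snd : FrechetSmoothOn v J
  init_fst : φ 0 = id
  init_snd : v 0 = u₀
  eq_fst : ∀ t ∈ J, HasVelocity φ t (v t)
  eq_snd : ∀ t ∈ J, HasDirDeriv v t 1 (-opPConj b (φ t) (v t))

end DiffCircle

namespace SmoothCircle

/-! ### The jets of a smooth function on the circle -/

/-! After conjugation by `φ` the force loses no derivatives. Indeed `3 u_x u_xx + b (Au) u_x` is the
derivative of `f = (b/2) u² + ((3-b)/2) u_x²`, and `A = (1 - ∂)(1 + ∂)`, so `P(u)` is half the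
difference of `(1 - ∂)⁻¹ f` and `(1 + ∂)⁻¹ f`. For `φ = id + ξ` the conjugates of these resolvents
are `g ↦ e^ξ (1 - ∂)⁻¹ (e^{-ξ} φ_x g)` and `g ↦ e^{-ξ} (1 + ∂)⁻¹ (e^ξ φ_x g)`. Taking `v`, `u_x ∘
φ`, `e^{±ξ}`, `e^{∓ξ} φ_x` and `ξ` as independent unknowns, the system becomes an ordinary
differential equation whose right side `field` is polynomial, apart from two linear operators of
norm at most one. Such an equation makes sense in any Banach algebra carrying such operators, with
bounds that depend only on `b` (`boundedLip_field`).

The time interval must not shrink with the order `k` of differentiability. The submultiplicative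
norms `ckNorm l k` weight each derivative by a factor `l`, and tend to the sup norm as `l → 0`.
Hence `sup |u₀| < 1` and `sup |u₀'| < 1` give, for every `k`, a weight for which the data lie in the
unit ball, and one lifespan serves all `k` (`exists_ckNorm_lt`).

The Picard iterates are polynomials in time with smooth coefficients, and do not depend on `k` or
`l`. For each `(k, l)` the polynomials are completed for an `ℓ¹` norm. Rescaling time to length one
turns `t` into a parameter, and the fixed point is smooth in `(t, u₀, u₀')` by the implicit function
theorem (`exists_contDiffAt_picard`). Each jet of the solution is a continuous linear image of such
a fixed point (`jet_sol`), and smoothness of all jets gives smoothness into `C^∞(S¹)`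
(`frechetSmoothOn_of_jet`).

The relations between the seven unknowns hold initially, and their defects solve linear equations in
time, so they persist (`isCompatible_sol`); under them `field` is the true force
(`opPConj_eq_force`). Conversely a geodesic lifts to a curve of coordinates (`exists_lift_curve`),
its unknowns solve the same equation in the completion with `k = 0`, and uniqueness there gives
uniqueness of geodesics. -/

theorem coe_add (u v : SmoothCircle) (y : UnitAddCircle) : (u + v) y = u y + v y := rfl
theorem coe_sub (u v : SmoothCircle) (y : UnitAddCircle) : (u - v) y = u y - v y := rfl
theorem coe_neg (u : SmoothCircle) (y : UnitAddCircle) : (-u) y = -u y := rfl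
theorem coe_mul (u v : SmoothCircle) (y : UnitAddCircle) : (u * v) y = u y * v y := rfl
theorem coe_smul (c : ℝ) (u : SmoothCircle) (y : UnitAddCircle) : (c • u) y = c * u y := rfl
theorem coe_one (y : UnitAddCircle) : (1 : SmoothCircle) y = 1 := rfl

theorem deriv_mul (u v : SmoothCircle) : deriv (u * v) = deriv u * v + u * deriv v :=
  ext_real fun x => ((u.hasDerivAt x).mul (v.hasDerivAt x)).deriv

theorem deriv_one : deriv (1 : SmoothCircle) = 0 :=
  ext_real fun x => deriv_const x (1 : ℝ)

/-- A smooth function is determined by a periodic function and its derivative. -/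
theorem eq_deriv_of_hasDerivAt {u v : SmoothCircle}
    (h : ∀ x : ℝ, HasDerivAt (fun x : ℝ => u (x : UnitAddCircle)) (v (x : UnitAddCircle)) x) :
    deriv u = v :=
  ext_real fun x => (h x).deriv

/-- The `k`-th derivative, as a linear map into the continuous functions. -/
noncomputable def jet (k : ℕ) : SmoothCircle →ₗ[ℝ] C(UnitAddCircle, ℝ) where
  toFun u := toContinuousMap (deriv^[k] u)
  map_add' u v := by
    simp only [← Module.End.pow_apply, map_add]; rfl
  map_smul' c u := by
    simp only [← Module.End.pow_apply, map_smul]; rfl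

theorem jet_apply (k : ℕ) (u : SmoothCircle) (y : UnitAddCircle) :
    jet k u y = (deriv^[k] u) y := rfl

theorem jet_zero_apply (u : SmoothCircle) (y : UnitAddCircle) : jet 0 u y = u y := rfl

theorem jet_succ (k : ℕ) (u : SmoothCircle) : jet (k + 1) u = jet k (deriv u) := rfl

theorem jet_zero_mul (u v : SmoothCircle) : jet 0 (u * v) = jet 0 u * jet 0 v := rfl

theorem jet_zero_injective : Function.Injective (jet 0) := fun u v h =>
  ext_real fun x => by
    have := congrArg (fun f : C(UnitAddCircle, ℝ) => f (x : UnitAddCircle)) h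
    exact this

theorem isInducing_jet :
    IsInducing (fun (u : SmoothCircle) (k : ℕ) => jet k u) := ⟨rfl⟩

/-- All the jets at once. -/
noncomputable def jets : SmoothCircle →ₗ[ℝ] (ℕ → C(UnitAddCircle, ℝ)) :=
  LinearMap.pi jet

instance : IsTopologicalAddGroup SmoothCircle := topologicalAddGroup_induced jets

instance : ContinuousSMul ℝ SmoothCircle := continuousSMul_induced jets

theorem tendsto_nhds_iff {ι : Type*} {l : Filter ι} {f : ι → SmoothCircle} {y : SmoothCircle} :
    Tendsto f l (𝓝 y) ↔ ∀ k, Tendsto (fun i => jet k (f i)) l (𝓝 (jet k y)) := by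
  rw [isInducing_jet.tendsto_nhds_iff, tendsto_pi_nhds]
  rfl

theorem continuous_jet (k : ℕ) : Continuous (jet k) :=
  (continuous_apply k).comp isInducing_jet.continuous

theorem continuous_deriv : Continuous (deriv : SmoothCircle → SmoothCircle) :=
  isInducing_jet.continuous_iff.2 (continuous_pi fun k => continuous_jet (k + 1))

instance : T2Space SmoothCircle := by
  refine T2Space.of_injective_continuous (f := jet 0) jet_zero_injective (continuous_jet 0)

/-- Time derivatives in the Fréchet space reduce to ordinary derivatives in the Banach space
`C(S¹)`, one for each jet, where one-variable calculus is available. -/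
theorem hasDirDeriv_iff {c : ℝ → SmoothCircle} {t : ℝ} {d : SmoothCircle} :
    HasDirDeriv c t 1 d ↔ ∀ k, HasDerivAt (fun s => jet k (c s)) (jet k d) t := by
  unfold HasDirDeriv
  rw [tendsto_nhds_iff]
  refine forall_congr' fun k => ?_
  rw [hasDerivAt_iff_tendsto_slope_zero]
  simp

theorem hasDerivAt_jet (k : ℕ) (u : SmoothCircle) (x : ℝ) :
    HasDerivAt (fun x : ℝ => jet k u (x : UnitAddCircle)) (jet (k + 1) u (x : UnitAddCircle)) x := by
  rw [jet_apply, Function.iterate_succ_apply']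
  exact (deriv^[k] u).hasDerivAt x

theorem iterate_deriv_coe {u : SmoothCircle} {f : ℕ → ℝ → ℝ}
    (h0 : ∀ x : ℝ, u (x : UnitAddCircle) = f 0 x) (h : ∀ k x, HasDerivAt (f k) (f (k + 1) x) x)
    (k : ℕ) (x : ℝ) : (deriv^[k] u) (x : UnitAddCircle) = f k x := by
  induction k generalizing x with
  | zero => exact h0 x
  | succ k ih =>
    rw [Function.iterate_succ_apply']
    have h1 := (deriv^[k] u).hasDerivAt x
    rw [show (fun x : ℝ => (deriv^[k] u) (x : UnitAddCircle)) = f k from funext ih] at h1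
    exact h1.unique (h k x)

/-- Completeness of `C^∞(S¹)`: a sequence whose derivatives of each order converge uniformly
converges. -/
theorem exists_jet_eq {u : ℕ → SmoothCircle} {g : ℕ → C(UnitAddCircle, ℝ)}
    (h : ∀ k, Tendsto (fun n => jet k (u n)) atTop (𝓝 (g k))) :
    ∃ y : SmoothCircle, ∀ k, jet k y = g k := by
  have hd : ∀ k (x : ℝ), HasDerivAt (fun x : ℝ => g k (x : UnitAddCircle))
      (g (k + 1) (x : UnitAddCircle)) x := by
    intro k x
    have h1 : TendstoUniformly (fun n (x : ℝ) => jet (k + 1) (u n) (x : UnitAddCircle))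
        (fun x : ℝ => g (k + 1) (x : UnitAddCircle)) atTop :=
      (ContinuousMap.tendsto_iff_tendstoUniformly.1 (h (k + 1))).comp
        (fun x : ℝ => (x : UnitAddCircle))
    refine hasDerivAt_of_tendstoUniformly h1 (Eventually.of_forall fun n x => hasDerivAt_jet k _ x)
      (fun x => ?_) x
    exact ((ContinuousMap.tendsto_iff_tendstoUniformly.1 (h k)).tendsto_at (x : UnitAddCircle))
  have hsm : ∀ n : ℕ, ∀ k, ContDiff ℝ n (fun x : ℝ => g k (x : UnitAddCircle)) := by
    intro n
    induction n with
    | zero => exact fun k => contDiff_zero.2 (continuous_iff_continuousAt.2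
        fun x => (hd k x).continuousAt)
    | succ n ih =>
      intro k
      rw [show ((n + 1 : ℕ) : ℕ∞ω) = (n : ℕ∞ω) + 1 by norm_cast, contDiff_succ_iff_deriv]
      refine ⟨fun x => (hd k x).differentiableAt, by simp, ?_⟩
      rw [show _root_.deriv (fun x : ℝ => g k (x : UnitAddCircle))
        = fun x : ℝ => g (k + 1) (x : UnitAddCircle) from funext fun x => (hd k x).deriv]
      exact ih (k + 1)
  refine ⟨⟨g 0, contDiff_infty.2 fun n => hsm n 0⟩, fun k => ?_⟩
  ext y
  induction y using QuotientAddGroup.induction_on with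
  | H x => exact iterate_deriv_coe (f := fun k x => g k (x : UnitAddCircle)) (fun _ => rfl) hd k x

theorem exists_tendsto {u : ℕ → SmoothCircle} {g : ℕ → C(UnitAddCircle, ℝ)}
    (h : ∀ k, Tendsto (fun n => jet k (u n)) atTop (𝓝 (g k))) :
    ∃ y : SmoothCircle, Tendsto u atTop (𝓝 y) ∧ ∀ k, jet k y = g k := by
  obtain ⟨y, hy⟩ := exists_jet_eq h
  exact ⟨y, tendsto_nhds_iff.2 fun k => by rw [hy]; exact h k, hy⟩

/-! ### A family of submultiplicative `C^k`-norms -/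

/-- The norm `∑_{j ≤ k} (k choose j) l^j sup |u^{(j)}|`. -/
noncomputable def ckNorm (l : ℝ) : ℕ → SmoothCircle → ℝ
  | 0, u => ‖jet 0 u‖
  | k + 1, u => ckNorm l k u + l * ckNorm l k (deriv u)

section ckNorm

variable {l : ℝ}

theorem ckNorm_nonneg (hl : 0 ≤ l) (k : ℕ) (u : SmoothCircle) : 0 ≤ ckNorm l k u := by
  induction k generalizing u with
  | zero => exact norm_nonneg _
  | succ k ih => exact add_nonneg (ih u) (mul_nonneg hl (ih _))

theorem ckNorm_zero (k : ℕ) : ckNorm l k 0 = 0 := by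
  induction k with
  | zero => simp [ckNorm]
  | succ k ih => simp [ckNorm, ih]

theorem ckNorm_one (k : ℕ) : ckNorm l k 1 = 1 := by
  induction k with
  | zero =>
    rw [ckNorm, show jet 0 (1 : SmoothCircle) = 1 from rfl, norm_one]
  | succ k ih => simp [ckNorm, ih, deriv_one, ckNorm_zero]

theorem ckNorm_smul (k : ℕ) (c : ℝ) (u : SmoothCircle) :
    ckNorm l k (c • u) = |c| * ckNorm l k u := by
  induction k generalizing u with
  | zero => simp [ckNorm, norm_smul]
  | succ k ih => simp only [ckNorm, map_smul, ih]; ring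

theorem ckNorm_add_le (hl : 0 ≤ l) (k : ℕ) (u v : SmoothCircle) :
    ckNorm l k (u + v) ≤ ckNorm l k u + ckNorm l k v := by
  induction k generalizing u v with
  | zero => simpa [ckNorm] using norm_add_le _ _
  | succ k ih =>
    simp only [ckNorm, map_add]
    linarith [ih u v, mul_le_mul_of_nonneg_left (ih (deriv u) (deriv v)) hl]

/-- Induction with the Leibniz rule: the binomial weights make the right side at order `k + 1` equal
to the product of `‖u‖ + l ‖u'‖` and `‖v‖ + l ‖v'‖`, whose extra term `l² ‖u'‖ ‖v'‖` is nonnegative.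
The constant is exactly one, as a Banach algebra norm requires. -/
theorem ckNorm_mul_le (hl : 0 ≤ l) (k : ℕ) (u v : SmoothCircle) :
    ckNorm l k (u * v) ≤ ckNorm l k u * ckNorm l k v := by
  induction k generalizing u v with
  | zero => simpa [ckNorm, jet_zero_mul] using norm_mul_le _ _
  | succ k ih =>
    simp only [ckNorm, deriv_mul]
    have h1 := ckNorm_add_le hl k (deriv u * v) (u * deriv v)
    have h2 := ih (deriv u) v
    have h3 := ih u (deriv v)
    have h4 := mul_le_mul_of_nonneg_left (h1.trans (add_le_add h2 h3)) hl
    have h5 : 0 ≤ l * ckNorm l k (deriv u) * (l * ckNorm l k (deriv v)) :=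
      mul_nonneg (mul_nonneg hl (ckNorm_nonneg hl k _)) (mul_nonneg hl (ckNorm_nonneg hl k _))
    nlinarith [ih u v]

theorem norm_jet_le_ckNorm (hl : 0 ≤ l) (k : ℕ) (u : SmoothCircle) :
    l ^ k * ‖jet k u‖ ≤ ckNorm l k u := by
  induction k generalizing u with
  | zero => simp [ckNorm]
  | succ k ih =>
    rw [ckNorm, jet_succ, pow_succ]
    have h1 := mul_le_mul_of_nonneg_left (ih (deriv u)) hl
    have h2 := ckNorm_nonneg hl k u
    linarith

theorem norm_jet_zero_le_ckNorm (hl : 0 ≤ l) (k : ℕ) (u : SmoothCircle) :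
    ‖jet 0 u‖ ≤ ckNorm l k u := by
  induction k with
  | zero => exact le_rfl
  | succ k ih =>
    rw [ckNorm]
    linarith [mul_nonneg hl (ckNorm_nonneg hl k (deriv u))]

theorem continuous_ckNorm (l : ℝ) (k : ℕ) : Continuous (ckNorm l k) := by
  induction k with
  | zero => exact (continuous_jet 0).norm
  | succ k ih => exact ih.add (continuous_const.mul (ih.comp continuous_deriv))

theorem continuous_ckNorm_param (k : ℕ) (u : SmoothCircle) :
    Continuous fun l => ckNorm l k u := by
  induction k generalizing u with
  | zero => exact continuous_const
  | succ k ih => exact (ih u).add (continuous_id.mul (ih _))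

theorem ckNorm_param_zero (k : ℕ) (u : SmoothCircle) : ckNorm 0 k u = ‖jet 0 u‖ := by
  induction k with
  | zero => rfl
  | succ k ih => simp [ckNorm, ih]

/-- The norm is a polynomial in the weight `l` whose constant term is the sup norm. This is what
frees the smallness condition from the order `k`. -/
theorem eventually_ckNorm_lt (k : ℕ) {u : SmoothCircle} {r : ℝ} (h : ‖jet 0 u‖ < r) :
    ∀ᶠ l in 𝓝 (0 : ℝ), ckNorm l k u < r := by
  rw [← ckNorm_param_zero k u] at h
  exact (continuous_ckNorm_param k u).continuousAt.eventually_lt continuousAt_const h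

end ckNorm

/-! ### The resolvents `(1 - s d/dx)⁻¹` -/

/-- The operator `1 - s d/dx`. -/
noncomputable def oneSubDeriv (s : ℝˣ) : SmoothCircle →ₗ[ℝ] SmoothCircle :=
  LinearMap.id - (s : ℝ) • deriv

theorem oneSubDeriv_bijective (s : ℝˣ) : Function.Bijective (oneSubDeriv s) := by
  have hA : ∀ u, oneSubDeriv s u = u - (s : ℝ) • deriv u := fun u => rfl
  have hs : (s : ℝ)⁻¹ ≠ 0 := inv_ne_zero s.ne_zero
  constructor
  · rw [← LinearMap.ker_eq_bot, LinearMap.ker_eq_bot']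
    intro u hu
    rw [hA, sub_eq_zero] at hu
    apply eq_zero_of_deriv_eq hs
    nth_rw 2 [hu]
    rw [smul_smul, inv_mul_cancel₀ s.ne_zero, one_smul]
  · intro f
    obtain ⟨g, hg⟩ := exists_deriv_sub hs (-(s : ℝ)⁻¹ • f)
    refine ⟨g, ?_⟩
    rw [hA]
    have h2 := congrArg (fun x => (s : ℝ) • x) hg
    simp only [smul_sub, smul_neg, smul_smul, mul_inv_cancel₀ s.ne_zero, one_smul, neg_smul] at h2
    rw [← neg_inj, ← h2]; abel

/-- The resolvent `(1 - s d/dx)⁻¹`. -/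
noncomputable def resolvent (s : ℝˣ) : SmoothCircle →ₗ[ℝ] SmoothCircle :=
  (LinearEquiv.ofBijective _ (oneSubDeriv_bijective s)).symm.toLinearMap

theorem resolvent_sub (s : ℝˣ) (f : SmoothCircle) :
    resolvent s f - (s : ℝ) • deriv (resolvent s f) = f :=
  (LinearEquiv.ofBijective _ (oneSubDeriv_bijective s)).apply_symm_apply f

theorem deriv_resolvent (s : ℝˣ) (f : SmoothCircle) :
    deriv (resolvent s f) = resolvent s (deriv f) := by
  apply (oneSubDeriv_bijective s).1
  change deriv (resolvent s f) - (s : ℝ) • deriv (deriv (resolvent s f))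
    = resolvent s (deriv f) - (s : ℝ) • deriv (resolvent s (deriv f))
  rw [resolvent_sub, ← map_smul, ← map_sub, resolvent_sub]

/-- Maximum principle: where `g = (1 - s ∂)⁻¹ f` attains its maximum, `g'` vanishes, so `g = f`
there. The sign of `s` plays no role. -/
theorem resolvent_le (s : ℝˣ) {f : SmoothCircle} {m : ℝ} (hf : ∀ y, f y ≤ m) (y : UnitAddCircle) :
    resolvent s f y ≤ m := by
  set g := resolvent s f with hg
  obtain ⟨z, -, hz⟩ := isCompact_univ.exists_isMaxOn univ_nonempty
    (toContinuousMap g).continuous.continuousOn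
  have hz' : ∀ y, g y ≤ g z := fun y => hz (mem_univ y)
  induction z using QuotientAddGroup.induction_on with
  | H x =>
    have h0 : deriv g (x : UnitAddCircle) = 0 :=
      IsLocalMax.hasDerivAt_eq_zero (Eventually.of_forall fun y => hz' (y : UnitAddCircle))
        (g.hasDerivAt x)
    have h1 : g (x : UnitAddCircle) - s * deriv g (x : UnitAddCircle) = f (x : UnitAddCircle) := by
      conv_rhs => rw [← resolvent_sub s f]
      rfl
    rw [h0] at h1
    have h2 : g y ≤ g (x : UnitAddCircle) := hz' y
    linarith [hf (x : UnitAddCircle)]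

theorem norm_jet_zero_resolvent_le (s : ℝˣ) (f : SmoothCircle) :
    ‖jet 0 (resolvent s f)‖ ≤ ‖jet 0 f‖ := by
  rw [ContinuousMap.norm_le _ (norm_nonneg _)]
  intro y
  have hb : ∀ y, |f y| ≤ ‖jet 0 f‖ := fun y => (jet 0 f).norm_coe_le_norm y
  rw [Real.norm_eq_abs, abs_le]
  constructor
  · have := resolvent_le s (f := -f) (m := ‖jet 0 f‖)
      (fun y => by rw [coe_neg]; linarith [(abs_le.1 (hb y)).1]) y
    rw [map_neg, coe_neg] at this
    rw [jet_zero_apply]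
    linarith
  · exact resolvent_le s (fun y => (abs_le.1 (hb y)).2) y

/-- The resolvent commutes with `∂`, so the sup norm bound passes to every derivative and to every
weight. -/
theorem ckNorm_resolvent_le {l : ℝ} (hl : 0 ≤ l) (k : ℕ) (s : ℝˣ) (f : SmoothCircle) :
    ckNorm l k (resolvent s f) ≤ ckNorm l k f := by
  induction k generalizing f with
  | zero => exact norm_jet_zero_resolvent_le s f
  | succ k ih =>
    simp only [ckNorm, deriv_resolvent]
    exact add_le_add (ih f) (mul_le_mul_of_nonneg_left (ih _) hl)

end SmoothCircle

/-! ### Two facts on Banach spaces -/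

/-- A fixed point of a contraction depends on the parameters as smoothly as the contraction. -/
theorem contDiffAt_of_fixedPoint {P E : Type*} [NormedAddCommGroup P] [NormedSpace ℝ P]
    [CompleteSpace P] [NormedAddCommGroup E] [NormedSpace ℝ E] [CompleteSpace E]
    {Φ : P × E → E} {n : ℕ∞ω} (hn : n ≠ 0) {Z : P → E} {p₀ : P} {B : Set E} {K : ℝ} (hK : K < 1)
    (hΦ : ContDiffAt ℝ n Φ (p₀, Z p₀)) (hB : B ∈ 𝓝 (Z p₀))
    (hlip : ∀ᶠ p in 𝓝 p₀, ∀ z ∈ B, ∀ z' ∈ B, ‖Φ (p, z) - Φ (p, z')‖ ≤ K * ‖z - z'‖)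
    (hZ : ∀ᶠ p in 𝓝 p₀, Z p ∈ B ∧ Φ (p, Z p) = Z p) : ContDiffAt ℝ n Z p₀ := by
  have hB0 : Z p₀ ∈ B := mem_of_mem_nhds hB
  have hfix : Φ (p₀, Z p₀) = Z p₀ := hZ.self_of_nhds.2
  -- The implicit function only describes solutions near `(p₀, Z p₀)`, so continuity of `Z` is
  -- needed first. The contraction gives `(1 - K) ‖Z p - Z p₀‖ ≤ ‖Φ(p, Z p₀) - Φ(p₀, Z p₀)‖`.
  have hcont : Tendsto Z (𝓝 p₀) (𝓝 (Z p₀)) := by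
    have h1 : Tendsto (fun p => (1 - K)⁻¹ * ‖Φ (p, Z p₀) - Φ (p₀, Z p₀)‖) (𝓝 p₀) (𝓝 0) := by
      have h2 : ContinuousAt (fun p => Φ (p, Z p₀)) p₀ :=
        hΦ.continuousAt.comp (f := fun p : P => (p, Z p₀)) (by fun_prop)
      simpa using (tendsto_iff_norm_sub_tendsto_zero.1 h2.tendsto).const_mul (1 - K)⁻¹
    rw [tendsto_iff_norm_sub_tendsto_zero]
    refine squeeze_zero' (Eventually.of_forall fun _ => norm_nonneg _) ?_ h1
    filter_upwards [hlip, hZ] with p hp hp'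
    have h3 := hp _ hp'.1 _ hB0
    rw [hp'.2] at h3
    have h4 : ‖Z p - Z p₀‖ ≤ ‖Z p - Φ (p, Z p₀)‖ + ‖Φ (p, Z p₀) - Φ (p₀, Z p₀)‖ := by
      rw [hfix]; exact norm_sub_le_norm_sub_add_norm_sub _ _ _
    rw [le_inv_mul_iff₀ (by linarith)]
    linarith
  set f : P × E → E := fun x => x.2 - Φ x with hf
  have hfd : ContDiffAt ℝ n f (p₀, Z p₀) := contDiffAt_snd.sub hΦ
  have hK0 : HasFDerivAt (fun z => Φ (p₀, z))
      (fderiv ℝ Φ (p₀, Z p₀) ∘L .inr ℝ P E) (Z p₀) :=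
    (hΦ.differentiableAt hn).hasFDerivAt.comp (Z p₀) (hasFDerivAt_prodMk_right p₀ (Z p₀))
  -- The Lipschitz constant bounds the partial derivative in `z`, so `1 - ∂_z Φ` is invertible by a
  -- Neumann series. The maximum with `0` is there because `K` is not assumed nonnegative.
  have hnorm : ‖fderiv ℝ Φ (p₀, Z p₀) ∘L .inr ℝ P E‖ < 1 := by
    refine lt_of_le_of_lt (hK0.le_of_lip' (le_max_right K 0) ?_) (max_lt hK one_pos)
    filter_upwards [hB] with z hz
    exact (hlip.self_of_nhds z hz _ hB0).trans
      (mul_le_mul_of_nonneg_right (le_max_left _ _) (norm_nonneg _))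
  have hinv : (fderiv ℝ f (p₀, Z p₀) ∘L .inr ℝ P E).IsInvertible := by
    have h1 : fderiv ℝ f (p₀, Z p₀) ∘L .inr ℝ P E
        = 1 - fderiv ℝ Φ (p₀, Z p₀) ∘L .inr ℝ P E := by
      rw [hf, fderiv_fun_sub differentiableAt_snd (hΦ.differentiableAt hn), fderiv_snd]
      ext z
      simp
    rw [h1]
    exact ⟨ContinuousLinearEquiv.ofUnit (Units.oneSub _ hnorm), rfl⟩
  have hev := hfd.eventually_apply_eq_iff_implicitFunction hn hinv
  have hpair : Tendsto (fun p => (p, Z p)) (𝓝 p₀) (𝓝 (p₀, Z p₀)) :=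
    tendsto_id.prodMk_nhds hcont
  refine (hfd.contDiffAt_implicitFunction hn hinv).congr_of_eventuallyEq ?_
  filter_upwards [hpair.eventually hev, hZ] with p hp hp'
  exact (hp.1 (by simp [hf, hp'.2, hfix])).symm

/-- Uniqueness of the integral curves of a `C¹` vector field on a normed space. -/
theorem eqOn_Ioo_of_hasDerivAt {E : Type*} [NormedAddCommGroup E] [NormedSpace ℝ E]
    {V : E → E} (hV : ContDiff ℝ 1 V) {f g : ℝ → E} {a b t₀ : ℝ} (ht₀ : t₀ ∈ Ioo a b)
    (hf : ∀ t ∈ Ioo a b, HasDerivAt f (V (f t)) t) (hg : ∀ t ∈ Ioo a b, HasDerivAt g (V (g t)) t)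
    (h0 : f t₀ = g t₀) : EqOn f g (Ioo a b) := by
  have key : ∀ t ∈ Ioo a b, f t = g t → f =ᶠ[𝓝 t] g := by
    intro t ht hfg
    obtain ⟨K, s, hs, hK⟩ := (hV.contDiffAt (x := f t)).exists_lipschitzOnWith
    refine ODE_solution_unique_of_eventually (v := fun _ => V) (s := fun _ => s) (K := K)
      (Eventually.of_forall fun _ => hK) ?_ ?_ hfg
    · filter_upwards [isOpen_Ioo.mem_nhds ht, (hf t ht).continuousAt hs] with r hr hr'
      exact ⟨hf r hr, hr'⟩
    · rw [hfg] at hs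
      filter_upwards [isOpen_Ioo.mem_nhds ht, (hg t ht).continuousAt hs] with r hr hr'
      exact ⟨hg r hr, hr'⟩
  -- The set where the germs of `f` and `g` agree is open; by continuity it is closed in the
  -- interval, so connectedness applies.
  have hsub : Ioo a b ⊆ {t | f =ᶠ[𝓝 t] g} := by
    refine isPreconnected_Ioo.subset_of_closure_inter_subset
      (isOpen_iff_mem_nhds.2 fun t ht => eventually_eventually_nhds.2 ht) ⟨t₀, ht₀, key _ ht₀ h0⟩ ?_
    rintro t ⟨htc, ht⟩
    apply key t ht
    have hfr : ∃ᶠ r in 𝓝 t, f r = g r :=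
      (mem_closure_iff_frequently.1 htc).mono fun r hr => hr.self_of_nhds
    exact tendsto_nhds_unique_of_frequently_eq (hf t ht).continuousAt.tendsto
      (hg t ht).continuousAt.tendsto hfr
  exact fun t ht => (hsub ht).self_of_nhds

/-! ### The geodesic vector field over a commutative algebra

The unknowns `z 0, …, z 6` stand for `v`, `u_x ∘ φ`, `e^ξ`, `e^{-ξ}`, `e^{-ξ} φ_x`, `e^ξ φ_x` and
`ξ`, where `φ = id + ξ` and `v = u ∘ φ`. -/

namespace BEquation

section Field

variable {A : Type*} [CommRing A] [Algebra ℝ A]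

/-- The density `(b/2) u² + ((3-b)/2) u_x²`, transported by `φ`. -/
noncomputable def density (b : ℝ) (z : Fin 7 → A) : A :=
  (b / 2) • (z 0 * z 0) + ((3 - b) / 2) • (z 1 * z 1)

/-- The resolvent `(1 - d/dx)⁻¹` of the density, transported by `φ`. -/
noncomputable def resPlus (b : ℝ) (R : A → A) (z : Fin 7 → A) : A :=
  z 2 * R (z 4 * density b z)

/-- The resolvent `(1 + d/dx)⁻¹` of the density, transported by `φ`. -/
noncomputable def resMinus (b : ℝ) (R : A → A) (z : Fin 7 → A) : A :=
  z 3 * R (z 5 * density b z)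

/-- The force `P(u) ∘ φ`. -/
noncomputable def force (b : ℝ) (R₁ R₂ : A → A) (z : Fin 7 → A) : A :=
  (1 / 2 : ℝ) • (resPlus b R₁ z - resMinus b R₂ z)

/-- The function `A⁻¹ ((b/2) u² + ((3-b)/2) u_x²) ∘ φ`. -/
noncomputable def pressure (b : ℝ) (R₁ R₂ : A → A) (z : Fin 7 → A) : A :=
  (1 / 2 : ℝ) • (resPlus b R₁ z + resMinus b R₂ z)

/-- The geodesic vector field. -/
noncomputable def field (b : ℝ) (R₁ R₂ : A → A) (z : Fin 7 → A) : Fin 7 → A :=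
  ![-force b R₁ R₂ z, density b z - z 1 * z 1 - pressure b R₁ R₂ z, z 0 * z 2, -(z 0 * z 3),
    (z 1 - z 0) * z 4, (z 1 + z 0) * z 5, z 0]

section Map

variable {B : Type*} [CommRing B] [Algebra ℝ B] (b : ℝ) {R₁ R₂ : A → A} {S₁ S₂ : B → B}
  (J : A →ₐ[ℝ] B)

theorem map_density (z : Fin 7 → A) : density b (fun i => J (z i)) = J (density b z) := by
  simp [density]

theorem map_resPlus (h₁ : ∀ x, J (R₁ x) = S₁ (J x)) (z : Fin 7 → A) :
    resPlus b S₁ (fun i => J (z i)) = J (resPlus b R₁ z) := by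
  rw [resPlus, resPlus, map_density, map_mul, h₁, map_mul]

theorem map_resMinus (h₂ : ∀ x, J (R₂ x) = S₂ (J x)) (z : Fin 7 → A) :
    resMinus b S₂ (fun i => J (z i)) = J (resMinus b R₂ z) := by
  rw [resMinus, resMinus, map_density, map_mul, h₂, map_mul]

theorem map_pressure (h₁ : ∀ x, J (R₁ x) = S₁ (J x)) (h₂ : ∀ x, J (R₂ x) = S₂ (J x))
    (z : Fin 7 → A) : pressure b S₁ S₂ (fun i => J (z i)) = J (pressure b R₁ R₂ z) := by
  simp [pressure, map_resPlus b J h₁, map_resMinus b J h₂]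

/-- Naturality of the field under algebra morphisms that intertwine the resolvents. It transports
the equation between polynomials in time, smooth functions and completions. -/
theorem map_field (h₁ : ∀ x, J (R₁ x) = S₁ (J x)) (h₂ : ∀ x, J (R₂ x) = S₂ (J x))
    (z : Fin 7 → A) : field b S₁ S₂ (fun i => J (z i)) = fun i => J (field b R₁ R₂ z i) := by
  funext i
  fin_cases i <;> simp [field, force, map_density, map_pressure b J h₁ h₂, map_resPlus b J h₁,
    map_resMinus b J h₂]

end Map

/-- The initial value of the unknowns: `v = u₀`, `u_x = u₀'`, `φ = id`. -/
def init (u u' : A) : Fin 7 → A := ![u, u', 1, 1, 1, 1, 0]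

theorem map_init {B : Type*} [CommRing B] [Algebra ℝ B] (J : A →ₐ[ℝ] B) (u u' : A) :
    (fun i => J (init u u' i)) = init (J u) (J u') := by
  funext i
  fin_cases i <;> simp [init]

end Field

/-! ### Bounds -/

/-- `f` is bounded by `M`, and Lipschitz with constant `M`, on the closed ball of radius `2`. -/
def BoundedLip {E G : Type*} [NormedAddCommGroup E] [NormedAddCommGroup G] (f : E → G) (M : ℝ) :
    Prop :=
  (∀ z, ‖z‖ ≤ 2 → ‖f z‖ ≤ M) ∧ ∀ z z', ‖z‖ ≤ 2 → ‖z'‖ ≤ 2 → ‖f z - f z'‖ ≤ M * ‖z - z'‖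

namespace BoundedLip

variable {E G : Type*} [NormedAddCommGroup E] [NormedAddCommGroup G] {f g : E → G} {M N : ℝ}

theorem nonneg (hf : BoundedLip f M) : 0 ≤ M :=
  (norm_nonneg _).trans (hf.1 0 (by simp))

theorem mono (hf : BoundedLip f M) (h : M ≤ N) : BoundedLip f N :=
  ⟨fun z hz => (hf.1 z hz).trans h,
    fun z z' hz hz' => (hf.2 z z' hz hz').trans (mul_le_mul_of_nonneg_right h (norm_nonneg _))⟩

theorem neg (hf : BoundedLip f M) : BoundedLip (fun z => -f z) M :=
  ⟨fun z hz => by simpa using hf.1 z hz, fun z z' hz hz' => by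
    rw [← neg_sub', norm_neg]; exact hf.2 z z' hz hz'⟩

theorem add (hf : BoundedLip f M) (hg : BoundedLip g N) :
    BoundedLip (fun z => f z + g z) (M + N) :=
  ⟨fun z hz => (norm_add_le _ _).trans (add_le_add (hf.1 z hz) (hg.1 z hz)), fun z z' hz hz' => by
    rw [add_sub_add_comm, add_mul]
    exact (norm_add_le _ _).trans (add_le_add (hf.2 z z' hz hz') (hg.2 z z' hz hz'))⟩

theorem sub (hf : BoundedLip f M) (hg : BoundedLip g N) :
    BoundedLip (fun z => f z - g z) (M + N) := by
  simpa only [sub_eq_add_neg] using hf.add hg.neg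

theorem smul [NormedSpace ℝ G] (hf : BoundedLip f M) (c : ℝ) :
    BoundedLip (fun z => c • f z) (|c| * M) :=
  ⟨fun z hz => by
    rw [norm_smul, Real.norm_eq_abs]
    exact mul_le_mul_of_nonneg_left (hf.1 z hz) (abs_nonneg c), fun z z' hz hz' => by
    rw [← smul_sub, norm_smul, Real.norm_eq_abs, mul_assoc]
    exact mul_le_mul_of_nonneg_left (hf.2 z z' hz hz') (abs_nonneg c)⟩

theorem map [NormedSpace ℝ G] (hf : BoundedLip f M) {R : G →L[ℝ] G} (hR : ∀ x, ‖R x‖ ≤ ‖x‖) :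
    BoundedLip (fun z => R (f z)) M :=
  ⟨fun z hz => (hR _).trans (hf.1 z hz), fun z z' hz hz' => by
    rw [← map_sub]; exact (hR _).trans (hf.2 z z' hz hz')⟩

/-- The factor `2` pays for the two terms of `f g - f' g' = f (g - g') + (f - f') g'`, so that a
single constant serves as bound and as Lipschitz constant. -/
theorem mul {G : Type*} [NormedCommRing G] {f g : E → G} (hf : BoundedLip f M)
    (hg : BoundedLip g N) : BoundedLip (fun z => f z * g z) (2 * (M * N)) := by
  have hM := hf.nonneg
  have hN := hg.nonneg
  refine ⟨fun z hz => ?_, fun z z' hz hz' => ?_⟩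
  · have h1 := (norm_mul_le (f z) (g z)).trans
      (mul_le_mul (hf.1 z hz) (hg.1 z hz) (norm_nonneg _) hM)
    nlinarith [mul_nonneg hM hN]
  · have e : f z * g z - f z' * g z' = f z * (g z - g z') + (f z - f z') * g z' := by ring
    rw [e]
    have h1 := (norm_mul_le (f z) (g z - g z')).trans
      (mul_le_mul (hf.1 z hz) (hg.2 z z' hz hz') (norm_nonneg _) hM)
    have h2 := (norm_mul_le (f z - f z') (g z')).trans
      (mul_le_mul (hf.2 z z' hz hz') (hg.1 z' hz') (norm_nonneg _)
        (mul_nonneg hM (norm_nonneg _)))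
    calc _ ≤ _ := norm_add_le _ _
      _ ≤ _ := add_le_add h1 h2
      _ = _ := by ring

theorem pi {ι : Type*} [Fintype ι] {f : E → ι → G} (hM : 0 ≤ M)
    (hf : ∀ i, BoundedLip (fun z => f z i) M) : BoundedLip f M :=
  ⟨fun z hz => (pi_norm_le_iff_of_nonneg hM).2 fun i => (hf i).1 z hz, fun z z' hz hz' =>
    (pi_norm_le_iff_of_nonneg (mul_nonneg hM (norm_nonneg _))).2 fun i => (hf i).2 z z' hz hz'⟩

theorem apply {ι : Type*} [Fintype ι] (i : ι) : BoundedLip (fun z : ι → G => z i) 2 :=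
  ⟨fun z hz => (norm_le_pi_norm z i).trans hz, fun z z' _ _ => by
    have h := norm_le_pi_norm (z - z') i
    rw [Pi.sub_apply] at h
    linarith [norm_nonneg (z - z')]⟩

end BoundedLip

/-- A bound for the geodesic vector field on the ball of radius `2`. -/
noncomputable def fieldBound (b : ℝ) : ℝ := 100 * (|b| + |3 - b| + 1)

theorem fieldBound_pos (b : ℝ) : 0 < fieldBound b := by unfold fieldBound; positivity

section NormedField

variable {G : Type*} [NormedCommRing G] [NormedAlgebra ℝ G] {R₁ R₂ : G →L[ℝ] G}

theorem boundedLip_density (b : ℝ) :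
    BoundedLip (density b : (Fin 7 → G) → G) (4 * (|b| + |3 - b|)) := by
  have hz : ∀ i : Fin 7, BoundedLip (fun z : Fin 7 → G => z i) 2 := fun i => .apply i
  refine ((((hz 0).mul (hz 0)).smul (b / 2)).add
    (((hz 1).mul (hz 1)).smul ((3 - b) / 2))).mono ?_
  rw [abs_div, abs_div, abs_two]
  apply le_of_eq; ring

theorem boundedLip_resPlus (b : ℝ) (h₁ : ∀ x, ‖R₁ x‖ ≤ ‖x‖) :
    BoundedLip (resPlus b R₁) (64 * (|b| + |3 - b|)) := by
  refine ((BoundedLip.apply 2).mul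
    (((BoundedLip.apply 4).mul (boundedLip_density b)).map h₁)).mono (le_of_eq ?_)
  ring

theorem boundedLip_resMinus (b : ℝ) (h₂ : ∀ x, ‖R₂ x‖ ≤ ‖x‖) :
    BoundedLip (resMinus b R₂) (64 * (|b| + |3 - b|)) := by
  refine ((BoundedLip.apply 3).mul
    (((BoundedLip.apply 5).mul (boundedLip_density b)).map h₂)).mono (le_of_eq ?_)
  ring

theorem boundedLip_pressure (b : ℝ) (h₁ : ∀ x, ‖R₁ x‖ ≤ ‖x‖) (h₂ : ∀ x, ‖R₂ x‖ ≤ ‖x‖) :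
    BoundedLip (pressure b R₁ R₂) (64 * (|b| + |3 - b|)) := by
  refine (((boundedLip_resPlus b h₁).add (boundedLip_resMinus b h₂)).smul (1 / 2)).mono
    (le_of_eq ?_)
  rw [abs_of_pos (by norm_num)]; ring

/-- The constant involves neither the algebra nor the operators beyond their norm bound, so it is
common to all `k` and `l`. -/
theorem boundedLip_field (b : ℝ) (h₁ : ∀ x, ‖R₁ x‖ ≤ ‖x‖) (h₂ : ∀ x, ‖R₂ x‖ ≤ ‖x‖) :
    BoundedLip (field b R₁ R₂) (fieldBound b) := by
  have hz : ∀ i : Fin 7, BoundedLip (fun z : Fin 7 → G => z i) 2 := fun i => .apply i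
  have hF : BoundedLip (force b R₁ R₂) (64 * (|b| + |3 - b|)) := by
    refine (((boundedLip_resPlus b h₁).sub (boundedLip_resMinus b h₂)).smul (1 / 2)).mono
      (le_of_eq ?_)
    rw [abs_of_pos (by norm_num)]; ring
  have hb : 0 ≤ |b| + |3 - b| := by positivity
  refine .pi (fieldBound_pos b).le fun i => ?_
  unfold fieldBound
  fin_cases i
  · exact hF.neg.mono (by linarith)
  · exact (((boundedLip_density b).sub ((hz 1).mul (hz 1))).sub
      (boundedLip_pressure b h₁ h₂)).mono (by linarith)
  · exact ((hz 0).mul (hz 2)).mono (by linarith)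
  · exact ((hz 0).mul (hz 3)).neg.mono (by linarith)
  · exact (((hz 1).sub (hz 0)).mul (hz 4)).mono (by linarith)
  · exact (((hz 1).add (hz 0)).mul (hz 5)).mono (by linarith)
  · exact (hz 0).mono (by linarith)

theorem contDiff_field (b : ℝ) {n : ℕ∞ω} : ContDiff ℝ n (field b R₁ R₂) := by
  have hd : ContDiff ℝ n (density b : (Fin 7 → G) → G) := by unfold density; fun_prop
  have hp : ContDiff ℝ n (resPlus b R₁) := by unfold resPlus; fun_prop
  have hm : ContDiff ℝ n (resMinus b R₂) := by unfold resMinus; fun_prop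
  have hF : ContDiff ℝ n (force b R₁ R₂) := by unfold force; fun_prop
  have hP : ContDiff ℝ n (pressure b R₁ R₂) := by unfold pressure; fun_prop
  refine contDiff_pi.2 fun i => ?_
  fin_cases i <;> simp [field] <;> fun_prop

theorem contDiff_init {n : ℕ∞ω} : ContDiff ℝ n (fun p : G × G => init p.1 p.2) := by
  refine contDiff_pi.2 fun i => ?_
  fin_cases i <;> simp [init] <;> fun_prop

end NormedField

theorem norm_init_le {G : Type*} [NormedCommRing G] [NormOneClass G] {u u' : G}
    (hu : ‖u‖ ≤ 1) (hu' : ‖u'‖ ≤ 1) :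
    ‖init u u'‖ ≤ 1 := by
  refine (pi_norm_le_iff_of_nonneg zero_le_one).2 fun i => ?_
  fin_cases i <;> simp [init, hu, hu']

end BEquation

namespace BEquation

/-! ### Fixed points of contractions -/

/-- The contraction principle on the ball of radius `1/10` about `z₀`, which lies in the ball of
radius `2`. The explicit rate for the iterates is kept because the same polynomial iterates are
later compared with the fixed point in every completion. -/
theorem exists_fixedPoint {E : Type*} [NormedAddCommGroup E] [CompleteSpace E] {Ψ : E → E} {z₀ : E}
    (hz₀ : ‖z₀‖ ≤ 1) (h1 : ∀ z, ‖z‖ ≤ 2 → ‖Ψ z - z₀‖ ≤ 1 / 10)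
    (h2 : ∀ z z', ‖z‖ ≤ 2 → ‖z'‖ ≤ 2 → ‖Ψ z - Ψ z'‖ ≤ 1 / 10 * ‖z - z'‖) :
    ∃ z, Ψ z = z ∧ ‖z - z₀‖ ≤ 1 / 10 ∧ ∀ n, ‖Ψ^[n] z₀ - z‖ ≤ (1 / 10) ^ n := by
  have hball : ∀ z ∈ Metric.closedBall z₀ (1 / 10 : ℝ), ‖z‖ ≤ 2 := by
    intro z hz
    rw [Metric.mem_closedBall, dist_eq_norm] at hz
    have := norm_add_le (z - z₀) z₀
    rw [sub_add_cancel] at this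
    linarith
  have hmaps : MapsTo Ψ (Metric.closedBall z₀ (1 / 10 : ℝ)) (Metric.closedBall z₀ (1 / 10 : ℝ)) := by
    intro z hz
    rw [Metric.mem_closedBall, dist_eq_norm]
    exact h1 z (hball z hz)
  have hmem : z₀ ∈ Metric.closedBall z₀ (1 / 10 : ℝ) := Metric.mem_closedBall_self (by norm_num)
  have hcontr : ContractingWith (1 / 10) (hmaps.restrict Ψ _ _) := by
    refine ⟨by rw [← NNReal.coe_lt_coe]; norm_num, LipschitzWith.of_dist_le_mul fun x y => ?_⟩
    rw [Subtype.dist_eq, Subtype.dist_eq, dist_eq_norm, dist_eq_norm]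
    simpa using h2 x y (hball x x.2) (hball y y.2)
  obtain ⟨z, hz, hfix, -⟩ := hcontr.exists_fixedPoint' Metric.isClosed_closedBall.isComplete hmaps
    hmem (edist_ne_top _ _)
  have hz' : ‖z - z₀‖ ≤ 1 / 10 := by rwa [← dist_eq_norm]
  refine ⟨z, hfix, hz', fun n => ?_⟩
  induction n with
  | zero => rw [Function.iterate_zero_apply, norm_sub_rev, pow_zero]; linarith
  | succ n ih =>
    have hn : Ψ^[n] z₀ ∈ Metric.closedBall z₀ (1 / 10 : ℝ) := hmaps.iterate n hmem
    rw [Function.iterate_succ_apply']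
    nth_rw 1 [← hfix.eq]
    rw [pow_succ']
    exact (h2 _ _ (hball _ hn) (hball z hz)).trans (mul_le_mul_of_nonneg_left ih (by norm_num))

/-! ### The Picard map -/

section Picard

variable {A : Type*} [CommRing A] [Algebra ℝ A]

/-- The Picard map `z ↦ z₀ + τ ∫ field z`, with `I` in the role of the integration in time. -/
noncomputable def picard (b : ℝ) (R₁ R₂ I : A → A) (τ : ℝ) (u u' : A) (z : Fin 7 → A) : Fin 7 → A :=
  fun i => init u u' i + τ • I (field b R₁ R₂ z i)

/-- The time scales `τ` and `σ` may differ on the two sides, so that a change of time variable is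
also an admissible `J`. -/
theorem map_picard {B : Type*} [CommRing B] [Algebra ℝ B] (b : ℝ) {R₁ R₂ I : A → A}
    {S₁ S₂ K : B → B} {τ σ : ℝ} (J : A →ₐ[ℝ] B) (h₁ : ∀ x, J (R₁ x) = S₁ (J x))
    (h₂ : ∀ x, J (R₂ x) = S₂ (J x)) (hI : ∀ x, J (τ • I x) = σ • K (J x)) (u u' : A)
    (z : Fin 7 → A) :
    picard b S₁ S₂ K σ (J u) (J u') (fun i => J (z i)) =
      fun i => J (picard b R₁ R₂ I τ u u' z i) := by
  funext i
  rw [picard, picard, map_field b J h₁ h₂, map_add, hI, ← map_init]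

theorem map_iterate_picard {B : Type*} [CommRing B] [Algebra ℝ B] (b : ℝ) {R₁ R₂ I : A → A}
    {S₁ S₂ K : B → B} {τ σ : ℝ} (J : A →ₐ[ℝ] B) (h₁ : ∀ x, J (R₁ x) = S₁ (J x))
    (h₂ : ∀ x, J (R₂ x) = S₂ (J x)) (hI : ∀ x, J (τ • I x) = σ • K (J x)) (u u' : A) (n : ℕ) :
    (picard b S₁ S₂ K σ (J u) (J u'))^[n] (init (J u) (J u')) =
      fun i => J ((picard b R₁ R₂ I τ u u')^[n] (init u u') i) := by
  induction n with
  | zero => exact (map_init J u u').symm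
  | succ n ih =>
    rw [Function.iterate_succ_apply', ih, map_picard b J h₁ h₂ hI, Function.iterate_succ_apply']

end Picard

/-- Half the length of the time interval on which the solutions are constructed. -/
noncomputable def lifespan (b : ℝ) : ℝ := 1 / (10 * fieldBound b)

theorem lifespan_pos (b : ℝ) : 0 < lifespan b := by
  have := fieldBound_pos b
  unfold lifespan; positivity

section Banach

variable {G : Type*} [NormedCommRing G] [NormedAlgebra ℝ G] {R₁ R₂ I : G →L[ℝ] G}

/-- The lifespan is chosen so that `|τ|` times the bound of the field is at most `1/10`. -/
theorem boundedLip_picard (b : ℝ) (h₁ : ∀ x, ‖R₁ x‖ ≤ ‖x‖) (h₂ : ∀ x, ‖R₂ x‖ ≤ ‖x‖)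
    (hI : ∀ x, ‖I x‖ ≤ ‖x‖) {τ : ℝ} (hτ : |τ| < lifespan b) :
    BoundedLip (fun z => fun i => τ • I (field b R₁ R₂ z i)) (1 / 10) := by
  have hf := boundedLip_field b h₁ h₂
  have hM := fieldBound_pos b
  refine .pi (by norm_num) fun i => ?_
  have hfi : BoundedLip (fun z => field b R₁ R₂ z i) (fieldBound b) :=
    ⟨fun z hz => (norm_le_pi_norm _ i).trans (hf.1 z hz), fun z z' hz hz' =>
      (norm_le_pi_norm (field b R₁ R₂ z - field b R₁ R₂ z') i).trans (hf.2 z z' hz hz')⟩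
  refine ((hfi.map hI).smul τ).mono ?_
  have : |τ| * fieldBound b ≤ lifespan b * fieldBound b := by gcongr
  rw [lifespan] at this
  refine this.trans (le_of_eq ?_)
  field_simp

/-- The fixed point of the Picard map depends smoothly on the time scale and on the initial
value. -/
theorem exists_contDiffAt_picard [CompleteSpace G] [NormOneClass G] (b : ℝ)
    (h₁ : ∀ x, ‖R₁ x‖ ≤ ‖x‖) (h₂ : ∀ x, ‖R₂ x‖ ≤ ‖x‖) (hI : ∀ x, ‖I x‖ ≤ ‖x‖) :
    ∃ Z : ℝ × G × G → Fin 7 → G, ∀ p : ℝ × G × G, |p.1| < lifespan b → ‖p.2.1‖ < 1 → ‖p.2.2‖ < 1 →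
      ContDiffAt ℝ ∞ Z p ∧ ‖Z p - init p.2.1 p.2.2‖ ≤ 1 / 10 ∧
      ∀ n, ‖(picard b R₁ R₂ I p.1 p.2.1 p.2.2)^[n] (init p.2.1 p.2.2) - Z p‖ ≤ (1 / 10) ^ n := by
  have hex : ∀ p : ℝ × G × G, |p.1| < lifespan b → ‖p.2.1‖ < 1 → ‖p.2.2‖ < 1 →
      ∃ z, picard b R₁ R₂ I p.1 p.2.1 p.2.2 z = z ∧ ‖z - init p.2.1 p.2.2‖ ≤ 1 / 10 ∧
      ∀ n, ‖(picard b R₁ R₂ I p.1 p.2.1 p.2.2)^[n] (init p.2.1 p.2.2) - z‖ ≤ (1 / 10) ^ n := by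
    intro p hp hp1 hp2
    have hb := boundedLip_picard b h₁ h₂ hI hp
    refine exists_fixedPoint (norm_init_le hp1.le hp2.le) (fun z hz => ?_) (fun z z' hz hz' => ?_)
    · have e : picard b R₁ R₂ I p.1 p.2.1 p.2.2 z - init p.2.1 p.2.2
          = fun i => p.1 • I (field b R₁ R₂ z i) := by
        funext i; simp [picard]
      rw [e]; exact hb.1 z hz
    · have e : picard b R₁ R₂ I p.1 p.2.1 p.2.2 z - picard b R₁ R₂ I p.1 p.2.1 p.2.2 z'
          = (fun i => p.1 • I (field b R₁ R₂ z i)) - fun i => p.1 • I (field b R₁ R₂ z' i) := by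
        funext i; simp [picard]
      rw [e]; exact hb.2 z z' hz hz'
  classical
  choose! Z hZ using hex
  refine ⟨Z, fun p hp hp1 hp2 => ⟨?_, (hZ p hp hp1 hp2).2⟩⟩
  have hW : ∀ᶠ p' : ℝ × G × G in 𝓝 p, |p'.1| < lifespan b ∧ ‖p'.2.1‖ < 1 ∧ ‖p'.2.2‖ < 1 := by
    have c1 : ContinuousAt (fun p' : ℝ × G × G => |p'.1|) p := by fun_prop
    have c2 : ContinuousAt (fun p' : ℝ × G × G => ‖p'.2.1‖) p := by fun_prop
    have c3 : ContinuousAt (fun p' : ℝ × G × G => ‖p'.2.2‖) p := by fun_prop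
    exact (c1.eventually_lt continuousAt_const hp).and
      ((c2.eventually_lt continuousAt_const hp1).and (c3.eventually_lt continuousAt_const hp2))
  have hball : ∀ p : ℝ × G × G, |p.1| < lifespan b → ‖p.2.1‖ < 1 → ‖p.2.2‖ < 1 →
      Z p ∈ Metric.ball (0 : Fin 7 → G) 2 := by
    intro p hp hp1 hp2
    have h := norm_add_le (Z p - init p.2.1 p.2.2) (init p.2.1 p.2.2)
    rw [sub_add_cancel] at h
    rw [mem_ball_zero_iff]
    linarith [(hZ p hp hp1 hp2).2.1, norm_init_le hp1.le hp2.le]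
  -- The fixed points have norm at most `1 + 1/10`, hence lie well inside the open ball of radius
  -- `2`, on which the Picard map contracts by `1/10`.
  refine contDiffAt_of_fixedPoint (B := Metric.ball 0 2) (K := 1 / 10)
    (Φ := fun x => picard b R₁ R₂ I x.1.1 x.1.2.1 x.1.2.2 x.2) (by simp) (by norm_num) ?_
    (Metric.isOpen_ball.mem_nhds (hball p hp hp1 hp2)) ?_ ?_
  · apply ContDiff.contDiffAt
    have hi : ContDiff ℝ ∞ (fun x : (ℝ × G × G) × (Fin 7 → G) => init x.1.2.1 x.1.2.2) :=
      contDiff_init.comp (contDiff_fst.snd)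
    have hf : ContDiff ℝ ∞ (fun x : (ℝ × G × G) × (Fin 7 → G) => field b R₁ R₂ x.2) :=
      (contDiff_field b).comp contDiff_snd
    refine contDiff_pi.2 fun i => ?_
    have hi' := contDiff_pi.1 hi i
    have hf' := contDiff_pi.1 hf i
    unfold picard
    fun_prop
  · filter_upwards [hW] with p' hp' z hz z' hz'
    have e : picard b R₁ R₂ I p'.1 p'.2.1 p'.2.2 z - picard b R₁ R₂ I p'.1 p'.2.1 p'.2.2 z'
        = (fun i => p'.1 • I (field b R₁ R₂ z i)) - fun i => p'.1 • I (field b R₁ R₂ z' i) := by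
      funext i; simp [picard]
    rw [e]
    exact (boundedLip_picard b h₁ h₂ hI hp'.1).2 z z' (mem_ball_zero_iff.1 hz).le
      (mem_ball_zero_iff.1 hz').le
  · filter_upwards [hW] with p' hp'
    exact ⟨hball p' hp'.1 hp'.2.1 hp'.2.2, (hZ p' hp'.1 hp'.2.1 hp'.2.2).1⟩

end Banach

end BEquation

/-! ### Polynomials in time with values in the smooth functions -/

namespace SmoothCircle

/-- The polynomials with coefficients in `C^∞(S¹)`, to be normed by the sum of the `C^k`-norms (with
weight `l`) of the coefficients. -/
def Poly (_ : ℕ) (_ : {l : ℝ // 0 < l}) : Type := Polynomial SmoothCircle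

namespace Poly

variable (k : ℕ) (l : {l : ℝ // 0 < l})

noncomputable instance : CommRing (Poly k l) := inferInstanceAs (CommRing (Polynomial SmoothCircle))

noncomputable instance : Algebra ℝ (Poly k l) :=
  inferInstanceAs (Algebra ℝ (Polynomial SmoothCircle))

/-- The `ℓ¹`-norm of a polynomial. -/
noncomputable def polyNorm (p : Polynomial SmoothCircle) : ℝ :=
  p.sum fun _ a => ckNorm l k a

theorem polyNorm_eq (p : Polynomial SmoothCircle) {n : ℕ} (hn : p.natDegree < n) :
    polyNorm k l p = ∑ i ∈ Finset.range n, ckNorm l k (p.coeff i) :=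
  Polynomial.sum_over_range' p (fun _ => ckNorm_zero k) n hn

theorem polyNorm_add_le (p q : Polynomial SmoothCircle) :
    polyNorm k l (p + q) ≤ polyNorm k l p + polyNorm k l q := by
  set n := max p.natDegree q.natDegree + 1
  rw [polyNorm_eq k l p (n := n) (by omega), polyNorm_eq k l q (n := n) (by omega),
    polyNorm_eq k l (p + q) (n := n) (by have := Polynomial.natDegree_add_le p q; omega),
    ← Finset.sum_add_distrib]
  refine Finset.sum_le_sum fun i _ => ?_
  rw [Polynomial.coeff_add]
  exact ckNorm_add_le l.2.le k _ _

theorem polyNorm_zero : polyNorm k l 0 = 0 := Polynomial.sum_zero_index _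

theorem polyNorm_monomial (i : ℕ) (a : SmoothCircle) :
    polyNorm k l (Polynomial.monomial i a) = ckNorm l k a :=
  Polynomial.sum_monomial_index a _ (ckNorm_zero k)

theorem polyNorm_sum_le {ι : Type*} (s : Finset ι) (f : ι → Polynomial SmoothCircle) :
    polyNorm k l (∑ i ∈ s, f i) ≤ ∑ i ∈ s, polyNorm k l (f i) :=
  Finset.le_sum_of_subadditive _ (polyNorm_zero k l).le (polyNorm_add_le k l) s f

theorem polyNorm_mul_le (p q : Polynomial SmoothCircle) :
    polyNorm k l (p * q) ≤ polyNorm k l p * polyNorm k l q := by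
  have hr : polyNorm k l p * polyNorm k l q = ∑ i ∈ p.support, ∑ j ∈ q.support,
      ckNorm l k (p.coeff i) * ckNorm l k (q.coeff j) := Finset.sum_mul_sum _ _ _ _
  rw [Polynomial.mul_eq_sum_sum, hr]
  refine (polyNorm_sum_le k l _ _).trans (Finset.sum_le_sum fun i _ => ?_)
  rw [Polynomial.sum_def]
  refine (polyNorm_sum_le k l _ _).trans (Finset.sum_le_sum fun j _ => ?_)
  rw [polyNorm_monomial]
  exact ckNorm_mul_le l.2.le k _ _

theorem polyNorm_smul (c : ℝ) (p : Polynomial SmoothCircle) :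
    polyNorm k l (c • p) = |c| * polyNorm k l p := by
  have hd := Polynomial.natDegree_smul_le c p
  rw [polyNorm_eq k l (c • p) (n := p.natDegree + 1) (by omega),
    polyNorm_eq k l p (n := p.natDegree + 1) (by omega), Finset.mul_sum]
  simp only [Polynomial.coeff_smul, ckNorm_smul]

theorem polyNorm_neg (p : Polynomial SmoothCircle) : polyNorm k l (-p) = polyNorm k l p := by
  have := polyNorm_smul k l (-1) p
  simpa using this

theorem eq_zero_of_polyNorm_eq_zero (p : Polynomial SmoothCircle) (h : polyNorm k l p = 0) :
    p = 0 := by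
  ext1 i
  rw [polyNorm_eq k l p (n := max p.natDegree i + 1) (by omega),
    Finset.sum_eq_zero_iff_of_nonneg fun i _ => ckNorm_nonneg l.2.le k _] at h
  have h1 := h i (Finset.mem_range.2 (by omega))
  have h2 := norm_jet_zero_le_ckNorm l.2.le k (p.coeff i)
  rw [h1] at h2
  rw [Polynomial.coeff_zero]
  exact jet_zero_injective ((norm_le_zero_iff.1 h2).trans (map_zero _).symm)

noncomputable instance : NormedCommRing (Poly k l) where
  __ := RingNorm.toNormedRing
    { toFun := polyNorm k l
      map_zero' := polyNorm_zero k l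
      add_le' := polyNorm_add_le k l
      neg' := polyNorm_neg k l
      mul_le' := polyNorm_mul_le k l
      eq_zero_of_map_eq_zero' := eq_zero_of_polyNorm_eq_zero k l : RingNorm (Poly k l) }
  mul_comm := mul_comm

noncomputable instance : NormedAlgebra ℝ (Poly k l) where
  norm_smul_le c p := (polyNorm_smul k l c p).le

instance : NormOneClass (Poly k l) :=
  ⟨(polyNorm_monomial k l 0 1).trans (ckNorm_one k)⟩

variable {k l}

/-- A linear map on the polynomials, given by its values on the monomials. -/
noncomputable def ofMonomials {G : Type*} [NormedAddCommGroup G] [NormedSpace ℝ G]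
    (f : ℕ → SmoothCircle →ₗ[ℝ] G) (C : ℝ) (hf : ∀ i a, ‖f i a‖ ≤ C * ckNorm l k a) :
    Poly k l →L[ℝ] G :=
  LinearMap.mkContinuous (Polynomial.lsum f : Polynomial SmoothCircle →ₗ[ℝ] G) C fun p => by
    refine (norm_sum_le _ _).trans ?_
    refine (Finset.sum_le_sum fun i _ => hf _ _).trans (le_of_eq ?_)
    exact (Finset.mul_sum _ _ _).symm

theorem norm_ofMonomials_le {G : Type*} [NormedAddCommGroup G] [NormedSpace ℝ G]
    (f : ℕ → SmoothCircle →ₗ[ℝ] G) (hf : ∀ i a, ‖f i a‖ ≤ 1 * ckNorm l k a) (p : Poly k l) :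
    ‖ofMonomials f 1 hf p‖ ≤ ‖p‖ := by
  simpa using (ofMonomials f 1 hf).le_of_opNorm_le (LinearMap.mkContinuous_norm_le _ zero_le_one _) p

theorem norm_monomial (i : ℕ) (a : SmoothCircle) :
    ‖(show Poly k l from Polynomial.monomial i a)‖ = ckNorm l k a := polyNorm_monomial k l i a

end Poly

/-! ### Operators on the polynomials in time -/

/-- The resolvent acting on the coefficients. -/
noncomputable def polyResolvent (s : ℝˣ) : Polynomial SmoothCircle →ₗ[ℝ] Polynomial SmoothCircle :=
  Polynomial.lsum fun i => (Polynomial.monomial i).restrictScalars ℝ ∘ₗ resolvent s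

/-- The primitive of a polynomial in time which vanishes at `0`. -/
noncomputable def polyIntegral : Polynomial SmoothCircle →ₗ[ℝ] Polynomial SmoothCircle :=
  Polynomial.lsum fun i => ((i : ℝ) + 1)⁻¹ • (Polynomial.monomial (i + 1)).restrictScalars ℝ

/-- Evaluation at a time. -/
noncomputable def polyEval (t : ℝ) : Polynomial SmoothCircle →ₐ[ℝ] SmoothCircle :=
  (Polynomial.aeval (algebraMap ℝ SmoothCircle t)).restrictScalars ℝ

/-- The constant polynomials. -/
noncomputable def polyConst : SmoothCircle →ₐ[ℝ] Polynomial SmoothCircle :=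
  (Algebra.ofId SmoothCircle (Polynomial SmoothCircle)).restrictScalars ℝ

/-- The rescaling of the time. -/
noncomputable def polyScale (t : ℝ) : Polynomial SmoothCircle →ₐ[ℝ] Polynomial SmoothCircle :=
  (Polynomial.aeval (Polynomial.C (algebraMap ℝ SmoothCircle t) * Polynomial.X)).restrictScalars ℝ

theorem polyResolvent_monomial (s : ℝˣ) (i : ℕ) (a : SmoothCircle) :
    polyResolvent s (Polynomial.monomial i a) = Polynomial.monomial i (resolvent s a) := by
  simp [polyResolvent, Polynomial.lsum_apply]

theorem polyIntegral_monomial (i : ℕ) (a : SmoothCircle) :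
    polyIntegral (Polynomial.monomial i a)
      = Polynomial.monomial (i + 1) (((i : ℝ) + 1)⁻¹ • a) := by
  rw [polyIntegral, Polynomial.lsum_apply,
    Polynomial.sum_monomial_index a _ (LinearMap.map_zero _), LinearMap.smul_apply,
    LinearMap.restrictScalars_apply, Polynomial.smul_monomial]

theorem polyEval_monomial (t : ℝ) (i : ℕ) (a : SmoothCircle) :
    polyEval t (Polynomial.monomial i a) = t ^ i • a := by
  rw [polyEval, AlgHom.restrictScalars_apply, Polynomial.aeval_monomial, ← map_pow,
    Algebra.smul_def, mul_comm]
  rfl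

theorem polyScale_monomial (t : ℝ) (i : ℕ) (a : SmoothCircle) :
    polyScale t (Polynomial.monomial i a) = Polynomial.monomial i (t ^ i • a) := by
  rw [polyScale, AlgHom.restrictScalars_apply, Polynomial.aeval_monomial, mul_pow, ← map_pow,
    ← map_pow, Polynomial.algebraMap_eq, ← mul_assoc, ← map_mul, Algebra.smul_def,
    Polynomial.C_mul_X_pow_eq_monomial, mul_comm]

theorem polyConst_apply (a : SmoothCircle) : polyConst a = Polynomial.monomial 0 a := rfl

theorem polyScale_const (t : ℝ) (a : SmoothCircle) : polyScale t (polyConst a) = polyConst a := by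
  rw [polyConst_apply, polyScale_monomial, pow_zero, one_smul]

theorem polyEval_const (t : ℝ) (a : SmoothCircle) : polyEval t (polyConst a) = a := by
  rw [polyConst_apply, polyEval_monomial, pow_zero, one_smul]

theorem polyEval_one_scale (t : ℝ) (p : Polynomial SmoothCircle) :
    polyEval 1 (polyScale t p) = polyEval t p := by
  induction p using Polynomial.induction_on' with
  | add p q hp hq => simp only [map_add, hp, hq]
  | monomial i a => rw [polyScale_monomial, polyEval_monomial, polyEval_monomial, one_pow, one_smul]

theorem polyScale_resolvent (t : ℝ) (s : ℝˣ) (p : Polynomial SmoothCircle) :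
    polyScale t (polyResolvent s p) = polyResolvent s (polyScale t p) := by
  induction p using Polynomial.induction_on' with
  | add p q hp hq => simp only [map_add, hp, hq]
  | monomial i a =>
    rw [polyScale_monomial, polyResolvent_monomial, polyResolvent_monomial, polyScale_monomial,
      map_smul (resolvent s)]

/-- Change of variable in the primitive. Through it, Picard iteration followed by rescaling is
Picard iteration with the factor `t` in front of the integral. -/
theorem polyScale_integral (t : ℝ) (p : Polynomial SmoothCircle) :
    polyScale t (polyIntegral p) = t • polyIntegral (polyScale t p) := by
  induction p using Polynomial.induction_on' with
  | add p q hp hq => simp only [map_add, hp, hq, smul_add]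
  | monomial i a =>
    rw [polyScale_monomial, polyIntegral_monomial, polyIntegral_monomial, polyScale_monomial,
      Polynomial.smul_monomial]
    congr 1
    rw [smul_smul, smul_smul, smul_smul]
    congr 1
    ring

theorem polyEval_resolvent (t : ℝ) (s : ℝˣ) (p : Polynomial SmoothCircle) :
    polyEval t (polyResolvent s p) = resolvent s (polyEval t p) := by
  induction p using Polynomial.induction_on' with
  | add p q hp hq => simp only [map_add, hp, hq]
  | monomial i a => rw [polyResolvent_monomial, polyEval_monomial, polyEval_monomial,
      map_smul (resolvent s)]

theorem hasDerivAt_polyEval_integral {G : Type*} [NormedAddCommGroup G] [NormedSpace ℝ G]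
    (J : SmoothCircle →ₗ[ℝ] G) (p : Polynomial SmoothCircle) (t : ℝ) :
    HasDerivAt (fun t => J (polyEval t (polyIntegral p))) (J (polyEval t p)) t := by
  induction p using Polynomial.induction_on' with
  | add p q hp hq => simpa only [map_add] using hp.fun_add hq
  | monomial i a =>
    simp only [polyIntegral_monomial, polyEval_monomial, map_smul, smul_smul]
    refine (((hasDerivAt_pow (i + 1) t).mul_const ((i : ℝ) + 1)⁻¹).smul_const (J a)).congr_deriv ?_
    congr 1
    push_cast
    have : (i : ℝ) + 1 ≠ 0 := by positivity
    field_simp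

/-! ### The completions -/

open UniformSpace

/-- The Banach algebra obtained by completion of the polynomials in time. -/
abbrev PolyCompl (k : ℕ) (l : {l : ℝ // 0 < l}) : Type := Completion (Poly k l)

namespace PolyCompl

variable (k : ℕ) (l : {l : ℝ // 0 < l})

instance : NormOneClass (PolyCompl k l) :=
  ⟨by rw [← Completion.coe_one, Completion.norm_coe, norm_one]⟩

/-- The inclusion of the polynomials. -/
noncomputable def ofPoly : Polynomial SmoothCircle →ₐ[ℝ] PolyCompl k l :=
  AlgHom.mk' (Completion.coeRingHom : Poly k l →+* PolyCompl k l)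
    fun c p => Completion.coe_smul (X := Poly k l) c p

/-- The inclusion of the constant polynomials. -/
noncomputable def ofSmooth : SmoothCircle →ₐ[ℝ] PolyCompl k l :=
  (ofPoly k l).comp polyConst

theorem norm_ofPoly_monomial (i : ℕ) (a : SmoothCircle) :
    ‖ofPoly k l (Polynomial.monomial i a)‖ = ckNorm l k a :=
  (Completion.norm_coe (E := Poly k l) (Polynomial.monomial i a)).trans (Poly.norm_monomial i a)

theorem norm_ofSmooth (a : SmoothCircle) : ‖ofSmooth k l a‖ = ckNorm l k a :=
  norm_ofPoly_monomial k l 0 a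

theorem continuous_ofSmooth : Continuous (ofSmooth k l) := by
  rw [continuous_iff_continuousAt]
  intro a
  rw [ContinuousAt, tendsto_iff_norm_sub_tendsto_zero]
  simp only [← map_sub, norm_ofSmooth]
  have h : Continuous fun b => ckNorm l k (b - a) :=
    (continuous_ckNorm l k).comp (continuous_id.sub continuous_const)
  simpa [ckNorm_zero] using h.tendsto a

/-- The resolvents on the completion. -/
noncomputable def resolventL (s : ℝˣ) : PolyCompl k l →L[ℝ] PolyCompl k l :=
  (Poly.ofMonomials (k := k) (l := l)
    (fun i => (ofPoly k l).toLinearMap ∘ₗ (Polynomial.monomial i).restrictScalars ℝ ∘ₗ resolvent s) 1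
    fun i a => by
      rw [one_mul]
      exact (norm_ofPoly_monomial k l i _).le.trans (ckNorm_resolvent_le l.2.le k s a)).fromCompletion

/-- The integration in time on the completion. -/
noncomputable def integralL : PolyCompl k l →L[ℝ] PolyCompl k l :=
  (Poly.ofMonomials (k := k) (l := l)
    (fun i => (ofPoly k l).toLinearMap ∘ₗ
      (((i : ℝ) + 1)⁻¹ • (Polynomial.monomial (i + 1)).restrictScalars ℝ)) 1
    fun i a => by
      have h1 : |((i : ℝ) + 1)⁻¹| ≤ 1 := by
        rw [abs_of_pos (by positivity)]
        exact inv_le_one_of_one_le₀ (by linarith [(Nat.cast_nonneg i : (0 : ℝ) ≤ i)])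
      change ‖ofPoly k l (((i : ℝ) + 1)⁻¹ • Polynomial.monomial (i + 1) a)‖ ≤ _
      rw [map_smul, norm_smul, norm_ofPoly_monomial]
      exact mul_le_mul_of_nonneg_right h1 (ckNorm_nonneg l.2.le k a)).fromCompletion

/-- The evaluation at the time `1` on the completion. -/
noncomputable def evalL : PolyCompl k l →L[ℝ] PolyCompl k l :=
  (Poly.ofMonomials (k := k) (l := l) (fun _ => (ofSmooth k l).toLinearMap) 1
    fun _ a => by rw [one_mul]; exact (norm_ofSmooth k l a).le).fromCompletion

/-- The `k`-th derivative of the value at the time `1`, on the completion. -/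
noncomputable def jetL : PolyCompl k l →L[ℝ] C(UnitAddCircle, ℝ) :=
  (Poly.ofMonomials (k := k) (l := l) (fun _ => jet k) ((l : ℝ) ^ k)⁻¹
    fun _ a => by
      rw [le_inv_mul_iff₀ (pow_pos l.2 k)]
      exact norm_jet_le_ckNorm l.2.le k a).fromCompletion

variable {k l}

theorem norm_le_of_ofMonomials {G : Type*} [NormedAddCommGroup G] [NormedSpace ℝ G]
    [CompleteSpace G] (f : ℕ → SmoothCircle →ₗ[ℝ] G) (hf : ∀ i a, ‖f i a‖ ≤ 1 * ckNorm l k a)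
    (x : PolyCompl k l) : ‖(Poly.ofMonomials f 1 hf).fromCompletion x‖ ≤ ‖x‖ := by
  induction x using Completion.induction_on with
  | hp => exact isClosed_le (by fun_prop) continuous_norm
  | ih p =>
    rw [ContinuousLinearMap.fromCompletion_apply_coe, Completion.norm_coe]
    exact Poly.norm_ofMonomials_le f hf p

theorem norm_resolventL_le (s : ℝˣ) (x : PolyCompl k l) : ‖resolventL k l s x‖ ≤ ‖x‖ :=
  norm_le_of_ofMonomials _ _ x

theorem norm_integralL_le (x : PolyCompl k l) : ‖integralL k l x‖ ≤ ‖x‖ :=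
  norm_le_of_ofMonomials _ _ x

theorem norm_evalL_le (x : PolyCompl k l) : ‖evalL k l x‖ ≤ ‖x‖ :=
  norm_le_of_ofMonomials _ _ x

theorem fromCompletion_ofMonomials_monomial {G : Type*} [NormedAddCommGroup G] [NormedSpace ℝ G]
    [CompleteSpace G] (f : ℕ → SmoothCircle →ₗ[ℝ] G) (C : ℝ)
    (hf : ∀ i a, ‖f i a‖ ≤ C * ckNorm l k a) (i : ℕ) (a : SmoothCircle) :
    (Poly.ofMonomials f C hf).fromCompletion (ofPoly k l (Polynomial.monomial i a)) = f i a := by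
  refine (ContinuousLinearMap.fromCompletion_apply_coe _ _).trans ?_
  change Polynomial.sum (Polynomial.monomial i a) (fun i a => f i a) = f i a
  exact Polynomial.sum_monomial_index a _ (map_zero _)

theorem ofPoly_resolvent (s : ℝˣ) (p : Polynomial SmoothCircle) :
    ofPoly k l (polyResolvent s p) = resolventL k l s (ofPoly k l p) := by
  induction p using Polynomial.induction_on' with
  | add p q hp hq => simp only [map_add, hp, hq]
  | monomial i a =>
    rw [polyResolvent_monomial, resolventL, fromCompletion_ofMonomials_monomial]; rfl

theorem ofPoly_integral (p : Polynomial SmoothCircle) :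
    ofPoly k l (polyIntegral p) = integralL k l (ofPoly k l p) := by
  induction p using Polynomial.induction_on' with
  | add p q hp hq => simp only [map_add, hp, hq]
  | monomial i a =>
    rw [polyIntegral_monomial, integralL, fromCompletion_ofMonomials_monomial]
    change _ = ofPoly k l (((i : ℝ) + 1)⁻¹ • Polynomial.monomial (i + 1) a)
    rw [Polynomial.smul_monomial]

theorem evalL_ofPoly (p : Polynomial SmoothCircle) :
    evalL k l (ofPoly k l p) = ofSmooth k l (polyEval 1 p) := by
  induction p using Polynomial.induction_on' with
  | add p q hp hq => simp only [map_add, hp, hq]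
  | monomial i a =>
    rw [polyEval_monomial, evalL, fromCompletion_ofMonomials_monomial, one_pow, one_smul]; rfl

theorem jetL_ofPoly (p : Polynomial SmoothCircle) :
    jetL k l (ofPoly k l p) = jet k (polyEval 1 p) := by
  induction p using Polynomial.induction_on' with
  | add p q hp hq => simp only [map_add, hp, hq]
  | monomial i a =>
    rw [polyEval_monomial, jetL, fromCompletion_ofMonomials_monomial, one_pow, one_smul]

theorem resolventL_ofSmooth (s : ℝˣ) (a : SmoothCircle) :
    ofSmooth k l (resolvent s a) = resolventL k l s (ofSmooth k l a) := by
  change ofPoly k l (polyConst _) = resolventL k l s (ofPoly k l (polyConst _))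
  rw [← ofPoly_resolvent, polyConst_apply, polyConst_apply, polyResolvent_monomial]

theorem jetL_ofSmooth (a : SmoothCircle) : jetL k l (ofSmooth k l a) = jet k a := by
  change jetL k l (ofPoly k l (polyConst _)) = _
  rw [jetL_ofPoly, polyEval_const]

end PolyCompl

end SmoothCircle

/-! ### Criteria for smoothness in the Fréchet sense -/

section Frechet

variable {X : Type*} [AddCommGroup X] [Module ℝ X] [TopologicalSpace X]

/-- `D` is a system of iterated directional derivatives of `f` on `U`. -/
def IsIteratedDirDeriv {Y : Type*} [AddCommGroup Y] [Module ℝ Y] [TopologicalSpace Y]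
    (D : (n : ℕ) → X → (Fin n → X) → Y) (f : X → Y) (U : Set X) : Prop :=
  (∀ x ∈ U, ∀ h : Fin 0 → X, D 0 x h = f x) ∧
    (∀ n, ∀ x ∈ U, ∀ h : Fin n → X, ∀ k : X,
      HasDirDeriv (fun y => D n y h) x k (D (n + 1) x (Fin.snoc h k))) ∧
    (∀ n, ContinuousOn (fun p : X × (Fin n → X) => D n p.1 p.2) (U ×ˢ univ))

/-- The restriction of a smooth map to an affine subspace is smooth. -/
theorem FrechetSmoothOn.comp_affine {W Y : Type*} [AddCommGroup W] [Module ℝ W] [TopologicalSpace W]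
    [AddCommGroup Y] [Module ℝ Y] [TopologicalSpace Y] {f : X → Y} {U : Set X}
    (hf : FrechetSmoothOn f U) (i : W →L[ℝ] X) {g : W → X} (hg : Continuous g)
    (hgi : ∀ w v, g (w + v) = g w + i v) {V : Set W} (hV : MapsTo g V U) :
    FrechetSmoothOn (fun w => f (g w)) V := by
  obtain ⟨D, h0, h1, h2⟩ := hf
  refine ⟨fun n w h => D n (g w) fun j => i (h j), fun w hw h => h0 _ (hV hw) _,
    fun n w hw h k => ?_, fun n => ?_⟩
  · have := h1 n (g w) (hV hw) (fun j => i (h j)) (i k)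
    unfold HasDirDeriv at this ⊢
    have e : (fun j => i (Fin.snoc (α := fun _ => W) h k j))
        = Fin.snoc (α := fun _ => X) (fun j => i (h j)) (i k) := by
      funext j
      refine Fin.lastCases ?_ (fun j => ?_) j <;> simp
    simpa only [hgi, map_smul, e] using this
  · refine (h2 n).comp (f := fun p : W × (Fin n → W) => (g p.1, fun j => i (p.2 j))) ?_ ?_
    · fun_prop
    · exact fun p hp => ⟨hV hp.1, mem_univ _⟩

/-- A smooth map between Banach spaces, composed with a continuous linear map. -/
theorem frechetSmoothOn_of_contDiffAt {E G : Type*} [NormedAddCommGroup E] [NormedSpace ℝ E]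
    [NormedAddCommGroup G] [NormedSpace ℝ G] {F : E → G} {V : Set E}
    (hF : ∀ e ∈ V, ContDiffAt ℝ ∞ F e) (i : X →L[ℝ] E) :
    FrechetSmoothOn (fun x => F (i x)) (i ⁻¹' V) := by
  have hD : ∀ n : ℕ, ∀ e ∈ V, ContDiffAt ℝ ∞ (iteratedFDeriv ℝ n F) e := fun n e he =>
    (hF e he).iteratedFDeriv_right (by exact_mod_cast le_top)
  -- The directions are reversed because `Fin.snoc` appends the new direction at the end, while the
  -- iterated Fréchet derivative takes it as its first argument.
  refine ⟨fun n x h => iteratedFDeriv ℝ n F (i x) fun j => i (h j.rev),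
    fun x _ h => iteratedFDeriv_zero_apply _,
    fun n x hx h k => ?_, fun n => ?_⟩
  · have h1 : HasFDerivAt (iteratedFDeriv ℝ n F) (fderiv ℝ (iteratedFDeriv ℝ n F) (i x)) (i x) :=
      ((hD n _ hx).differentiableAt (by simp)).hasFDerivAt
    have h2 : HasDerivAt (fun ε : ℝ => i x + ε • i k) (i k) 0 := by
      simpa using ((hasDerivAt_id (0 : ℝ)).smul_const (i k)).const_add (i x)
    have h3 : HasDerivAt (fun ε : ℝ => iteratedFDeriv ℝ n F (i x + ε • i k))
        (fderiv ℝ (iteratedFDeriv ℝ n F) (i x) (i k)) 0 :=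
      h1.comp_hasDerivAt_of_eq (0 : ℝ) h2 (by simp)
    have h4 := (ContinuousMultilinearMap.apply ℝ (fun _ : Fin n => E) G
      (fun j => i (h j.rev))).hasFDerivAt.comp_hasDerivAt (0 : ℝ) h3
    have e : iteratedFDeriv ℝ (n + 1) F (i x) (fun j => i (Fin.snoc (α := fun _ => X) h k j.rev))
        = fderiv ℝ (iteratedFDeriv ℝ n F) (i x) (i k) (fun j => i (h j.rev)) := by
      rw [iteratedFDeriv_succ_apply_left]
      congr 1
      · simp
      · funext j
        simp [Fin.tail, Fin.rev_succ]
    rw [hasDerivAt_iff_tendsto_slope_zero] at h4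
    unfold HasDirDeriv
    change Tendsto _ _ (𝓝 (iteratedFDeriv ℝ (n + 1) F (i x)
      fun j => i (Fin.snoc (α := fun _ => X) h k j.rev)))
    rw [e]
    simpa using h4
  · have h1 : ContinuousOn (fun p : X × (Fin n → X) => iteratedFDeriv ℝ n F (i p.1))
        ((i ⁻¹' V) ×ˢ univ) := by
      intro p hp
      refine ContinuousAt.continuousWithinAt ?_
      exact ((hD n _ hp.1).continuousAt).comp (f := fun p : X × (Fin n → X) => i p.1) (by fun_prop)
    have h2 : Continuous (fun p : X × (Fin n → X) => fun j : Fin n => i (p.2 j.rev)) := by fun_prop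
    exact h1.eval h2.continuousOn

end Frechet

namespace SmoothCircle

section Jets

variable {X : Type*} [AddCommGroup X] [Module ℝ X] [TopologicalSpace X] [ContinuousAdd X]
  [ContinuousSMul ℝ X]

/-- The iterated directional derivatives of a map into `C^∞(S¹)`. -/
noncomputable def dirD (f : X → SmoothCircle) : (n : ℕ) → X → (Fin n → X) → SmoothCircle
  | 0, x, _ => f x
  | n + 1, x, h => limUnder (𝓝[≠] (0 : ℝ)) fun ε =>
      ε⁻¹ • (dirD f n (x + ε • h (Fin.last n)) (Fin.init h) - dirD f n x (Fin.init h))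

/-- A map into `C^∞(S¹)` is smooth if each of its jets is locally smooth. -/
theorem frechetSmoothOn_of_jet {f : X → SmoothCircle} {U : Set X} (hU : IsOpen U)
    (hf : ∀ x ∈ U, ∀ k, ∃ N, IsOpen N ∧ x ∈ N ∧ FrechetSmoothOn (fun y => jet k (f y)) N) :
    FrechetSmoothOn f U := by
  have hline : ∀ x v : X, ∀ N : Set X, IsOpen N → x ∈ N →
      ∀ᶠ ε in 𝓝[≠] (0 : ℝ), x + ε • v ∈ N := by
    intro x v N hN hx
    have hc : Continuous fun ε : ℝ => x + ε • v := by fun_prop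
    exact nhdsWithin_le_nhds (hc.continuousAt.eventually_mem (hN.mem_nhds (by simpa using hx)))
  have step : ∀ n, (∀ x ∈ U, ∀ h : Fin n → X, ∀ k N D, IsOpen N → x ∈ N →
      IsIteratedDirDeriv D (fun y => jet k (f y)) N → jet k (dirD f n x h) = D n x h) →
      ∀ x ∈ U, ∀ (h : Fin n → X) (v : X),
      HasDirDeriv (fun y => dirD f n y h) x v (dirD f (n + 1) x (Fin.snoc h v)) := by
    intro n hn x hx h v
    choose N hNo hNx D hD using fun k => hf x hx k
    have hq : ∀ k, Tendsto (fun ε : ℝ => jet k (ε⁻¹ • (dirD f n (x + ε • v) h - dirD f n x h)))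
        (𝓝[≠] 0) (𝓝 (D k (n + 1) x (Fin.snoc h v))) := by
      intro k
      have h1 := (hD k).2.1 n x (hNx k) h v
      unfold HasDirDeriv at h1
      refine h1.congr' ?_
      filter_upwards [hline x v _ (hNo k) (hNx k), hline x v _ hU hx] with ε hε hε'
      rw [map_smul, map_sub, hn _ hε' h k _ _ (hNo k) hε (hD k),
        hn _ hx h k _ _ (hNo k) (hNx k) (hD k)]
    -- Completeness of `C^∞(S¹)` is available for sequences, so the limit is produced along
    -- `1/(m+1)`; the full difference quotient then tends to it jet by jet.
    have hseq : Tendsto (fun m : ℕ => 1 / ((m : ℝ) + 1)) atTop (𝓝[≠] 0) :=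
      tendsto_nhdsWithin_iff.2 ⟨tendsto_one_div_add_atTop_nhds_zero_nat,
        Eventually.of_forall fun m => by
          have : (0 : ℝ) < 1 / ((m : ℝ) + 1) := by positivity
          exact this.ne'⟩
    obtain ⟨y, hy⟩ := exists_jet_eq (fun k => (hq k).comp hseq)
    have hlim : Tendsto (fun ε : ℝ => ε⁻¹ • (dirD f n (x + ε • v) h - dirD f n x h))
        (𝓝[≠] 0) (𝓝 y) := tendsto_nhds_iff.2 fun k => by rw [hy]; exact hq k
    have : dirD f (n + 1) x (Fin.snoc h v) = y := by
      rw [dirD]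
      simp only [Fin.snoc_last, Fin.init_snoc]
      exact hlim.limUnder_eq
    rw [this]
    exact hlim
  -- `dirD` is one global candidate, whereas the systems `D` live on neighbourhoods that depend on
  -- `k`. Uniqueness of limits identifies the two, order by order.
  have key : ∀ n, ∀ x ∈ U, ∀ h : Fin n → X, ∀ k N D, IsOpen N → x ∈ N →
      IsIteratedDirDeriv D (fun y => jet k (f y)) N → jet k (dirD f n x h) = D n x h := by
    intro n
    induction n with
    | zero => exact fun x _ h k N D _ hx hD => (hD.1 x hx h).symm
    | succ n ih =>
      intro x hx h k N D hN hxN hD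
      have h1 := step n ih x hx (Fin.init h) (h (Fin.last n))
      have h2 := hD.2.1 n x hxN (Fin.init h) (h (Fin.last n))
      rw [Fin.snoc_init_self] at h1 h2
      refine tendsto_nhds_unique (tendsto_nhds_iff.1 h1 k) (Tendsto.congr' ?_ h2)
      filter_upwards [hline x (h (Fin.last n)) _ hN hxN, hline x (h (Fin.last n)) _ hU hx]
        with ε hε hε'
      rw [map_smul, map_sub, ih _ hε' _ k _ _ hN hε hD, ih _ hx _ k _ _ hN hxN hD]
  refine ⟨dirD f, fun x _ h => rfl, fun n x hx h v => step n (key n) x hx h v, fun n => ?_⟩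
  rintro ⟨x, h⟩ ⟨hx, -⟩
  refine ContinuousAt.continuousWithinAt ?_
  refine tendsto_nhds_iff.2 fun k => ?_
  obtain ⟨N, hN, hxN, D, hD⟩ := hf x hx k
  have hopen : ∀ᶠ p : X × (Fin n → X) in 𝓝 (x, h), p.1 ∈ N ∩ U :=
    continuous_fst.continuousAt.eventually_mem ((hN.inter hU).mem_nhds ⟨hxN, hx⟩)
  have h1 : ContinuousAt (fun p : X × (Fin n → X) => D n p.1 p.2) (x, h) :=
    (hD.2.2 n).continuousAt ((hN.prod isOpen_univ).mem_nhds ⟨hxN, mem_univ _⟩)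
  rw [key n x hx h k N D hN hxN hD]
  refine h1.tendsto.congr' ?_
  filter_upwards [hopen] with p hp
  exact (key n p.1 hp.2 p.2 k N D hN hp.1 hD).symm

end Jets

end SmoothCircle

theorem FrechetSmoothOn.congr {X Y : Type*} [AddCommGroup X] [Module ℝ X] [TopologicalSpace X]
    [AddCommGroup Y] [Module ℝ Y] [TopologicalSpace Y] {f g : X → Y} {U : Set X}
    (hf : FrechetSmoothOn f U) (h : EqOn f g U) : FrechetSmoothOn g U := by
  obtain ⟨D, h0, h1, h2⟩ := hf
  exact ⟨D, fun x hx v => (h0 x hx v).trans (h hx), h1, h2⟩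

/-! ### Convergence of the Picard iterates in `C^∞(S¹)` and smoothness of the limit -/

namespace BEquation

open SmoothCircle

/-- The geodesic vector field on `C^∞(S¹)`. -/
noncomputable abbrev smoothField (b : ℝ) (z : Fin 7 → SmoothCircle) : Fin 7 → SmoothCircle :=
  field b (SmoothCircle.resolvent 1) (SmoothCircle.resolvent (-1)) z

/-- The geodesic vector field on a completion of the polynomials in time. -/
noncomputable abbrev complField (b : ℝ) (k : ℕ) (l : {l : ℝ // 0 < l})
    (z : Fin 7 → PolyCompl k l) : Fin 7 → PolyCompl k l :=
  field b (PolyCompl.resolventL k l 1) (PolyCompl.resolventL k l (-1)) z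

theorem complField_ofSmooth (b : ℝ) (k : ℕ) (l : {l : ℝ // 0 < l}) (z : Fin 7 → SmoothCircle) :
    complField b k l (fun i => PolyCompl.ofSmooth k l (z i)) =
      fun i => PolyCompl.ofSmooth k l (smoothField b z i) :=
  map_field b _ (PolyCompl.resolventL_ofSmooth _) (PolyCompl.resolventL_ofSmooth _) z

/-- The Picard iterates, which are polynomials in time. -/
noncomputable def picardIter (b : ℝ) (u : SmoothCircle) (n : ℕ) : Fin 7 → Polynomial SmoothCircle :=
  (picard b (polyResolvent 1) (polyResolvent (-1)) polyIntegral 1 (polyConst u)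
    (polyConst (SmoothCircle.deriv u)))^[n] (init (polyConst u) (polyConst (SmoothCircle.deriv u)))

/-- The limit of the Picard iterates. -/
noncomputable def sol (b : ℝ) (p : ℝ × SmoothCircle) (i : Fin 7) : SmoothCircle :=
  limUnder atTop fun n => polyEval p.1 (picardIter b p.2 n i)

/-- The domain on which the Picard iterates are shown to converge. -/
def domain (b : ℝ) : Set (ℝ × SmoothCircle) :=
  {p | |p.1| < lifespan b ∧ ‖jet 0 p.2‖ < 1 ∧ ‖jet 0 (SmoothCircle.deriv p.2)‖ < 1}

theorem isOpen_domain (b : ℝ) : IsOpen (domain b) := by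
  have h0 := continuous_jet 0
  have h1 := (continuous_jet 0).comp continuous_deriv
  have o1 : IsOpen {p : ℝ × SmoothCircle | |p.1| < lifespan b} :=
    isOpen_lt (by fun_prop) continuous_const
  have o2 : IsOpen {p : ℝ × SmoothCircle | ‖jet 0 p.2‖ < 1} :=
    isOpen_lt (h0.comp continuous_snd).norm continuous_const
  have o3 : IsOpen {p : ℝ × SmoothCircle | ‖jet 0 (SmoothCircle.deriv p.2)‖ < 1} :=
    isOpen_lt (h1.comp continuous_snd).norm continuous_const
  exact o1.and (o2.and o3)

/-- Small weights work for `u` and `u'` at once; the weight depends on `k`, the smallness condition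
does not. -/
theorem exists_ckNorm_lt {u : SmoothCircle} (hu : ‖jet 0 u‖ < 1)
    (hu' : ‖jet 0 (SmoothCircle.deriv u)‖ < 1)
    (k : ℕ) : ∃ l : {l : ℝ // 0 < l}, ckNorm l k u < 1 ∧ ckNorm l k (SmoothCircle.deriv u) < 1 := by
  have h := ((eventually_ckNorm_lt k hu).and (eventually_ckNorm_lt k hu')).filter_mono
    (nhdsWithin_le_nhds (s := Ioi (0 : ℝ)))
  obtain ⟨l, hl, hl'⟩ := (h.and self_mem_nhdsWithin).exists
  exact ⟨⟨l, hl'⟩, hl⟩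

section Compl

variable (b : ℝ) (k : ℕ) (l : {l : ℝ // 0 < l})

theorem exists_complSol : ∃ Z : ℝ × PolyCompl k l × PolyCompl k l → Fin 7 → PolyCompl k l,
    ∀ p : ℝ × PolyCompl k l × PolyCompl k l, |p.1| < lifespan b → ‖p.2.1‖ < 1 → ‖p.2.2‖ < 1 →
      ContDiffAt ℝ ∞ Z p ∧ ‖Z p - init p.2.1 p.2.2‖ ≤ 1 / 10 ∧
      ∀ n, ‖(picard b (PolyCompl.resolventL k l 1) (PolyCompl.resolventL k l (-1))
        (PolyCompl.integralL k l) p.1 p.2.1 p.2.2)^[n] (init p.2.1 p.2.2) - Z p‖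
          ≤ (1 / 10) ^ n := exists_contDiffAt_picard (G := PolyCompl k l) b
  (PolyCompl.norm_resolventL_le 1) (PolyCompl.norm_resolventL_le (-1)) PolyCompl.norm_integralL_le

/-- The fixed point of the Picard map in a completion of the polynomials in time. -/
noncomputable def complSol : ℝ × PolyCompl k l × PolyCompl k l → Fin 7 → PolyCompl k l :=
  (exists_complSol b k l).choose

theorem complSol_spec (p : ℝ × PolyCompl k l × PolyCompl k l) (h : |p.1| < lifespan b)
    (h1 : ‖p.2.1‖ < 1) (h2 : ‖p.2.2‖ < 1) :
    ContDiffAt ℝ ∞ (complSol b k l) p ∧ ‖complSol b k l p - init p.2.1 p.2.2‖ ≤ 1 / 10 ∧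
      ∀ n, ‖(picard b (PolyCompl.resolventL k l 1) (PolyCompl.resolventL k l (-1))
        (PolyCompl.integralL k l) p.1 p.2.1 p.2.2)^[n] (init p.2.1 p.2.2) - complSol b k l p‖
          ≤ (1 / 10) ^ n :=
  (exists_complSol b k l).choose_spec p h h1 h2

/-- The parameters of the fixed point problem. -/
noncomputable def param : ℝ × SmoothCircle →L[ℝ] ℝ × PolyCompl k l × PolyCompl k l where
  -- The derivative of the datum is a separate coordinate, since the fixed point problem takes `u`
  -- and `u'` as independent parameters. The map stays continuous because differentiation is
  -- continuous on `C^∞(S¹)`.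
  toFun p := (p.1, PolyCompl.ofSmooth k l p.2, PolyCompl.ofSmooth k l (SmoothCircle.deriv p.2))
  map_add' p q := by simp
  map_smul' c p := by simp
  cont := by
    have h := PolyCompl.continuous_ofSmooth k l
    have h' := h.comp continuous_deriv
    exact continuous_fst.prodMk ((h.comp continuous_snd).prodMk (h'.comp continuous_snd))

variable {b k l} {t : ℝ} {u : SmoothCircle}

/-- Rescaling by `t` and including into the completion carries the polynomial iterates, which do not
know `t`, to the Banach iterates with time factor `t`. -/
theorem norm_ofPoly_sub_complSol_le (ht : |t| < lifespan b) (hu : ckNorm l k u < 1)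
    (hu' : ckNorm l k (SmoothCircle.deriv u) < 1) (n : ℕ) :
    ‖(fun i => PolyCompl.ofPoly k l (polyScale t (picardIter b u n i)))
      - complSol b k l (param k l (t, u))‖ ≤ (1 / 10) ^ n := by
  have h := (complSol_spec b k l (param k l (t, u)) ht ((PolyCompl.norm_ofSmooth k l u).trans_lt hu)
    ((PolyCompl.norm_ofSmooth k l _).trans_lt hu')).2.2 n
  have e := map_iterate_picard b (τ := 1) (σ := t) (R₁ := polyResolvent 1)
    (R₂ := polyResolvent (-1)) (I := polyIntegral)
    (S₁ := PolyCompl.resolventL k l 1) (S₂ := PolyCompl.resolventL k l (-1))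
    (K := PolyCompl.integralL k l) ((PolyCompl.ofPoly k l).comp (polyScale t))
    (fun x => by simp only [AlgHom.comp_apply, polyScale_resolvent, PolyCompl.ofPoly_resolvent])
    (fun x => by simp only [AlgHom.comp_apply, polyScale_resolvent, PolyCompl.ofPoly_resolvent])
    (fun x => by
      simp only [AlgHom.comp_apply, one_smul, polyScale_integral, map_smul,
        PolyCompl.ofPoly_integral])
    (polyConst u) (polyConst (SmoothCircle.deriv u)) n
  simp only [AlgHom.comp_apply, polyScale_const] at e
  rw [show (fun i => PolyCompl.ofPoly k l (polyScale t (picardIter b u n i))) = _ from e.symm]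
  exact h

theorem norm_ofSmooth_sub_evalL_le (ht : |t| < lifespan b) (hu : ckNorm l k u < 1)
    (hu' : ckNorm l k (SmoothCircle.deriv u) < 1) (n : ℕ) (i : Fin 7) :
    ‖PolyCompl.ofSmooth k l (polyEval t (picardIter b u n i))
      - PolyCompl.evalL k l (complSol b k l (param k l (t, u)) i)‖ ≤ (1 / 10) ^ n := by
  rw [← polyEval_one_scale, ← PolyCompl.evalL_ofPoly, ← map_sub]
  exact (PolyCompl.norm_evalL_le _).trans
    ((norm_le_pi_norm _ i).trans (norm_ofPoly_sub_complSol_le ht hu hu' n))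

theorem tendsto_pow_tenth : Tendsto (fun n : ℕ => (1 / 10 : ℝ) ^ n) atTop (𝓝 0) :=
  tendsto_pow_atTop_nhds_zero_of_lt_one (by norm_num) (by norm_num)

theorem tendsto_jet_picardIter (ht : |t| < lifespan b) (hu : ckNorm l k u < 1)
    (hu' : ckNorm l k (SmoothCircle.deriv u) < 1) (i : Fin 7) :
    Tendsto (fun n => jet k (polyEval t (picardIter b u n i))) atTop
      (𝓝 (PolyCompl.jetL k l (complSol b k l (param k l (t, u)) i))) := by
  simp only [← polyEval_one_scale t, ← PolyCompl.jetL_ofPoly (l := l)]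
  refine ((PolyCompl.jetL k l).continuous.tendsto _).comp ?_
  rw [tendsto_iff_norm_sub_tendsto_zero]
  exact squeeze_zero (fun _ => norm_nonneg _) (fun n => (norm_le_pi_norm _ i).trans
    (norm_ofPoly_sub_complSol_le ht hu hu' n)) tendsto_pow_tenth

end Compl

/-- Each jet converges in the completion with its own weight; completeness of `C^∞(S¹)` assembles
the limits. Thus the `limUnder` in `sol` is a true limit on the whole domain. -/
theorem tendsto_picardIter {b : ℝ} {p : ℝ × SmoothCircle} (hp : p ∈ domain b) (i : Fin 7) :
    Tendsto (fun n => polyEval p.1 (picardIter b p.2 n i)) atTop (𝓝 (sol b p i)) := by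
  choose l hl hl' using exists_ckNorm_lt hp.2.1 hp.2.2
  obtain ⟨y, hy, -⟩ := exists_tendsto fun k => tendsto_jet_picardIter hp.1 (hl k) (hl' k) i
  rw [sol, hy.limUnder_eq]
  exact hy

theorem mem_domain_of_ckNorm {b : ℝ} {k : ℕ} {l : {l : ℝ // 0 < l}} {t : ℝ} {u : SmoothCircle}
    (ht : |t| < lifespan b) (hu : ckNorm l k u < 1) (hu' : ckNorm l k (SmoothCircle.deriv u) < 1) :
    (t, u) ∈ domain b :=
  ⟨ht, (norm_jet_zero_le_ckNorm l.2.le k u).trans_lt hu,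
    (norm_jet_zero_le_ckNorm l.2.le k _).trans_lt hu'⟩

section Compl

variable {b : ℝ} {k : ℕ} {l : {l : ℝ // 0 < l}} {t : ℝ} {u : SmoothCircle}

/-- This ties one smooth function to all the Banach fixed points: for each `k`, its `k`-th jet is
read off the fixed point by a continuous linear map. -/
theorem jet_sol (ht : |t| < lifespan b) (hu : ckNorm l k u < 1)
    (hu' : ckNorm l k (SmoothCircle.deriv u) < 1)
    (i : Fin 7) :
    jet k (sol b (t, u) i) = PolyCompl.jetL k l (complSol b k l (param k l (t, u)) i) :=
  tendsto_nhds_unique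
    (tendsto_nhds_iff.1 (tendsto_picardIter (mem_domain_of_ckNorm ht hu hu') i) k)
    (tendsto_jet_picardIter ht hu hu' i)

theorem ofSmooth_sol (ht : |t| < lifespan b) (hu : ckNorm l k u < 1)
    (hu' : ckNorm l k (SmoothCircle.deriv u) < 1) (i : Fin 7) :
    PolyCompl.ofSmooth k l (sol b (t, u) i)
      = PolyCompl.evalL k l (complSol b k l (param k l (t, u)) i) := by
  refine tendsto_nhds_unique (((PolyCompl.continuous_ofSmooth k l).tendsto _).comp
    (tendsto_picardIter (mem_domain_of_ckNorm ht hu hu') i)) ?_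
  rw [tendsto_iff_norm_sub_tendsto_zero]
  exact squeeze_zero (fun _ => norm_nonneg _) (fun n => norm_ofSmooth_sub_evalL_le ht hu hu' n i)
    tendsto_pow_tenth

theorem norm_ofSmooth_sub_sol_le (ht : |t| < lifespan b) (hu : ckNorm l k u < 1)
    (hu' : ckNorm l k (SmoothCircle.deriv u) < 1) (n : ℕ) :
    ‖(fun i => PolyCompl.ofSmooth k l (polyEval t (picardIter b u n i)))
      - fun i => PolyCompl.ofSmooth k l (sol b (t, u) i)‖ ≤ (1 / 10) ^ n := by
  refine (pi_norm_le_iff_of_nonneg (by positivity)).2 fun i => ?_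
  rw [Pi.sub_apply, ofSmooth_sol ht hu hu']
  exact norm_ofSmooth_sub_evalL_le ht hu hu' n i

theorem norm_ofSmooth_sol_sub_init_le (ht : |t| < lifespan b) (hu : ckNorm l k u < 1)
    (hu' : ckNorm l k (SmoothCircle.deriv u) < 1) :
    ‖(fun i => PolyCompl.ofSmooth k l (sol b (t, u) i))
      - fun i => PolyCompl.ofSmooth k l (init u (SmoothCircle.deriv u) i)‖ ≤ 1 / 10 := by
  have h := (complSol_spec b k l (param k l (t, u)) ht ((PolyCompl.norm_ofSmooth k l u).trans_lt hu)
    ((PolyCompl.norm_ofSmooth k l _).trans_lt hu')).2.1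
  refine (pi_norm_le_iff_of_nonneg (by positivity)).2 fun i => ?_
  have e : PolyCompl.ofSmooth k l (init u (SmoothCircle.deriv u) i)
      = PolyCompl.evalL k l (init (param k l (t, u)).2.1 (param k l (t, u)).2.2 i) := by
    have e1 : init (param k l (t, u)).2.1 (param k l (t, u)).2.2 i
      = PolyCompl.ofSmooth k l (init u (SmoothCircle.deriv u) i) :=
        (congrFun (map_init (PolyCompl.ofSmooth k l) u (SmoothCircle.deriv u)) i).symm
    rw [e1]
    change _ = PolyCompl.evalL k l (PolyCompl.ofPoly k l (polyConst _))
    rw [PolyCompl.evalL_ofPoly, polyEval_const]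
  rw [Pi.sub_apply, ofSmooth_sol ht hu hu', e, ← map_sub]
  exact (PolyCompl.norm_evalL_le _).trans ((norm_le_pi_norm (complSol b k l (param k l (t, u))
    - init (param k l (t, u)).2.1 (param k l (t, u)).2.2) i).trans h)

/-- Termwise differentiation: the time derivative of iterate `n + 1` is the field at iterate `n`,
and these converge uniformly in time because the field is Lipschitz on the ball of radius `2`. -/
theorem hasDerivAt_ofSmooth_sol (ht : |t| < lifespan b) (hu : ckNorm l k u < 1)
    (hu' : ckNorm l k (SmoothCircle.deriv u) < 1) :
    HasDerivAt (fun s => fun i => PolyCompl.ofSmooth k l (sol b (s, u) i))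
      (complField b k l fun i => PolyCompl.ofSmooth k l (sol b (t, u) i)) t := by
  have hmem : ∀ s, s ∈ Ioo (-lifespan b) (lifespan b) → |s| < lifespan b := fun s hs =>
    abs_lt.2 hs
  refine hasDerivAt_of_tendstoUniformlyOn (l := atTop) (s := Ioo (-lifespan b) (lifespan b))
    (f := fun n s => fun i => PolyCompl.ofSmooth k l (polyEval s (picardIter b u (n + 1) i)))
    (f' := fun n s => complField b k l
      fun i => PolyCompl.ofSmooth k l (polyEval s (picardIter b u n i)))
    (g' := fun s => complField b k l fun i => PolyCompl.ofSmooth k l (sol b (s, u) i))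
    isOpen_Ioo ?_ ?_ ?_ (abs_lt.1 ht)
  · have hM := fieldBound_pos b
    have hF := boundedLip_field b (PolyCompl.norm_resolventL_le (k := k) (l := l) 1)
      (PolyCompl.norm_resolventL_le (-1))
    rw [Metric.tendstoUniformlyOn_iff]
    intro ε hε
    have hlim := tendsto_pow_tenth.const_mul (fieldBound b)
    rw [mul_zero] at hlim
    -- The available estimates put iterate `n` in the ball of radius `2` only from `n = 1` on, where
    -- they give `1/10 + 1/10 + 1`; for `n = 0` they would give `1 + 1/10 + 1`.
    filter_upwards [hlim.eventually_lt_const hε, eventually_ge_atTop 1] with n hn hn1 s hs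
    have h1 := norm_ofSmooth_sub_sol_le (hmem s hs) hu hu' n
    have h2 := norm_ofSmooth_sol_sub_init_le (hmem s hs) hu hu'
    have h3 : ‖fun i => PolyCompl.ofSmooth k l (init u (SmoothCircle.deriv u) i)‖ ≤ 1 := by
      rw [map_init]
      exact norm_init_le ((PolyCompl.norm_ofSmooth k l u).trans_le hu.le)
        ((PolyCompl.norm_ofSmooth k l _).trans_le hu'.le)
    have h4 : (1 / 10 : ℝ) ^ n ≤ 1 / 10 := by
      calc (1 / 10 : ℝ) ^ n ≤ (1 / 10) ^ 1 :=
            pow_le_pow_of_le_one (by norm_num) (by norm_num) hn1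
        _ = 1 / 10 := pow_one _
    have h5 := norm_add_le ((fun i => PolyCompl.ofSmooth k l (sol b (s, u) i))
      - fun i => PolyCompl.ofSmooth k l (init u (SmoothCircle.deriv u) i))
      (fun i => PolyCompl.ofSmooth k l (init u (SmoothCircle.deriv u) i))
    rw [sub_add_cancel] at h5
    have h6 := norm_add_le ((fun i => PolyCompl.ofSmooth k l (polyEval s (picardIter b u n i)))
      - fun i => PolyCompl.ofSmooth k l (sol b (s, u) i))
      (fun i => PolyCompl.ofSmooth k l (sol b (s, u) i))
    rw [sub_add_cancel] at h6
    rw [dist_comm, dist_eq_norm]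
    refine ((hF.2 _ _ (by linarith) (by linarith)).trans ?_).trans_lt hn
    exact mul_le_mul_of_nonneg_left h1 hM.le
  · refine Eventually.of_forall fun n s _ => hasDerivAt_pi.2 fun i => ?_
    have e1 : complField b k l (fun i => PolyCompl.ofSmooth k l (polyEval s (picardIter b u n i)))
        = fun i => PolyCompl.ofSmooth k l (polyEval s (field b (polyResolvent 1)
          (polyResolvent (-1)) (picardIter b u n) i)) := by
      rw [complField_ofSmooth, smoothField, map_field b (polyEval s) (polyEval_resolvent s 1)
        (polyEval_resolvent s (-1))]
    rw [e1]
    have e2 : ∀ s, PolyCompl.ofSmooth k l (polyEval s (picardIter b u (n + 1) i))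
        = PolyCompl.ofSmooth k l (polyEval s (init (polyConst u) (polyConst (SmoothCircle.deriv u)) i))
        + (PolyCompl.ofSmooth k l).toLinearMap (polyEval s (polyIntegral (field b (polyResolvent 1)
          (polyResolvent (-1)) (picardIter b u n) i))) := by
      intro s
      rw [picardIter, Function.iterate_succ_apply', picard, one_smul, map_add, map_add]
      rfl
    have e3 : ∀ s, polyEval s (init (polyConst u) (polyConst (SmoothCircle.deriv u)) i)
        = init u (SmoothCircle.deriv u) i := by
      intro s
      have := congrFun (map_init (polyEval s) (polyConst u) (polyConst (SmoothCircle.deriv u))) i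
      simpa only [polyEval_const] using this
    simp only [e2, e3]
    exact (hasDerivAt_polyEval_integral (PolyCompl.ofSmooth k l).toLinearMap _ s).const_add _
  · intro s hs
    have h := tendsto_pow_tenth.comp (tendsto_add_atTop_nat 1)
    rw [tendsto_iff_norm_sub_tendsto_zero]
    exact squeeze_zero (fun _ => norm_nonneg _)
      (fun n => norm_ofSmooth_sub_sol_le (hmem s hs) hu hu' (n + 1)) h

end Compl

/-- The limit of the Picard iterates solves the geodesic equation. -/
theorem hasDirDeriv_sol {b t : ℝ} {u : SmoothCircle} (h : (t, u) ∈ domain b) (i : Fin 7) :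
    HasDirDeriv (fun s => sol b (s, u) i) t 1 (smoothField b (sol b (t, u)) i) := by
  rw [hasDirDeriv_iff]
  intro k
  obtain ⟨l, hu, hu'⟩ := exists_ckNorm_lt h.2.1 h.2.2 k
  have h1 := hasDerivAt_pi.1 (hasDerivAt_ofSmooth_sol h.1 hu hu') i
  rw [complField_ofSmooth] at h1
  have h2 := (PolyCompl.jetL k l).hasFDerivAt.comp_hasDerivAt t h1
  simpa only [Function.comp_def, PolyCompl.jetL_ofSmooth] using h2

theorem norm_sol_sub_init_le {b : ℝ} {p : ℝ × SmoothCircle} (h : p ∈ domain b) (i : Fin 7) :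
    ‖jet 0 (sol b p i - init p.2 (SmoothCircle.deriv p.2) i)‖ ≤ 1 / 10 := by
  obtain ⟨l, hu, hu'⟩ := exists_ckNorm_lt h.2.1 h.2.2 0
  have h1 := (norm_le_pi_norm _ i).trans (norm_ofSmooth_sol_sub_init_le h.1 hu hu')
  rw [Pi.sub_apply, ← map_sub, PolyCompl.norm_ofSmooth] at h1
  exact h1

theorem sol_zero {b : ℝ} {u : SmoothCircle} (h : (0, u) ∈ domain b) :
    sol b (0, u) = init u (SmoothCircle.deriv u) := by
  funext i
  have h0 : ∀ p, polyEval 0 (polyIntegral p) = 0 := by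
    intro p
    induction p using Polynomial.induction_on' with
    | add p q hp hq => simp only [map_add, hp, hq, add_zero]
    | monomial i a => rw [polyIntegral_monomial, polyEval_monomial, pow_succ, mul_zero, zero_smul]
  have hi : polyEval 0 (init (polyConst u) (polyConst (SmoothCircle.deriv u)) i)
      = init u (SmoothCircle.deriv u) i := by
    have := congrFun (map_init (polyEval 0) (polyConst u) (polyConst (SmoothCircle.deriv u))) i
    simpa only [polyEval_const] using this
  refine tendsto_nhds_unique (tendsto_picardIter h i) ?_
  refine tendsto_const_nhds.congr fun n => ?_
  cases n with
  | zero => exact hi.symm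
  | succ n =>
    rw [picardIter, Function.iterate_succ_apply', picard, one_smul, map_add, h0, add_zero, hi]

/-- Near a given point a single weight serves order `k`, because the unit ball conditions are open;
there the jet is a smooth Banach map composed with the continuous linear map `param`. -/
theorem frechetSmoothOn_sol (b : ℝ) (i : Fin 7) :
    FrechetSmoothOn (fun p => sol b p i) (domain b) := by
  refine frechetSmoothOn_of_jet (isOpen_domain b) fun p hp k => ?_
  obtain ⟨l, hu, hu'⟩ := exists_ckNorm_lt hp.2.1 hp.2.2 k
  set V : Set (ℝ × PolyCompl k l × PolyCompl k l) :=
    {q | |q.1| < lifespan b ∧ ‖q.2.1‖ < 1 ∧ ‖q.2.2‖ < 1} with hV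
  have hVo : IsOpen V := by
    have o1 : IsOpen {q : ℝ × PolyCompl k l × PolyCompl k l | |q.1| < lifespan b} :=
      isOpen_lt (by fun_prop) continuous_const
    have o2 : IsOpen {q : ℝ × PolyCompl k l × PolyCompl k l | ‖q.2.1‖ < 1} :=
      isOpen_lt (by fun_prop) continuous_const
    have o3 : IsOpen {q : ℝ × PolyCompl k l × PolyCompl k l | ‖q.2.2‖ < 1} :=
      isOpen_lt (by fun_prop) continuous_const
    exact o1.and (o2.and o3)
  have hmem : ∀ q : ℝ × SmoothCircle, param k l q ∈ V ↔
      |q.1| < lifespan b ∧ ckNorm l k q.2 < 1 ∧ ckNorm l k (SmoothCircle.deriv q.2) < 1 := by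
    intro q
    rw [← PolyCompl.norm_ofSmooth, ← PolyCompl.norm_ofSmooth]; rfl
  refine ⟨param k l ⁻¹' V, hVo.preimage (param k l).continuous, (hmem p).2 ⟨hp.1, hu, hu'⟩, ?_⟩
  refine (frechetSmoothOn_of_contDiffAt (V := V)
    (F := fun q => PolyCompl.jetL k l (complSol b k l q i)) (fun q hq => ?_) (param k l)).congr ?_
  · have h1 := contDiffAt_pi.1 (complSol_spec b k l q hq.1 hq.2.1 hq.2.2).1 i
    exact (PolyCompl.jetL k l).contDiff.contDiffAt.comp q h1
  · intro q hq
    obtain ⟨h1, h2, h3⟩ := (hmem q).1 hq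
    exact (jet_sol h1 h2 h3 i).symm

end BEquation

/-- A function on a symmetric interval which vanishes at `0` and satisfies a linear differential
inequality is zero. -/
theorem eq_zero_of_norm_deriv_le {E : Type*} [NormedAddCommGroup E] [NormedSpace ℝ E] {r K : ℝ}
    {g g' : ℝ → E} (hg : ∀ t ∈ Ioo (-r) r, HasDerivAt g (g' t) t)
    (hK : ∀ t ∈ Ioo (-r) r, ‖g' t‖ ≤ K * ‖g t‖) (h0 : g 0 = 0) :
    ∀ t ∈ Ioo (-r) r, g t = 0 := by
  have key : ∀ g g' : ℝ → E, (∀ t ∈ Ioo (-r) r, HasDerivAt g (g' t) t) →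
      (∀ t ∈ Ioo (-r) r, ‖g' t‖ ≤ K * ‖g t‖) → g 0 = 0 →
      ∀ t ∈ Ioo (-r) r, 0 ≤ t → g t = 0 := by
    intro g g' hg hK h0 t ht ht0
    have hsub : Icc 0 t ⊆ Ioo (-r) r := fun s hs =>
      ⟨by linarith [hs.1, hs.2, ht.1, ht.2], hs.2.trans_lt ht.2⟩
    exact eq_zero_of_abs_deriv_le_mul_abs_self_of_eq_zero_right
      (fun s hs => (hg s (hsub hs)).continuousAt.continuousWithinAt)
      (fun s hs => (hg s (hsub (Ico_subset_Icc_self hs))).hasDerivWithinAt) h0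
      (fun s hs => hK s (hsub (Ico_subset_Icc_self hs))) t ⟨ht0, le_rfl⟩
  intro t ht
  rcases le_total 0 t with h | h
  · exact key g g' hg hK h0 t ht h
  · have hneg : ∀ s ∈ Ioo (-r) r, -s ∈ Ioo (-r) r := fun s hs =>
      ⟨by linarith [hs.2], by linarith [hs.1]⟩
    have := key (fun s => g (-s)) (fun s => -g' (-s))
      (fun s hs => by
        have h1 := (hg (-s) (hneg s hs)).scomp s (hasDerivAt_neg s)
        simpa [Function.comp_def] using h1)
      (fun s hs => by rw [norm_neg]; exact hK (-s) (hneg s hs)) (by simpa using h0) (-t)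
      (hneg t ht) (by linarith)
    simpa using this

/-! ### Derivatives in time and in space at a point of the circle -/

namespace SmoothCircle

theorem hasDirDeriv_deriv {c : ℝ → SmoothCircle} {t : ℝ} {d : SmoothCircle}
    (h : HasDirDeriv c t 1 d) : HasDirDeriv (fun s => deriv (c s)) t 1 (deriv d) := by
  rw [hasDirDeriv_iff] at h ⊢
  exact fun k => h (k + 1)

theorem hasDerivAt_apply {c : ℝ → SmoothCircle} {t : ℝ} {d : SmoothCircle}
    (h : HasDirDeriv c t 1 d) (y : UnitAddCircle) : HasDerivAt (fun s => c s y) (d y) t :=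
  (ContinuousMap.evalCLM ℝ y : C(UnitAddCircle, ℝ) →L[ℝ] ℝ).hasFDerivAt.comp_hasDerivAt t
    (hasDirDeriv_iff.1 h 0)

theorem hasDerivAt_deriv_apply {c : ℝ → SmoothCircle} {t : ℝ} {d : SmoothCircle}
    (h : HasDirDeriv c t 1 d) (y : UnitAddCircle) :
    HasDerivAt (fun s => deriv (c s) y) (deriv d y) t :=
  hasDerivAt_apply (hasDirDeriv_deriv h) y

theorem ext_apply {u v : SmoothCircle} (h : ∀ y, u y = v y) : u = v :=
  ext_real fun x => h x

theorem abs_apply_le (u : SmoothCircle) (y : UnitAddCircle) : |u y| ≤ ‖jet 0 u‖ :=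
  (jet 0 u).norm_coe_le_norm y

theorem deriv_resolvent_one (f : SmoothCircle) :
    deriv (resolvent 1 f) = resolvent 1 f - f := by
  have h := resolvent_sub 1 f
  rw [Units.val_one, one_smul] at h
  nth_rw 3 [← h]
  abel

theorem deriv_resolvent_neg_one (f : SmoothCircle) :
    deriv (resolvent (-1) f) = f - resolvent (-1) f := by
  have h := resolvent_sub (-1) f
  rw [Units.val_neg, Units.val_one, neg_smul, one_smul] at h
  nth_rw 2 [← h]
  abel

end SmoothCircle

namespace BEquation

open SmoothCircle

/-! ### The spatial derivatives of the force and of the pressure -/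

section Spatial

variable {b : ℝ} {z : Fin 7 → SmoothCircle}

theorem deriv_resPlus (hE : SmoothCircle.deriv (z 2) = SmoothCircle.deriv (z 6) * z 2) :
    SmoothCircle.deriv (resPlus b (SmoothCircle.resolvent 1) z) =
      (1 + SmoothCircle.deriv (z 6)) * resPlus b (SmoothCircle.resolvent 1) z
        - z 2 * z 4 * density b z := by
  rw [resPlus, deriv_mul, hE, deriv_resolvent_one]
  ring

theorem deriv_resMinus (hF : SmoothCircle.deriv (z 3) = -(SmoothCircle.deriv (z 6) * z 3)) :
    SmoothCircle.deriv (resMinus b (SmoothCircle.resolvent (-1)) z) =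
      -((1 + SmoothCircle.deriv (z 6)) * resMinus b (SmoothCircle.resolvent (-1)) z)
        + z 3 * z 5 * density b z := by
  rw [resMinus, deriv_mul, hF, deriv_resolvent_neg_one]
  ring

/-- The compatibility conditions satisfied by the unknowns of the geodesic equation, up to the one
which involves `v`. -/
structure IsCompatible (z : Fin 7 → SmoothCircle) : Prop where
  deriv_two : SmoothCircle.deriv (z 2) = SmoothCircle.deriv (z 6) * z 2
  deriv_three : SmoothCircle.deriv (z 3) = -(SmoothCircle.deriv (z 6) * z 3)
  two_mul_four : z 2 * z 4 = 1 + SmoothCircle.deriv (z 6)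
  three_mul_five : z 3 * z 5 = 1 + SmoothCircle.deriv (z 6)
  deriv_zero : SmoothCircle.deriv (z 0) = z 1 * (1 + SmoothCircle.deriv (z 6))

/-- The common product `r` is kept apart from `1 + ξ_x`: their equality is among the conditions to
be proved with this formula. -/
theorem deriv_force (hE : SmoothCircle.deriv (z 2) = SmoothCircle.deriv (z 6) * z 2)
    (hF : SmoothCircle.deriv (z 3) = -(SmoothCircle.deriv (z 6) * z 3))
    {r : SmoothCircle} (h4 : z 2 * z 4 = r) (h5 : z 3 * z 5 = r) :
    SmoothCircle.deriv (force b (SmoothCircle.resolvent 1) (SmoothCircle.resolvent (-1)) z) =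
      (1 + SmoothCircle.deriv (z 6))
        * pressure b (SmoothCircle.resolvent 1) (SmoothCircle.resolvent (-1)) z - r * density b z := by
  rw [force, map_smul, map_sub, deriv_resPlus hE, deriv_resMinus hF, h4, h5, pressure,
    mul_smul_comm]
  have : r * density b z = (1 / 2 : ℝ) • (r * density b z + r * density b z) := by
    rw [← two_smul ℝ, smul_smul]; norm_num
  nth_rw 3 [this]
  rw [← smul_sub]
  congr 1
  ring

theorem deriv_pressure (h : IsCompatible z) :
    SmoothCircle.deriv (pressure b (SmoothCircle.resolvent 1) (SmoothCircle.resolvent (-1)) z) =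
      (1 + SmoothCircle.deriv (z 6))
        * force b (SmoothCircle.resolvent 1) (SmoothCircle.resolvent (-1)) z := by
  rw [pressure, map_smul, map_add, deriv_resPlus h.deriv_two, deriv_resMinus h.deriv_three,
    h.two_mul_four, h.three_mul_five, force, mul_smul_comm]
  congr 1
  ring

end Spatial

/-! ### The conjugated force -/

section Conj

theorem comp_compInv (w : SmoothCircle) (φ : DiffCircle) :
    DiffCircle.comp (DiffCircle.compInv w φ) φ = w :=
  ext_apply fun y => congrArg w (φ.toEquiv.symm_apply_apply y)

theorem compInv_comp (w : SmoothCircle) (φ : DiffCircle) :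
    DiffCircle.compInv (DiffCircle.comp w φ) φ = w :=
  ext_apply fun y => congrArg w (φ.toEquiv.apply_symm_apply y)

theorem deriv_comp {φ : DiffCircle} {ξ : SmoothCircle}
    (hφ : ∀ x : ℝ, φ.toEquiv (x : UnitAddCircle)
      = ((x + ξ (x : UnitAddCircle) : ℝ) : UnitAddCircle))
    (w : SmoothCircle) :
    SmoothCircle.deriv (DiffCircle.comp w φ)
      = DiffCircle.comp (SmoothCircle.deriv w) φ * (1 + SmoothCircle.deriv ξ) := by
  refine eq_deriv_of_hasDerivAt fun x => ?_
  have h1 : HasDerivAt (fun x : ℝ => x + ξ (x : UnitAddCircle))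
      (1 + SmoothCircle.deriv ξ (x : UnitAddCircle)) x := (hasDerivAt_id x).add (ξ.hasDerivAt x)
  have h2 := (w.hasDerivAt (x + ξ (x : UnitAddCircle))).comp x h1
  rw [← hφ x] at h2
  refine h2.congr_of_eventuallyEq (Eventually.of_forall fun x => ?_)
  exact congrArg w (hφ x)

/-- The chain rule for `w = (w ∘ φ⁻¹) ∘ φ`, with the nonvanishing factor `φ_x` cancelled. -/
theorem deriv_compInv {φ : DiffCircle} {ξ : SmoothCircle}
    (hφ : ∀ x : ℝ, φ.toEquiv (x : UnitAddCircle)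
      = ((x + ξ (x : UnitAddCircle) : ℝ) : UnitAddCircle))
    (hpos : ∀ y, (1 + SmoothCircle.deriv ξ) y ≠ 0) {w g : SmoothCircle}
    (hw : SmoothCircle.deriv w = g * (1 + SmoothCircle.deriv ξ)) :
    SmoothCircle.deriv (DiffCircle.compInv w φ) = DiffCircle.compInv g φ := by
  have h1 := deriv_comp hφ (DiffCircle.compInv w φ)
  rw [comp_compInv, hw] at h1
  have h2 : DiffCircle.comp (SmoothCircle.deriv (DiffCircle.compInv w φ)) φ = g :=
    ext_apply fun y => by
      have h3 : (g * (1 + SmoothCircle.deriv ξ)) y = _ := congrArg (fun f : SmoothCircle => f y) h1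
      exact (mul_right_cancel₀ (hpos y) h3).symm
  rw [← h2, compInv_comp]

/-- Put `m = M ∘ φ⁻¹`, `n = N ∘ φ⁻¹` and let `f` be the density of `u`. The spatial derivative
formulas say `m' = n - f` and `n' = m`, hence `A m = m - m'' = f'`. Expanding `f'` gives the
expression under `A⁻¹` in `P(u)`, so `m = P(u)`. -/
theorem opPConj_eq_force {b : ℝ} {z : Fin 7 → SmoothCircle} (hz : IsCompatible z) {φ : DiffCircle}
    (hφ : ∀ x : ℝ, φ.toEquiv (x : UnitAddCircle)
      = ((x + z 6 (x : UnitAddCircle) : ℝ) : UnitAddCircle))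
    (hpos : ∀ y, (1 + SmoothCircle.deriv (z 6)) y ≠ 0) :
    DiffCircle.opPConj b φ (z 0) =
      force b (SmoothCircle.resolvent 1) (SmoothCircle.resolvent (-1)) z := by
  set M := force b (SmoothCircle.resolvent 1) (SmoothCircle.resolvent (-1)) z with hM
  set N := pressure b (SmoothCircle.resolvent 1) (SmoothCircle.resolvent (-1)) z with hN
  set u := DiffCircle.compInv (z 0) φ with hu
  have hu' : SmoothCircle.deriv u = DiffCircle.compInv (z 1) φ :=
    deriv_compInv hφ hpos hz.deriv_zero
  have hm' : SmoothCircle.deriv (DiffCircle.compInv M φ)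
      = DiffCircle.compInv (N - density b z) φ := by
    refine deriv_compInv hφ hpos ?_
    rw [hM, deriv_force hz.deriv_two hz.deriv_three hz.two_mul_four hz.three_mul_five]
    ring
  have hn' : SmoothCircle.deriv (DiffCircle.compInv N φ) = DiffCircle.compInv M φ := by
    refine deriv_compInv hφ hpos ?_
    rw [hN, deriv_pressure hz]
    ring
  have hf : DiffCircle.compInv (density b z) φ
      = (b / 2) • (u * u) + ((3 - b) / 2) • (SmoothCircle.deriv u * SmoothCircle.deriv u) := by
    rw [hu', hu]; rfl
  have hsub : DiffCircle.compInv (N - density b z) φ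
      = DiffCircle.compInv N φ - DiffCircle.compInv (density b z) φ := rfl
  have hA : opA (DiffCircle.compInv M φ)
      = (3 : ℝ) • (SmoothCircle.deriv u * SmoothCircle.deriv (SmoothCircle.deriv u))
        + b • (opA u * SmoothCircle.deriv u) := by
    change DiffCircle.compInv M φ - SmoothCircle.deriv (SmoothCircle.deriv (DiffCircle.compInv M φ))
      = _ + b • ((u - SmoothCircle.deriv (SmoothCircle.deriv u)) * SmoothCircle.deriv u)
    rw [hm', hsub, map_sub, hn', hf]
    simp only [map_add, map_smul, deriv_mul]
    refine ext_apply fun y => ?_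
    simp only [coe_add, coe_sub, coe_mul, coe_smul]
    ring
  have hP : opP b u = DiffCircle.compInv M φ := by
    rw [opP, ← hA]
    exact opAEquiv.symm_apply_apply _
  rw [DiffCircle.opPConj, ← hu, hP, comp_compInv]

end Conj

/-! ### The compatibility conditions hold along the solutions -/

section Compat

theorem norm_sol_le {b : ℝ} {p : ℝ × SmoothCircle} (h : p ∈ domain b) (i : Fin 7) :
    ‖jet 0 (sol b p i)‖ ≤ 2 := by
  have h1 := norm_sol_sub_init_le h i
  have h2 : ‖jet 0 (init p.2 (SmoothCircle.deriv p.2) i)‖ ≤ 1 := by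
    have hp1 := h.2.1.le
    have hp2 := h.2.2.le
    have hone : ‖jet 0 (1 : SmoothCircle)‖ = 1 := norm_one (α := C(UnitAddCircle, ℝ))
    fin_cases i <;> simp [init, hp1, hp2, hone]
  have h3 := norm_add_le (jet 0 (sol b p i - init p.2 (SmoothCircle.deriv p.2) i))
    (jet 0 (init p.2 (SmoothCircle.deriv p.2) i))
  rw [← map_add, sub_add_cancel] at h3
  linarith

/-- At order `k = 0` the norm is the sup norm whatever the weight, so the abstract bound applies; `l
= 1` is an arbitrary choice. -/
theorem norm_pressure_sol_le {b : ℝ} {p : ℝ × SmoothCircle} (h : p ∈ domain b) :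
    ‖jet 0 (pressure b (SmoothCircle.resolvent 1) (SmoothCircle.resolvent (-1)) (sol b p))‖
      ≤ 64 * (|b| + |3 - b|) := by
  set l : {l : ℝ // 0 < l} := ⟨1, one_pos⟩
  have hJ : ∀ a, ‖PolyCompl.ofSmooth 0 l a‖ = ‖jet 0 a‖ := PolyCompl.norm_ofSmooth 0 l
  rw [← hJ, ← map_pressure b (PolyCompl.ofSmooth 0 l) (PolyCompl.resolventL_ofSmooth _)
    (PolyCompl.resolventL_ofSmooth _)]
  refine (boundedLip_pressure b (PolyCompl.norm_resolventL_le 1)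
    (PolyCompl.norm_resolventL_le (-1))).1 _ ?_
  refine (pi_norm_le_iff_of_nonneg zero_le_two).2 fun i => ?_
  rw [hJ]
  exact norm_sol_le h i

theorem mem_domain {b : ℝ} {u : SmoothCircle} (hu : ‖jet 0 u‖ < 1)
    (hu' : ‖jet 0 (SmoothCircle.deriv u)‖ < 1) {t : ℝ}
    (ht : t ∈ Ioo (-lifespan b) (lifespan b)) : (t, u) ∈ domain b :=
  ⟨abs_lt.2 ht, hu, hu'⟩

theorem sol_zero_apply {b : ℝ} {u : SmoothCircle} (hu : ‖jet 0 u‖ < 1)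
    (hu' : ‖jet 0 (SmoothCircle.deriv u)‖ < 1) (i : Fin 7) :
    sol b (0, u) i = init u (SmoothCircle.deriv u) i := by
  rw [sol_zero ⟨by simpa using lifespan_pos b, hu, hu'⟩]

/-- A linear differential equation in time, pointwise on the circle. -/
theorem eq_of_linear {r : ℝ} {g c h : ℝ → UnitAddCircle → ℝ} {K : ℝ}
    (hg : ∀ t ∈ Ioo (-r) r, ∀ y, HasDerivAt (fun s => g s y - h s y) (c t y * (g t y - h t y)) t)
    (hc : ∀ t ∈ Ioo (-r) r, ∀ y, |c t y| ≤ K) (h0 : ∀ y, g 0 y = h 0 y) :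
    ∀ t ∈ Ioo (-r) r, ∀ y, g t y = h t y := by
  intro t ht y
  rw [← sub_eq_zero]
  refine eq_zero_of_norm_deriv_le (g := fun s => g s y - h s y) (K := K) (fun t ht => hg t ht y)
    (fun t ht => ?_) (sub_eq_zero.2 (h0 y)) t ht
  rw [norm_mul]
  exact mul_le_mul_of_nonneg_right (hc t ht y) (norm_nonneg _)

/-- The defect `∂_x z₂ - (∂_x z₆) z₂` satisfies `d_t = z₀ d` and vanishes at time `0`. The companion
identity for `z₃` has the coefficient `-z₀`. -/
theorem deriv_sol_two {b : ℝ} {u : SmoothCircle} (hu : ‖jet 0 u‖ < 1)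
    (hu' : ‖jet 0 (SmoothCircle.deriv u)‖ < 1) {t : ℝ}
    (ht : t ∈ Ioo (-lifespan b) (lifespan b)) :
    SmoothCircle.deriv (sol b (t, u) 2) = SmoothCircle.deriv (sol b (t, u) 6) * sol b (t, u) 2 := by
  refine ext_apply (eq_of_linear (r := lifespan b)
    (g := fun s y => SmoothCircle.deriv (sol b (s, u) 2) y)
    (h := fun s y => (SmoothCircle.deriv (sol b (s, u) 6) * sol b (s, u) 2) y)
    (c := fun s y => sol b (s, u) 0 y) (K := 2) (fun t ht y => ?_) (fun t ht y => ?_)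
    (fun y => ?_) t ht)
  · have h1 := hasDirDeriv_sol (mem_domain hu hu' ht) 2
    have h2 := hasDerivAt_apply h1 y
    have h2' := hasDerivAt_deriv_apply h1 y
    have h6' := hasDerivAt_deriv_apply (hasDirDeriv_sol (mem_domain hu hu' ht) 6) y
    refine (h2'.fun_sub (h6'.fun_mul h2)).congr_deriv ?_
    simp only [field, Matrix.cons_val, coe_mul, coe_add, deriv_mul]
    ring
  · exact (abs_apply_le _ y).trans (norm_sol_le (mem_domain hu hu' ht) 0)
  · simp [sol_zero_apply hu hu', init, deriv_one]

theorem deriv_sol_three {b : ℝ} {u : SmoothCircle} (hu : ‖jet 0 u‖ < 1)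
    (hu' : ‖jet 0 (SmoothCircle.deriv u)‖ < 1) {t : ℝ}
    (ht : t ∈ Ioo (-lifespan b) (lifespan b)) :
    SmoothCircle.deriv (sol b (t, u) 3)
      = -(SmoothCircle.deriv (sol b (t, u) 6) * sol b (t, u) 3) := by
  refine ext_apply (eq_of_linear (r := lifespan b)
    (g := fun s y => SmoothCircle.deriv (sol b (s, u) 3) y)
    (h := fun s y => (-(SmoothCircle.deriv (sol b (s, u) 6) * sol b (s, u) 3)) y)
    (c := fun s y => -sol b (s, u) 0 y) (K := 2) (fun t ht y => ?_) (fun t ht y => ?_)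
    (fun y => ?_) t ht)
  · have h1 := hasDirDeriv_sol (mem_domain hu hu' ht) 3
    have h3 := hasDerivAt_apply h1 y
    have h3' := hasDerivAt_deriv_apply h1 y
    have h6' := hasDerivAt_deriv_apply (hasDirDeriv_sol (mem_domain hu hu' ht) 6) y
    refine (h3'.fun_sub (h6'.fun_mul h3).fun_neg).congr_deriv ?_
    simp only [field, Matrix.cons_val, coe_mul, coe_add, coe_neg, deriv_mul, map_neg]
    ring
  · rw [abs_neg]
    exact (abs_apply_le _ y).trans (norm_sol_le (mem_domain hu hu' ht) 0)
  · simp [sol_zero_apply hu hu', init, deriv_one]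

/-- Both products satisfy `q_t = z₁ q` and start at `1`: the terms in `z₀` cancel in each. -/
theorem sol_two_mul_four {b : ℝ} {u : SmoothCircle} (hu : ‖jet 0 u‖ < 1)
    (hu' : ‖jet 0 (SmoothCircle.deriv u)‖ < 1) {t : ℝ}
    (ht : t ∈ Ioo (-lifespan b) (lifespan b)) :
    sol b (t, u) 2 * sol b (t, u) 4 = sol b (t, u) 3 * sol b (t, u) 5 := by
  refine ext_apply (eq_of_linear (r := lifespan b)
    (g := fun s y => (sol b (s, u) 2 * sol b (s, u) 4) y)
    (h := fun s y => (sol b (s, u) 3 * sol b (s, u) 5) y)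
    (c := fun s y => sol b (s, u) 1 y) (K := 2) (fun t ht y => ?_) (fun t ht y => ?_)
    (fun y => ?_) t ht)
  · have h := fun i => hasDerivAt_apply (hasDirDeriv_sol (mem_domain hu hu' ht) i) y
    refine (((h 2).fun_mul (h 4)).fun_sub ((h 3).fun_mul (h 5))).congr_deriv ?_
    simp only [field, Matrix.cons_val, coe_mul, coe_add, coe_sub, coe_neg]
    ring
  · exact (abs_apply_le _ y).trans (norm_sol_le (mem_domain hu hu' ht) 1)
  · simp [sol_zero_apply hu hu', init]

/-- The solution satisfies the compatibility conditions. -/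
theorem isCompatible_sol {b : ℝ} {u : SmoothCircle} (hu : ‖jet 0 u‖ < 1)
    (hu' : ‖jet 0 (SmoothCircle.deriv u)‖ < 1) {t : ℝ}
    (ht : t ∈ Ioo (-lifespan b) (lifespan b)) : IsCompatible (sol b (t, u)) := by
  -- Neither remaining defect closes up alone. With `d₁ = 1 + ∂_x z₆ - z₂ z₄` and `d₂ = ∂_x z₀ - z₁
  -- z₂ z₄` one has `d₁' = d₂` and `d₂' = -p d₁`, where `p` is the pressure: a linear system with
  -- bounded coefficients.
  have key : ∀ y, ∀ t ∈ Ioo (-lifespan b) (lifespan b),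
      ((1 + SmoothCircle.deriv (sol b (t, u) 6)) y - (sol b (t, u) 2 * sol b (t, u) 4) y,
        SmoothCircle.deriv (sol b (t, u) 0) y
          - (sol b (t, u) 1 * (sol b (t, u) 2 * sol b (t, u) 4)) y) = (0 : ℝ × ℝ) := by
    intro y
    refine eq_zero_of_norm_deriv_le (K := 1 + 64 * (|b| + |3 - b|))
      (g' := fun t => (SmoothCircle.deriv (sol b (t, u) 0) y
          - (sol b (t, u) 1 * (sol b (t, u) 2 * sol b (t, u) 4)) y,
        -(pressure b (SmoothCircle.resolvent 1) (SmoothCircle.resolvent (-1)) (sol b (t, u)) y)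
          * ((1 + SmoothCircle.deriv (sol b (t, u) 6)) y - (sol b (t, u) 2 * sol b (t, u) 4) y)))
      (fun t ht => ?_) (fun t ht => ?_) ?_
    · have h := fun i => hasDerivAt_apply (hasDirDeriv_sol (mem_domain hu hu' ht) i) y
      have h' := fun i => hasDerivAt_deriv_apply (hasDirDeriv_sol (mem_domain hu hu' ht) i) y
      refine HasDerivAt.prodMk ?_ ?_
      · refine ((((h' 6).const_add 1)).fun_sub ((h 2).fun_mul (h 4))).congr_deriv ?_
        simp only [field, Matrix.cons_val, coe_mul, coe_sub]
        ring
      · refine ((h' 0).fun_sub ((h 1).fun_mul ((h 2).fun_mul (h 4)))).congr_deriv ?_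
        have hfo := deriv_force (b := b) (deriv_sol_two hu hu' ht) (deriv_sol_three hu hu' ht) rfl
          (sol_two_mul_four hu hu' ht).symm
        simp only [field, Matrix.cons_val, map_neg, hfo, coe_mul, coe_add, coe_sub, coe_neg]
        ring
    · set d : ℝ × ℝ := ((1 + SmoothCircle.deriv (sol b (t, u) 6)) y
          - (sol b (t, u) 2 * sol b (t, u) 4) y, SmoothCircle.deriv (sol b (t, u) 0) y
          - (sol b (t, u) 1 * (sol b (t, u) 2 * sol b (t, u) 4)) y) with hd
      have hp := (abs_apply_le _ y).trans (norm_pressure_sol_le (mem_domain hu hu' ht))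
      have hB : 0 ≤ |b| + |3 - b| := by positivity
      have h1 : |d.1| ≤ ‖d‖ := norm_fst_le d
      have h2 : |d.2| ≤ ‖d‖ := norm_snd_le d
      change ‖(d.2, -(pressure b (SmoothCircle.resolvent 1) (SmoothCircle.resolvent (-1))
        (sol b (t, u)) y) * d.1)‖ ≤ _
      rw [Prod.norm_def]
      refine max_le ?_ ?_
      · refine h2.trans ?_
        nlinarith [norm_nonneg d, mul_nonneg hB (norm_nonneg d)]
      · rw [norm_mul, norm_neg]
        refine (mul_le_mul hp h1 (abs_nonneg _) (by positivity)).trans ?_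
        nlinarith [norm_nonneg d]
    · simp [sol_zero_apply hu hu', init, coe_one]
  have h4 : sol b (t, u) 2 * sol b (t, u) 4 = 1 + SmoothCircle.deriv (sol b (t, u) 6) :=
    ext_apply fun y => (sub_eq_zero.1 (Prod.ext_iff.1 (key y t ht)).1).symm
  refine ⟨deriv_sol_two hu hu' ht, deriv_sol_three hu hu' ht, h4, ?_, ?_⟩
  · rw [← sol_two_mul_four hu hu' ht, h4]
  · rw [← h4]
    exact ext_apply fun y => sub_eq_zero.1 (Prod.ext_iff.1 (key y t ht)).2

/-- By compatibility `φ_x` is the product `z₂ z₄` of two factors within `1/10` of `1`. Positivity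
thus costs no further restriction on time. -/
theorem one_add_deriv_sol_pos {b : ℝ} {u : SmoothCircle} (hu : ‖jet 0 u‖ < 1)
    (hu' : ‖jet 0 (SmoothCircle.deriv u)‖ < 1) {t : ℝ}
    (ht : t ∈ Ioo (-lifespan b) (lifespan b)) (y : UnitAddCircle) :
    0 < (1 + SmoothCircle.deriv (sol b (t, u) 6)) y := by
  rw [← (isCompatible_sol hu hu' ht).two_mul_four, coe_mul]
  have h := fun i => (abs_apply_le _ y).trans (norm_sol_sub_init_le (mem_domain hu hu' ht) i)
  have h2 : |sol b (t, u) 2 y - 1| ≤ 1 / 10 := h 2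
  have h4 : |sol b (t, u) 4 y - 1| ≤ 1 / 10 := h 4
  rw [abs_le] at h2 h4
  exact mul_pos (by linarith) (by linarith)

/-- This keeps the solution in the first chart throughout the interval. -/
theorem abs_sol_six_le {b : ℝ} {u : SmoothCircle} (hu : ‖jet 0 u‖ < 1)
    (hu' : ‖jet 0 (SmoothCircle.deriv u)‖ < 1) {t : ℝ}
    (ht : t ∈ Ioo (-lifespan b) (lifespan b)) (y : UnitAddCircle) :
    |sol b (t, u) 6 y| ≤ 1 / 10 := by
  have h := (abs_apply_le _ y).trans (norm_sol_sub_init_le (mem_domain hu hu' ht) 6)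
  have e : init u (SmoothCircle.deriv u) 6 = 0 := rfl
  simpa [e] using h

end Compat

end BEquation

/-! ### Diffeomorphisms from their coordinates -/

namespace DiffCircle

theorem ext {φ ψ : DiffCircle} (h : ∀ x : ℝ, φ.toEquiv (x : UnitAddCircle) = ψ.toEquiv x) :
    φ = ψ := by
  have he : φ.toEquiv = ψ.toEquiv := Equiv.ext fun y => by
    induction y using QuotientAddGroup.induction_on with
    | H x => exact h x
  cases φ; cases ψ
  simpa using he

section OfCoord

variable {ξ : SmoothCircle} (hξ : ∀ y, 0 < (1 + SmoothCircle.deriv ξ) y)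

/-- The lift `id + ξ`. -/
def lift (ξ : SmoothCircle) (x : ℝ) : ℝ := x + ξ (x : UnitAddCircle)

theorem hasDerivAt_lift (ξ : SmoothCircle) (x : ℝ) :
    HasDerivAt (lift ξ) ((1 + SmoothCircle.deriv ξ) (x : UnitAddCircle)) x :=
  (hasDerivAt_id x).add (ξ.hasDerivAt x)

theorem contDiff_lift (ξ : SmoothCircle) : ContDiff ℝ ∞ (lift ξ) :=
  contDiff_id.add ξ.contDiff

theorem lift_add_one (ξ : SmoothCircle) (x : ℝ) : lift ξ (x + 1) = lift ξ x + 1 := by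
  have : ξ ((x + 1 : ℝ) : UnitAddCircle) = ξ (x : UnitAddCircle) := ξ.periodic x
  rw [lift, lift, this]; ring

theorem strictMono_lift (hξ : ∀ y, 0 < (1 + SmoothCircle.deriv ξ) y) : StrictMono (lift ξ) :=
  strictMono_of_deriv_pos fun x => by rw [(hasDerivAt_lift ξ x).deriv]; exact hξ x

theorem surjective_lift (ξ : SmoothCircle) : Function.Surjective (lift ξ) := by
  have hb : ∀ x : ℝ, |ξ (x : UnitAddCircle)| ≤ ‖SmoothCircle.jet 0 ξ‖ := fun x =>
    SmoothCircle.abs_apply_le ξ _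
  refine (contDiff_lift ξ).continuous.surjective ?_ ?_
  · refine tendsto_atTop_mono (fun x => ?_)
      (tendsto_atTop_add_const_right _ (-‖SmoothCircle.jet 0 ξ‖) tendsto_id)
    have := (abs_le.1 (hb x)).1
    simp only [lift, id_eq]; linarith
  · refine tendsto_atBot_mono (fun x => ?_)
      (tendsto_atBot_add_const_right _ (‖SmoothCircle.jet 0 ξ‖) tendsto_id)
    have := (abs_le.1 (hb x)).2
    simp only [lift, id_eq]; linarith

/-- The lift, as an order isomorphism of the real line. -/
noncomputable def liftIso (hξ : ∀ y, 0 < (1 + SmoothCircle.deriv ξ) y) : ℝ ≃o ℝ :=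
  (strictMono_lift hξ).orderIsoOfSurjective _ (surjective_lift ξ)

theorem contDiff_liftIso_symm : ContDiff ℝ ∞ (liftIso hξ).symm := by
  refine (liftIso hξ).toHomeomorph.contDiff_symm_deriv
    (f' := fun x => (1 + SmoothCircle.deriv ξ) (x : UnitAddCircle)) (fun x => (hξ x).ne')
    (fun x => hasDerivAt_lift ξ x) (contDiff_lift ξ)

theorem liftIso_symm_add_one (x : ℝ) : (liftIso hξ).symm (x + 1) = (liftIso hξ).symm x + 1 := by
  rw [OrderIso.symm_apply_eq]
  change _ = lift ξ _
  rw [lift_add_one]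
  change _ = (liftIso hξ) _ + 1
  rw [OrderIso.apply_symm_apply]

theorem liftIso_symm_periodic :
    Function.Periodic (fun x => (((liftIso hξ).symm x : ℝ) : UnitAddCircle)) 1 := fun x => by
  simp only [liftIso_symm_add_one]
  exact AddCircle.coe_add_period 1 _

/-- The diffeomorphism `id + ξ`. -/
noncomputable def ofCoord : DiffCircle where
  toFun y := y + ((ξ y : ℝ) : UnitAddCircle)
  invFun := (liftIso_symm_periodic hξ).lift
  left_inv y := by
    induction y using QuotientAddGroup.induction_on with
    | H x =>
      have e : ((x : ℝ) : UnitAddCircle) + ((ξ (x : UnitAddCircle) : ℝ) : UnitAddCircle)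
          = ((liftIso hξ x : ℝ) : UnitAddCircle) := rfl
      change (liftIso_symm_periodic hξ).lift (((x : ℝ) : UnitAddCircle) + _) = _
      rw [e, Function.Periodic.lift_coe, OrderIso.symm_apply_apply]
  right_inv y := by
    induction y using QuotientAddGroup.induction_on with
    | H x =>
      change (((liftIso hξ).symm x : ℝ) : UnitAddCircle)
        + ((ξ (((liftIso hξ).symm x : ℝ) : UnitAddCircle) : ℝ) : UnitAddCircle) = _
      have e : lift ξ ((liftIso hξ).symm x) = x := (liftIso hξ).apply_symm_apply x
      exact congrArg (fun x : ℝ => (x : UnitAddCircle)) e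
  exists_lift := ⟨lift ξ, contDiff_lift ξ, fun x => by
    rw [(hasDerivAt_lift ξ x).deriv]; exact hξ x, fun x => rfl⟩
  exists_lift_inv := ⟨(liftIso hξ).symm, contDiff_liftIso_symm hξ, fun x => rfl⟩

theorem ofCoord_apply (x : ℝ) : (ofCoord hξ).toEquiv (x : UnitAddCircle)
    = ((x + ξ (x : UnitAddCircle) : ℝ) : UnitAddCircle) := rfl

end OfCoord

end DiffCircle

/-! ### Existence of geodesics and smooth dependence on time and initial velocity -/

namespace BEquation

open SmoothCircle

/-- The diffeomorphism of the solution. -/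
noncomputable def solDiff (b : ℝ) (p : ℝ × SmoothCircle) : DiffCircle :=
  open scoped Classical in
  if h : ∀ y, 0 < (1 + SmoothCircle.deriv (sol b p 6)) y then DiffCircle.ofCoord h
  else DiffCircle.id

theorem solDiff_apply {b : ℝ} {p : ℝ × SmoothCircle} (hp : p ∈ domain b) (x : ℝ) :
    (solDiff b p).toEquiv (x : UnitAddCircle)
      = ((x + sol b p 6 (x : UnitAddCircle) : ℝ) : UnitAddCircle) := by
  rw [solDiff, dif_pos (one_add_deriv_sol_pos hp.2.1 hp.2.2 (abs_lt.1 hp.1))]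
  exact DiffCircle.ofCoord_apply _ x

theorem isCoord_solDiff {b : ℝ} {p : ℝ × SmoothCircle} (hp : p ∈ domain b) :
    DiffCircle.IsCoord 0 (solDiff b p) (sol b p 6) := by
  refine ⟨solDiff_apply hp, ?_⟩
  have h := abs_le.1 (abs_sol_six_le hp.2.1 hp.2.2 (abs_lt.1 hp.1) 0)
  rw [if_pos rfl]
  exact ⟨by linarith, by linarith⟩

theorem smoothOn_solDiff (b : ℝ) : DiffCircle.SmoothOn (solDiff b) (domain b) := by
  intro p hp
  refine ⟨0, univ, isOpen_univ, mem_univ _, fun p => sol b p 6, fun q hq => isCoord_solDiff hq.2, ?_⟩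
  rw [univ_inter]
  exact frechetSmoothOn_sol b 6

theorem FrechetSmoothOn.time_slice {X Y : Type*} [AddCommGroup X] [Module ℝ X] [TopologicalSpace X]
    [AddCommGroup Y] [Module ℝ Y] [TopologicalSpace Y] {f : ℝ × X → Y} {U : Set (ℝ × X)}
    (hf : FrechetSmoothOn f U) {J : Set ℝ} {u : X} (hJ : ∀ t ∈ J, (t, u) ∈ U) :
    FrechetSmoothOn (fun t => f (t, u)) J :=
  hf.comp_affine (ContinuousLinearMap.inl ℝ ℝ X) (g := fun t => (t, u)) (by fun_prop)
    (fun w v => by simp) hJ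

theorem isGeodesic_sol {b : ℝ} {u : SmoothCircle} (hu : ‖jet 0 u‖ < 1)
    (hu' : ‖jet 0 (SmoothCircle.deriv u)‖ < 1) :
    DiffCircle.IsGeodesic b (Ioo (-lifespan b) (lifespan b)) u (fun t => solDiff b (t, u))
      (fun t => sol b (t, u) 0) where
  smooth_fst t ht := by
    refine ⟨0, univ, isOpen_univ, mem_univ _, fun t => sol b (t, u) 6,
      fun s hs => isCoord_solDiff (mem_domain hu hu' hs.2), ?_⟩
    rw [univ_inter]
    exact FrechetSmoothOn.time_slice (frechetSmoothOn_sol b 6) fun t ht => mem_domain hu hu' ht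
  smooth_snd := FrechetSmoothOn.time_slice (frechetSmoothOn_sol b 0)
    fun t ht => mem_domain hu hu' ht
  init_fst := by
    have h0 : (0 : ℝ) ∈ Ioo (-lifespan b) (lifespan b) := by simpa using lifespan_pos b
    refine DiffCircle.ext fun x => ?_
    rw [solDiff_apply (mem_domain hu hu' h0), sol_zero_apply hu hu']
    exact congrArg (fun x : ℝ => (x : UnitAddCircle)) (add_zero x)
  init_snd := sol_zero_apply hu hu' 0
  eq_fst t ht := by
    refine ⟨0, fun t => sol b (t, u) 6, ?_, hasDirDeriv_sol (mem_domain hu hu' ht) 6⟩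
    filter_upwards [isOpen_Ioo.mem_nhds ht] with s hs
    exact isCoord_solDiff (mem_domain hu hu' hs)
  eq_snd t ht := by
    rw [opPConj_eq_force (isCompatible_sol hu hu' ht) (solDiff_apply (mem_domain hu hu' ht))
      (fun y => (one_add_deriv_sol_pos hu hu' ht y).ne')]
    exact hasDirDeriv_sol (mem_domain hu hu' ht) 0

end BEquation

/-! ### Lifting a curve of diffeomorphisms -/

theorem exists_int_eq_of_continuous {f : ℝ → ℝ} (hf : Continuous f) (h : ∀ x, ∃ n : ℤ, f x = n) :
    ∃ n : ℤ, ∀ x, f x = n := by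
  choose n hn using h
  have hc : Continuous n := by
    rw [Int.isClosedEmbedding_coe_real.isInducing.continuous_iff]
    exact hf.congr hn
  exact ⟨n 0, fun x => by rw [hn x, PreconnectedSpace.constant inferInstance hc (x := x) (y := 0)]⟩

theorem UnitAddCircle.exists_int_of_coe_eq {x y : ℝ}
    (h : (x : UnitAddCircle) = (y : UnitAddCircle)) :
    ∃ n : ℤ, x - y = n := by
  rw [← sub_eq_zero, ← AddCircle.coe_sub, AddCircle.coe_eq_zero_iff] at h
  obtain ⟨n, hn⟩ := h
  exact ⟨n, by rw [← hn]; simp⟩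

namespace SmoothCircle

/-- Two continuous lifts differ by a continuous integer-valued function on the line. The smooth lift
passes its smoothness to the one known only to be continuous. -/
theorem exists_int_lift {φ : UnitAddCircle → UnitAddCircle} {Ξ : C(UnitAddCircle, ℝ)}
    {η : SmoothCircle} (h1 : ∀ x : ℝ, φ x = ((x + Ξ (x : UnitAddCircle) : ℝ) : UnitAddCircle))
    (h2 : ∀ x : ℝ, φ x = ((x + η (x : UnitAddCircle) : ℝ) : UnitAddCircle)) :
    ∃ n : ℤ, Ξ = jet 0 (η + (n : ℝ) • 1) := by
  have hc : Continuous fun x : ℝ => Ξ (x : UnitAddCircle) - η (x : UnitAddCircle) :=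
    (Ξ.continuous.comp (AddCircle.continuous_mk' 1)).sub η.contDiff.continuous
  obtain ⟨n, hn⟩ := exists_int_eq_of_continuous hc fun x => by
    obtain ⟨n, hn⟩ := UnitAddCircle.exists_int_of_coe_eq ((h1 x).symm.trans (h2 x))
    exact ⟨n, by rw [← hn]; ring⟩
  refine ⟨n, ?_⟩
  ext y
  induction y using QuotientAddGroup.induction_on with
  | H x =>
    have : Ξ (x : UnitAddCircle) = η (x : UnitAddCircle) + n * 1 := by linarith [hn x]
    exact this

theorem hasDirDeriv_congr {c d : ℝ → SmoothCircle} {t : ℝ} {v : SmoothCircle}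
    (h : HasDirDeriv c t 1 v) (hcd : d =ᶠ[𝓝 t] c) : HasDirDeriv d t 1 v := by
  rw [hasDirDeriv_iff] at h ⊢
  exact fun k => (h k).congr_of_eventuallyEq (hcd.mono fun s hs => congrArg (jet k) hs)

theorem hasDirDeriv_add_const {c : ℝ → SmoothCircle} {t : ℝ} {v : SmoothCircle}
    (h : HasDirDeriv c t 1 v) (a : SmoothCircle) : HasDirDeriv (fun s => c s + a) t 1 v := by
  rw [hasDirDeriv_iff] at h ⊢
  exact fun k => by simpa only [map_add] using (h k).add_const (jet k a)

end SmoothCircle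

namespace DiffCircle

open SmoothCircle

section Lift

variable {r : ℝ} {ψ : ℝ → DiffCircle} {w : ℝ → SmoothCircle}

/-- The lift of a curve of diffeomorphisms is the integral of its velocity. -/
theorem toEquiv_eq_integral (h0 : ψ 0 = DiffCircle.id)
    (hψ : ∀ t ∈ Ioo (-r) r, HasVelocity ψ t (w t)) {Ξ : ℝ → C(UnitAddCircle, ℝ)} (hΞ0 : Ξ 0 = 0)
    (hΞ : ∀ t ∈ Ioo (-r) r, HasDerivAt Ξ (jet 0 (w t)) t) {t : ℝ} (ht : t ∈ Ioo (-r) r) (x : ℝ) :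
    (ψ t).toEquiv (x : UnitAddCircle) = ((x + Ξ t (x : UnitAddCircle) : ℝ) : UnitAddCircle) := by
  have hcoe : ∀ a : ℝ, ((AddCircle.toCircle ((a : ℝ) : UnitAddCircle) : Circle) : ℂ)
      = Complex.exp ((2 * Real.pi * a : ℝ) * Complex.I) := fun a => by
    rw [AddCircle.toCircle_apply_mk, Circle.coe_exp, div_one]
  set y : UnitAddCircle := (x : UnitAddCircle) with hy
  have hE : ∀ (f : ℝ → ℝ) (f' t : ℝ), HasDerivAt f f' t →
      HasDerivAt (fun s => Complex.exp ((2 * Real.pi * (x + f s) : ℝ) * Complex.I))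
        (Complex.exp ((2 * Real.pi * (x + f t) : ℝ) * Complex.I)
          * ((2 * Real.pi * f' : ℝ) * Complex.I)) t := by
    intro f f' t hf
    exact ((((hf.const_add x).const_mul (2 * Real.pi)).ofReal_comp).mul_const Complex.I).cexp
  -- The quotient of `exp(2πi ψ)` by `exp(2πi (x + Ξ))` has zero derivative. The exponential forgets
  -- the integers by which chart coordinates differ, so no chart has to be followed along the curve.
  have hder : ∀ t ∈ Ioo (-r) r, HasDerivAt
      (fun s => ((AddCircle.toCircle ((ψ s).toEquiv y) : Circle) : ℂ)
        * Complex.exp (-((2 * Real.pi * (x + Ξ s y) : ℝ) * Complex.I)) - 1) 0 t := by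
    intro t ht
    obtain ⟨j, η, hη, hηd⟩ := hψ t ht
    have h1 := hE _ _ t (hasDerivAt_apply hηd y)
    have h2 : HasDerivAt (fun s => Ξ s y) (w t y) t :=
      (ContinuousMap.evalCLM ℝ y : C(UnitAddCircle, ℝ) →L[ℝ] ℝ).hasFDerivAt.comp_hasDerivAt t
        (hΞ t ht)
    have h3 := ((((h2.const_add x).const_mul (2 * Real.pi)).ofReal_comp).mul_const Complex.I).fun_neg.cexp
    have h4 : ∀ᶠ s in 𝓝 t, ((AddCircle.toCircle ((ψ s).toEquiv y) : Circle) : ℂ)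
        = Complex.exp ((2 * Real.pi * (x + η s y) : ℝ) * Complex.I) := by
      filter_upwards [hη] with s hs
      rw [hy, hs.1 x, hcoe]
    have h5 := ((h1.congr_of_eventuallyEq h4).fun_mul h3).sub_const 1
    refine h5.congr_deriv ?_
    rw [h4.self_of_nhds]
    push_cast
    ring
  have hzero := eq_zero_of_norm_deriv_le (K := 0) hder (fun t _ => by simp) (by
    rw [h0, hΞ0]
    have : (DiffCircle.id.toEquiv y) = ((x : ℝ) : UnitAddCircle) := rfl
    rw [this, hcoe, ← Complex.exp_add]
    simp) t ht
  apply AddCircle.injective_toCircle one_ne_zero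
  apply Subtype.ext
  rw [hcoe]
  have h1 := sub_eq_zero.1 hzero
  rw [Complex.exp_neg] at h1
  exact (mul_inv_eq_one₀ (Complex.exp_ne_zero _)).1 h1

/-- A curve of diffeomorphisms which starts at the identity and has a velocity lifts to a curve of
smooth functions. -/
theorem exists_lift_curve (hr : 0 < r) (h0 : ψ 0 = DiffCircle.id)
    (hψ : ∀ t ∈ Ioo (-r) r, HasVelocity ψ t (w t))
    (hw : ContinuousOn (fun t => jet 0 (w t)) (Ioo (-r) r)) :
    ∃ ξ : ℝ → SmoothCircle, ξ 0 = 0 ∧ ∀ t ∈ Ioo (-r) r,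
      (∀ x : ℝ, (ψ t).toEquiv (x : UnitAddCircle)
        = ((x + ξ t (x : UnitAddCircle) : ℝ) : UnitAddCircle)) ∧ HasDirDeriv ξ t 1 (w t) := by
  have hmem0 : (0 : ℝ) ∈ Ioo (-r) r := by simpa using hr
  -- The integral is taken in the Banach space `C(S¹)`, where only continuity of `jet 0 (w t)` is
  -- needed; smoothness in space is recovered from the charts.
  set Ξ : ℝ → C(UnitAddCircle, ℝ) := fun t => ∫ s in (0 : ℝ)..t, jet 0 (w s) with hΞ
  have hΞ0 : Ξ 0 = 0 := intervalIntegral.integral_same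
  have hd : ∀ t ∈ Ioo (-r) r, HasDerivAt Ξ (jet 0 (w t)) t := fun t ht =>
    intervalIntegral.integral_hasDerivAt_right
      ((hw.mono ((ordConnected_Ioo).uIcc_subset hmem0 ht)).intervalIntegrable)
      (hw.stronglyMeasurableAtFilter isOpen_Ioo t ht) (hw.continuousAt (isOpen_Ioo.mem_nhds ht))
  have hlift : ∀ t ∈ Ioo (-r) r, ∀ x : ℝ, (ψ t).toEquiv (x : UnitAddCircle)
      = ((x + Ξ t (x : UnitAddCircle) : ℝ) : UnitAddCircle) :=
    fun t ht x => toEquiv_eq_integral h0 hψ hΞ0 hd ht x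
  have hex : ∀ t, ∃ ξ : SmoothCircle, t ∈ Ioo (-r) r → jet 0 ξ = Ξ t := by
    intro t
    by_cases ht : t ∈ Ioo (-r) r
    · obtain ⟨j, η, hη, -⟩ := hψ t ht
      obtain ⟨n, hn⟩ := exists_int_lift (hlift t ht) hη.self_of_nhds.1
      exact ⟨_, fun _ => hn.symm⟩
    · exact ⟨0, fun h => absurd h ht⟩
  choose ξ hξ using hex
  refine ⟨ξ, ?_, fun t ht => ⟨fun x => ?_, ?_⟩⟩
  · apply jet_zero_injective
    rw [hξ 0 hmem0, hΞ0, map_zero]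
  · rw [hlift t ht, ← hξ t ht]; rfl
  · obtain ⟨j, η, hη, hηd⟩ := hψ t ht
    have hn : ∀ᶠ s in 𝓝 t, ∃ n : ℤ, ξ s = η s + (n : ℝ) • 1 := by
      filter_upwards [hη, isOpen_Ioo.mem_nhds ht] with s hs hsJ
      obtain ⟨n, hn⟩ := exists_int_lift (hlift s hsJ) hs.1
      exact ⟨n, jet_zero_injective (by rw [hξ s hsJ, hn])⟩
    obtain ⟨m, hm⟩ := hn.self_of_nhds
    have hcont : ContinuousAt (fun s => Ξ s 0 - η s 0) t := by
      have h1 : ContinuousAt (fun s => Ξ s 0) t :=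
        (ContinuousMap.evalCLM ℝ (0 : UnitAddCircle) :
          C(UnitAddCircle, ℝ) →L[ℝ] ℝ).continuous.continuousAt.comp (hd t ht).continuousAt
      exact h1.sub (hasDerivAt_apply hηd 0).continuousAt
    have hval : ∀ s ∈ Ioo (-r) r, ∀ n : ℤ, ξ s = η s + (n : ℝ) • 1 → Ξ s 0 - η s 0 = n := by
      intro s hs n hn
      rw [← hξ s hs, hn]
      change η s 0 + n * 1 - η s 0 = n
      ring
    refine hasDirDeriv_congr (hasDirDeriv_add_const hηd ((m : ℝ) • 1)) ?_
    -- The integer offset from a chart coordinate varies continuously in time; once it moves by less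
    -- than `1` it is constant. So near `t` the lift is a chart coordinate plus a constant, and has
    -- the same velocity in every jet.
    have hclose := Metric.continuousAt_iff'.1 hcont 1 one_pos
    filter_upwards [hn, isOpen_Ioo.mem_nhds ht, hclose] with s hs hsJ hsc
    obtain ⟨n, hn⟩ := hs
    rw [hval s hsJ n hn, hval t ht m hm, Real.dist_eq, ← Int.cast_sub, ← Int.cast_abs,
      ← Int.cast_one, Int.cast_lt, Int.abs_lt_one_iff, sub_eq_zero] at hsc
    rw [hn, hsc]

/-- A lift of a diffeomorphism has a positive derivative. -/
theorem one_add_deriv_pos {φ : DiffCircle} {ξ : SmoothCircle}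
    (h : ∀ x : ℝ, φ.toEquiv (x : UnitAddCircle) = ((x + ξ (x : UnitAddCircle) : ℝ) : UnitAddCircle))
    (y : UnitAddCircle) : 0 < (1 + SmoothCircle.deriv ξ) y := by
  obtain ⟨f, hf, hfpos, hfl⟩ := φ.exists_lift
  obtain ⟨n, hn⟩ := exists_int_eq_of_continuous
    (hf.continuous.sub (contDiff_lift ξ).continuous) fun x =>
      UnitAddCircle.exists_int_of_coe_eq ((hfl x).symm.trans (h x))
  induction y using QuotientAddGroup.induction_on with
  | H x =>
    have hfe : f = fun x => lift ξ x + n := by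
      funext x
      have h2 : f x - lift ξ x = n := hn x
      linarith
    have h1 := hfpos x
    rw [hfe, ((hasDerivAt_lift ξ x).add_const _).deriv] at h1
    exact h1

end Lift

end DiffCircle

/-! ### Exponentials and inverses of smooth functions -/

namespace SmoothCircle

/-- The exponential of a smooth function. -/
noncomputable def exp (u : SmoothCircle) : SmoothCircle :=
  ⟨fun y => Real.exp (u y), Real.contDiff_exp.comp u.contDiff⟩

theorem deriv_exp (u : SmoothCircle) : deriv (exp u) = deriv u * exp u :=
  ext_real fun x => ((u.hasDerivAt x).exp.deriv).trans (mul_comm _ _)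

/-- Identifies the pointwise exponential with that of the Banach algebra `C(S¹)`, whose derivative
is known. -/
theorem jet_zero_exp (u : SmoothCircle) : jet 0 (exp u) = NormedSpace.exp (jet 0 u) := by
  let _ : NormedAlgebra ℚ C(UnitAddCircle, ℝ) := NormedAlgebra.restrictScalars ℚ ℝ _
  ext y
  have h := NormedSpace.map_exp (ContinuousMap.evalAlgHom ℝ ℝ y : C(UnitAddCircle, ℝ) →ₐ[ℝ] ℝ)
    (ContinuousMap.evalCLM ℝ y : C(UnitAddCircle, ℝ) →L[ℝ] ℝ).continuous (jet 0 u)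
  refine Eq.trans ?_ h.symm
  rw [← Real.exp_eq_exp_ℝ]
  rfl

theorem hasDerivAt_jet_zero_exp {c : ℝ → SmoothCircle} {t : ℝ} {d : SmoothCircle}
    (h : HasDerivAt (fun s => jet 0 (c s)) (jet 0 d) t) :
    HasDerivAt (fun s => jet 0 (exp (c s))) (jet 0 (exp (c t) * d)) t := by
  simp only [jet_zero_exp, jet_zero_mul]
  have h1 := (hasFDerivAt_exp (𝕂 := ℝ) (x := jet 0 (c t))).comp_hasDerivAt t h
  refine h1.congr_deriv ?_
  simp

/-- The inverse of a nonvanishing smooth function. -/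
noncomputable def inv (u : SmoothCircle) (h : ∀ y, u y ≠ 0) : SmoothCircle :=
  ⟨fun y => (u y)⁻¹, u.contDiff.inv fun x => h x⟩

theorem mul_inv (u : SmoothCircle) (h : ∀ y, u y ≠ 0) : u * inv u h = 1 :=
  ext_apply fun y => mul_inv_cancel₀ (h y)

/-- The derivative in time of an inverse. -/
theorem hasDerivAt_jet_zero_inv {c k : ℝ → SmoothCircle} {t : ℝ} {d : SmoothCircle}
    (hk : ∀ᶠ s in 𝓝 t, c s * k s = 1) (h : HasDerivAt (fun s => jet 0 (c s)) (jet 0 d) t) :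
    HasDerivAt (fun s => jet 0 (k s)) (jet 0 (-(k t * d * k t))) t := by
  have hu : ∀ s, c s * k s = 1 → ∃ x : C(UnitAddCircle, ℝ)ˣ, (x : C(UnitAddCircle, ℝ)) = jet 0 (c s)
      ∧ ((x⁻¹ : C(UnitAddCircle, ℝ)ˣ) : C(UnitAddCircle, ℝ)) = jet 0 (k s) := by
    intro s hs
    have h1 : jet 0 (c s) * jet 0 (k s) = 1 := by rw [← jet_zero_mul, hs]; rfl
    exact ⟨⟨jet 0 (c s), jet 0 (k s), h1, by rw [mul_comm, h1]⟩, rfl, rfl⟩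
  have he : ∀ᶠ s in 𝓝 t, jet 0 (k s) = Ring.inverse (jet 0 (c s)) := by
    filter_upwards [hk] with s hs
    obtain ⟨x, hx, hx'⟩ := hu s hs
    rw [← hx, Ring.inverse_unit, hx']
  obtain ⟨x, hx, hx'⟩ := hu t hk.self_of_nhds
  have h1 := (hasFDerivAt_ringInverse (𝕜 := ℝ) x)
  rw [hx] at h1
  have h2 := h1.comp_hasDerivAt t h
  refine (h2.congr_of_eventuallyEq he).congr_deriv ?_
  simp [hx', jet_zero_mul]

theorem hasDerivAt_jet_zero_mul {c k : ℝ → SmoothCircle} {t : ℝ} {d e : SmoothCircle}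
    (hc : HasDerivAt (fun s => jet 0 (c s)) (jet 0 d) t)
    (hk : HasDerivAt (fun s => jet 0 (k s)) (jet 0 e) t) :
    HasDerivAt (fun s => jet 0 (c s * k s)) (jet 0 (d * k t + c t * e)) t := by
  simp only [jet_zero_mul, map_add]
  exact hc.fun_mul hk

/-- At order `0` the inclusion into the completion is isometric for the sup norm, so the difference
quotients have the same size. -/
theorem hasDerivAt_ofSmooth_of_jet {l : {l : ℝ // 0 < l}} {c : ℝ → SmoothCircle} {t : ℝ}
    {d : SmoothCircle} (h : HasDerivAt (fun s => jet 0 (c s)) (jet 0 d) t) :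
    HasDerivAt (fun s => PolyCompl.ofSmooth 0 l (c s)) (PolyCompl.ofSmooth 0 l d) t := by
  rw [hasDerivAt_iff_tendsto] at h ⊢
  refine h.congr fun s => ?_
  rw [← map_sub, ← map_smul, ← map_sub, ← map_sub, ← map_smul, ← map_sub, PolyCompl.norm_ofSmooth]
  rfl

end SmoothCircle

/-! ### Uniqueness of the geodesics -/

namespace BEquation

open SmoothCircle

/-- The unknowns of the geodesic equation, from a velocity `v`, the coordinate `ξ` of a
diffeomorphism and the inverse `κ` of its derivative. -/
noncomputable def unknowns (v ξ κ : SmoothCircle) : Fin 7 → SmoothCircle :=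
  ![v, SmoothCircle.deriv v * κ, SmoothCircle.exp ξ, SmoothCircle.exp (-ξ),
    SmoothCircle.exp (-ξ) * (1 + SmoothCircle.deriv ξ),
    SmoothCircle.exp ξ * (1 + SmoothCircle.deriv ξ), ξ]

theorem exp_mul_exp_neg (ξ : SmoothCircle) : SmoothCircle.exp ξ * SmoothCircle.exp (-ξ) = 1 :=
  ext_apply fun y => by
    change Real.exp (ξ y) * Real.exp (-ξ y) = 1
    rw [← Real.exp_add, add_neg_cancel, Real.exp_zero]

theorem isCompatible_unknowns {v ξ κ : SmoothCircle} (h : (1 + SmoothCircle.deriv ξ) * κ = 1) :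
    IsCompatible (unknowns v ξ κ) where
  deriv_two := deriv_exp ξ
  deriv_three := (deriv_exp (-ξ)).trans (by rw [map_neg, neg_mul]; rfl)
  two_mul_four := by
    change SmoothCircle.exp ξ * (SmoothCircle.exp (-ξ) * (1 + SmoothCircle.deriv ξ)) = _
    rw [← mul_assoc, exp_mul_exp_neg, one_mul]; rfl
  three_mul_five := by
    change SmoothCircle.exp (-ξ) * (SmoothCircle.exp ξ * (1 + SmoothCircle.deriv ξ)) = _
    rw [← mul_assoc, mul_comm (SmoothCircle.exp (-ξ)), exp_mul_exp_neg, one_mul]; rfl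
  deriv_zero := by
    change SmoothCircle.deriv v = SmoothCircle.deriv v * κ * (1 + SmoothCircle.deriv ξ)
    rw [mul_assoc, mul_comm κ, h, mul_one]

/-- The converse passage, from a geodesic to the enlarged system. Only sup norm derivatives of the
seven unknowns are needed, since uniqueness is applied at order `0`. -/
theorem hasDerivAt_unknowns {b : ℝ} {v ξ κ : ℝ → SmoothCircle} {t : ℝ}
    (hκ : ∀ᶠ s in 𝓝 t, (1 + SmoothCircle.deriv (ξ s)) * κ s = 1)
    (hξ : HasDirDeriv ξ t 1 (v t))
    (hv : HasDirDeriv v t 1 (smoothField b (unknowns (v t) (ξ t) (κ t)) 0)) (i : Fin 7) :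
    HasDerivAt (fun s => jet 0 (unknowns (v s) (ξ s) (κ s) i))
      (jet 0 (smoothField b (unknowns (v t) (ξ t) (κ t)) i)) t := by
  set z := unknowns (v t) (ξ t) (κ t) with hz
  have hκt : (1 + SmoothCircle.deriv (ξ t)) * κ t = 1 := hκ.self_of_nhds
  have hc : IsCompatible z := isCompatible_unknowns hκt
  have h0 := hasDirDeriv_iff.1 hv 0
  have h6 := hasDirDeriv_iff.1 hξ 0
  have h6n : HasDerivAt (fun s => jet 0 (-ξ s)) (jet 0 (-v t)) t := by
    simp only [map_neg]; exact h6.fun_neg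
  have hρ : HasDerivAt (fun s => jet 0 (1 + SmoothCircle.deriv (ξ s)))
      (jet 0 (SmoothCircle.deriv (v t))) t := by
    simp only [map_add]; exact (hasDirDeriv_iff.1 (hasDirDeriv_deriv hξ) 0).const_add _
  have h2 := hasDerivAt_jet_zero_exp h6
  have h3 := hasDerivAt_jet_zero_exp h6n
  have hv' := hasDirDeriv_iff.1 (hasDirDeriv_deriv hv) 0
  have h1 := hasDerivAt_jet_zero_mul hv' (hasDerivAt_jet_zero_inv hκ hρ)
  have h4 := hasDerivAt_jet_zero_mul h3 hρ
  have h5 := hasDerivAt_jet_zero_mul h2 hρ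
  have hF : SmoothCircle.deriv (smoothField b z 0) = _ := (map_neg SmoothCircle.deriv _).trans
    (congrArg Neg.neg (deriv_force (b := b) hc.deriv_two hc.deriv_three hc.two_mul_four
      hc.three_mul_five))
  have hv1 : SmoothCircle.deriv (v t) = z 1 * (1 + SmoothCircle.deriv (ξ t)) := hc.deriv_zero
  fin_cases i
  · exact h0
  · refine h1.congr_deriv (congrArg (jet 0) ?_)
    rw [hF]
    change _ = density b z - z 1 * z 1 - pressure b _ _ z
    change -((1 + SmoothCircle.deriv (ξ t)) * _ - (1 + SmoothCircle.deriv (ξ t)) * _) * _ + _ = _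
    rw [hv1]
    -- With `ρ = 1 + ξ_x`, density `D` and pressure `N`, the difference of the sides is `(D - N)(ρ κ
    -- - 1) - z₁² ((ρ κ)² - 1)`, which has the factor `ρ κ - 1`.
    linear_combination (density b z
      - pressure b (SmoothCircle.resolvent 1) (SmoothCircle.resolvent (-1)) z
      - z 1 * z 1 * ((1 + SmoothCircle.deriv (ξ t)) * κ t + 1)) * hκt
  · exact h2.congr_deriv (congrArg (jet 0) (mul_comm _ _))
  · refine h3.congr_deriv (congrArg (jet 0) ?_)
    change SmoothCircle.exp (-ξ t) * -v t = -(v t * SmoothCircle.exp (-ξ t))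
    ring
  · refine h4.congr_deriv (congrArg (jet 0) ?_)
    change _ = (z 1 - v t) * (SmoothCircle.exp (-ξ t) * (1 + SmoothCircle.deriv (ξ t)))
    rw [hv1]
    ring
  · refine h5.congr_deriv (congrArg (jet 0) ?_)
    change _ = (z 1 + v t) * (SmoothCircle.exp (ξ t) * (1 + SmoothCircle.deriv (ξ t)))
    rw [hv1]
    ring
  · exact h6

theorem unknowns_init (u : SmoothCircle) :
    unknowns u 0 1 = init u (SmoothCircle.deriv u) := by
  have h : SmoothCircle.exp 0 = 1 := ext_apply fun y => Real.exp_zero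
  funext i
  fin_cases i <;> simp [unknowns, init, h]

/-- A geodesic coincides with the solution of the geodesic system. -/
theorem eq_sol_of_isGeodesic {b : ℝ} {u : SmoothCircle} (hu : ‖jet 0 u‖ < 1)
    (hu' : ‖jet 0 (SmoothCircle.deriv u)‖ < 1) {ψ : ℝ → DiffCircle} {w : ℝ → SmoothCircle}
    (h : DiffCircle.IsGeodesic b (Ioo (-lifespan b) (lifespan b)) u ψ w) {t : ℝ}
    (ht : t ∈ Ioo (-lifespan b) (lifespan b)) :
    ψ t = solDiff b (t, u) ∧ w t = sol b (t, u) 0 := by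
  have hmem0 : (0 : ℝ) ∈ Ioo (-lifespan b) (lifespan b) := by simpa using lifespan_pos b
  obtain ⟨ξ, hξ0, hξ⟩ := DiffCircle.exists_lift_curve (lifespan_pos b) h.init_fst h.eq_fst
    fun t ht => (hasDirDeriv_iff.1 (h.eq_snd t ht) 0).continuousAt.continuousWithinAt
  have hpos : ∀ t ∈ Ioo (-lifespan b) (lifespan b), ∀ y,
      (1 + SmoothCircle.deriv (ξ t)) y ≠ 0 := fun t ht y =>
    (DiffCircle.one_add_deriv_pos (hξ t ht).1 y).ne'
  have hex : ∀ t, ∃ κ : SmoothCircle, t ∈ Ioo (-lifespan b) (lifespan b) →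
      (1 + SmoothCircle.deriv (ξ t)) * κ = 1 := fun t => by
    by_cases ht : t ∈ Ioo (-lifespan b) (lifespan b)
    · exact ⟨SmoothCircle.inv _ (hpos t ht), fun _ => mul_inv _ _⟩
    · exact ⟨0, fun h => absurd h ht⟩
  choose κ hκ using hex
  have hκ0 : κ 0 = 1 := by simpa [hξ0] using hκ 0 hmem0
  set l : {l : ℝ // 0 < l} := ⟨1, one_pos⟩
  -- Both curves solve the same `C¹` equation in the completion of order `0`. Since the inclusion is
  -- injective, this already determines the smooth functions.
  have key : EqOn (fun s i => PolyCompl.ofSmooth 0 l (unknowns (w s) (ξ s) (κ s) i))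
      (fun s i => PolyCompl.ofSmooth 0 l (sol b (s, u) i)) (Ioo (-lifespan b) (lifespan b)) := by
    refine eqOn_Ioo_of_hasDerivAt (V := complField b 0 l) (contDiff_field b) hmem0
      (fun s hs => ?_) (fun s hs => hasDerivAt_ofSmooth_sol (abs_lt.2 hs) hu hu') ?_
    · rw [complField_ofSmooth]
      refine hasDerivAt_pi.2 fun i => hasDerivAt_ofSmooth_of_jet (hasDerivAt_unknowns
        (eventually_of_mem (isOpen_Ioo.mem_nhds hs) hκ) (hξ s hs).2 ?_ i)
      have hf : DiffCircle.opPConj b (ψ s) (w s) = _ :=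
        opPConj_eq_force (isCompatible_unknowns (v := w s) (hκ s hs)) (hξ s hs).1 (hpos s hs)
      have hs' := h.eq_snd s hs
      rw [hf] at hs'
      exact hs'
    · funext i
      simp only [h.init_snd, hξ0, hκ0, unknowns_init, sol_zero_apply hu hu']
  have hinj : ∀ a c : SmoothCircle, PolyCompl.ofSmooth 0 l a = PolyCompl.ofSmooth 0 l c →
      a = c := fun a c hac => by
    rw [← sub_eq_zero, ← map_sub, ← norm_eq_zero, PolyCompl.norm_ofSmooth] at hac
    have h1 : jet 0 (a - c) = 0 := norm_eq_zero.1 hac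
    rw [map_sub, sub_eq_zero] at h1
    exact jet_zero_injective h1
  have hi := fun i => hinj _ _ (congrFun (key ht) i)
  refine ⟨DiffCircle.ext fun x => ?_, hi 0⟩
  have h6 : ξ t = sol b (t, u) 6 := hi 6
  rw [(hξ t ht).1 x, h6, solDiff_apply (mem_domain hu hu' ht)]

end BEquation

/-! ### Restriction to the domain of the theorem and conclusion -/

theorem FrechetSmoothOn.mono {X Y : Type*} [AddCommGroup X] [Module ℝ X] [TopologicalSpace X]
    [AddCommGroup Y] [Module ℝ Y] [TopologicalSpace Y] {f : X → Y} {U V : Set X}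
    (hf : FrechetSmoothOn f U) (h : V ⊆ U) : FrechetSmoothOn f V := by
  obtain ⟨D, h0, h1, h2⟩ := hf
  exact ⟨D, fun x hx => h0 x (h hx), fun n x hx => h1 n x (h hx),
    fun n => (h2 n).mono (prod_mono_left h)⟩

theorem DiffCircle.SmoothOn.mono {X : Type*} [AddCommGroup X] [Module ℝ X] [TopologicalSpace X]
    {g : X → DiffCircle} {U V : Set X} (hg : SmoothOn g U) (h : V ⊆ U) : SmoothOn g V := by
  intro x hx
  obtain ⟨j, N, hN, hxN, w, hw, hws⟩ := hg x (h hx)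
  exact ⟨j, N, hN, hxN, w, fun y hy => hw y ⟨hy.1, h hy.2⟩, hws.mono (inter_subset_inter_right N h)⟩

theorem SmoothCircle.norm_jet_le_cNorm {k n : ℕ} (hk : k ≤ n) (u : SmoothCircle) :
    ‖jet k u‖ ≤ cNorm n u :=
  Finset.single_le_sum (f := fun k => ‖toContinuousMap (deriv^[k] u)‖) (fun _ _ => norm_nonneg _)
    (Finset.mem_range_succ_iff.2 hk)

theorem theorem5p2 (b : ℝ) :
    ∃ T : ℝ, 0 < T ∧ ∃ δ : ℝ, 0 < δ ∧
      ∃ (φ : ℝ × SmoothCircle → DiffCircle) (v : ℝ × SmoothCircle → SmoothCircle),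
        (∀ u₀ : SmoothCircle, SmoothCircle.cNorm 3 u₀ < δ →
          DiffCircle.IsGeodesic b (Set.Ioo (-T) T) u₀ (fun t => φ (t, u₀)) (fun t => v (t, u₀)) ∧
          ∀ (ψ : ℝ → DiffCircle) (w : ℝ → SmoothCircle),
            DiffCircle.IsGeodesic b (Set.Ioo (-T) T) u₀ ψ w →
              ∀ t ∈ Set.Ioo (-T) T, ψ t = φ (t, u₀) ∧ w t = v (t, u₀)) ∧
        DiffCircle.SmoothOn φ (Set.Ioo (-T) T ×ˢ {u₀ | SmoothCircle.cNorm 3 u₀ < δ}) ∧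
        FrechetSmoothOn v (Set.Ioo (-T) T ×ˢ {u₀ | SmoothCircle.cNorm 3 u₀ < δ}) := by
  -- The choice `δ = 1` suffices: only the sup norms of `u₀` and `u₀'` enter, and the `C³` norm
  -- dominates both.
  have h0 : ∀ u : SmoothCircle, SmoothCircle.cNorm 3 u < 1 → ‖SmoothCircle.jet 0 u‖ < 1 :=
    fun u hu => (SmoothCircle.norm_jet_le_cNorm (by norm_num) u).trans_lt hu
  have h1 : ∀ u : SmoothCircle, SmoothCircle.cNorm 3 u < 1 →
      ‖SmoothCircle.jet 0 (SmoothCircle.deriv u)‖ < 1 :=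
    fun u hu => (SmoothCircle.norm_jet_le_cNorm (k := 1) (by norm_num) u).trans_lt hu
  have hsub : Ioo (-BEquation.lifespan b) (BEquation.lifespan b)
      ×ˢ {u₀ | SmoothCircle.cNorm 3 u₀ < 1} ⊆ BEquation.domain b := fun p hp =>
    BEquation.mem_domain (h0 _ hp.2) (h1 _ hp.2) hp.1
  exact ⟨BEquation.lifespan b, BEquation.lifespan_pos b, 1, one_pos, BEquation.solDiff b,
    fun p => BEquation.sol b p 0, fun u hu => ⟨BEquation.isGeodesic_sol (h0 u hu) (h1 u hu),
      fun ψ w h t ht => BEquation.eq_sol_of_isGeodesic (h0 u hu) (h1 u hu) h ht⟩,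
    (BEquation.smoothOn_solDiff b).mono hsub, (BEquation.frechetSmoothOn_sol b 0).mono hsub⟩
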